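/- Let $\mathbf k$ be a commutative $\mathbb Q$-algebra and $n\ge 1$. All exponentials below are taken in completions of enveloping algebras; for a graded Lie algebra $\mathfrak g$ generated in degree $1$, $\hat{\mathfrak g}^{\mathbf k}$ is the degree completion of $\mathfrak g\otimes\mathbf k$ and $\exp(\hat{\mathfrak g}^{\mathbf k})$ the corresponding prounipotent group. *Groups.* $B_n$ is the braid group with Artin generators $\sigma_1,\dots,\sigma_{n-1}$, mapped to $S_n$ by $\sigma_i\mapsto s_i=(i,i+1)$, and $$\Gamma_{0,n}=B_n/\big((\sigma_1\cdots\sigma_{n-1})^n,\ \sigma_1\cdots\sigma_{n-2}\sigma_{n-1}^2\sigma_{n-2}\cdots\sigma_1\big),$$ which also maps to $S_n$. $\Gamma_{0,n}(\mathbf k)$ is the group of $\mathbf k$-points of the prounipotent completion of $\Gamma_{0,n}$ relative to $\pi:\Gamma_{0,n}\to S_n$: the group of pairs $(g,s)$, where $s\in S_n$ and $g$ is a group-like element of $\varprojlim_m \mathbf k[\Gamma_{0,n}]/J^m$, $J=\ker(\mathbf k[\Gamma_{0,n}]\to\mathbf k[S_n])$, with image $s$ in $\mathbf k[S_n]$.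 It is an extension of $S_n$ by the prounipotent completion of $\ker\pi$ over $\mathbf k$. *Lie algebras.* $\mathfrak t_n$ is the Lie algebra with generators $t_{ij}$ ($i\ne j$ in $\{1,\dots,n\}$) and relations $t_{ji}=t_{ij}$, $[t_{ij},t_{ik}+t_{jk}]=0$ for $i,j,k$ distinct and $[t_{ij},t_{kl}]=0$ for $i,j,k,l$ distinct; $\mathfrak p_n$ is its quotient by the relations $\sum_{j\ne i}t_{ij}=0$ for all $i$. $S_n$ acts on both by permuting indices. $\mathfrak f_2$ is the free Lie algebra on $A,B$. For disjoint $I,J\subset\{1,\dots,n\}$ put $t_{I,J}=\sum_{i\in I,j\in J}t_{ij}$, and for $\Phi\in\exp(\hat{\mathfrak f}_2^{\mathbf k})$ put $\Phi^{I,J,K}=\Phi(t_{I,J},t_{J,K})$. *Associators.* A pair $(\mu,\Phi)\in\mathbf k\times\exp(\hat{\mathfrak f}_2^{\mathbf k})$ is an associator if $\Phi(B,A)=\Phi(A,B)^{-1}$; $e^{\mu A/2}\Phi(C,A)e^{\mu C/2}\Phi(B,C)e^{\mu B/2}\Phi(A,B)=1$ for $C=-A-B$; and, in $\exp(\hat{\mathfrak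 t}_4^{\mathbf k})$, $$\Phi(t_{12},t_{23}+t_{24})\,\Phi(t_{13}+t_{23},t_{34})=\Phi(t_{23},t_{34})\,\Phi(t_{12}+t_{13},t_{24}+t_{34})\,\Phi(t_{12},t_{23}).$$ *The morphism $i_{t,\Phi}$.* Let $t$ be a parenthesization of a word in $n$ letters. If $t$ is left-normed, $t=(\cdots((\bullet\bullet)\bullet)\cdots)\bullet$, then $i_{t,\Phi}:B_n\to\exp(\hat{\mathfrak t}_n^{\mathbf k})\rtimes S_n$ is given by $\sigma_i\mapsto(\Phi^{\{1,\dots,i-1\},\{i\},\{i+1\}})^{-1}e^{\mu t_{i,i+1}/2}s_i\,\Phi^{\{1,\dots,i-1\},\{i\},\{i+1\}}$. In general it is this morphism conjugated as $x\mapsto c_t^{-1}x\,c_t$, where $c_t=c_{0,t}\in\exp(\hat{\mathfrak t}_n^{\mathbf k})$ is the composite of associativity constraints from $t$ to the left-normed word, defined recursively by $c_{a,\bullet}=1$ and $$c_{a,t't''}=c_{a+|t'|,t''}\;c_{a,t'}\;\big(\Phi^{\{1,\dots,a\},\{a+1,\dots,a+|t'|\},\{a+|t'|+1,\dots,a+|t'|+|t''|\}}\big)^{-1}.$$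 **Proposition.** Let $(\mu,\Phi)$ be an associator over $\mathbf k$ and $t$ a parenthesization of a word in $n$ letters. The above formulas define a group morphism $i_{t,\Phi}:B_n\to\exp(\hat{\mathfrak t}_n^{\mathbf k})\rtimes S_n$, and there is a unique group morphism $f:\Gamma_{0,n}\to\exp(\hat{\mathfrak p}_n^{\mathbf k})\rtimes S_n$ such that the composite $B_n\to\Gamma_{0,n}\xrightarrow{f}\exp(\hat{\mathfrak p}_n^{\mathbf k})\rtimes S_n$ equals the composite of $i_{t,\Phi}$ with the projection $\exp(\hat{\mathfrak t}_n^{\mathbf k})\rtimes S_n\to\exp(\hat{\mathfrak p}_n^{\mathbf k})\rtimes S_n$. If $\mu$ is invertible, then $f$ induces an isomorphism $\Gamma_{0,n}(\mathbf k)\xrightarrow{\sim}\exp(\hat{\mathfrak p}_n^{\mathbf k})\rtimes S_n$ over $S_n$, i.e. the unique morphism given by the continuous $\mathbf k$-linear extension of $f$ to the completed group algebra is an isomorphism. -/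

import Mathlib

universe u

noncomputable section

namespace GenusZero

open Finset

/-! ### Adic completion of a possibly noncommutative ring -/

section Completion

variable {A B C : Type*} [Ring A] [Ring B] [Ring C]

/-- The compatible families in `∏ A / J ^ m`. -/
def complSubring (J : Ideal A) [J.IsTwoSided] : Subring (∀ m : ℕ, A ⧸ J ^ m) where
  carrier := {x | ∀ m, Ideal.Quotient.factorPowSucc J m (x (m + 1)) = x m}
  mul_mem' hx hy m := by
    simp only [Set.mem_ofPred_eq] at hx hy
    rw [Pi.mul_apply, Pi.mul_apply, map_mul, hx, hy]
  one_mem' m := by rw [Pi.one_apply, Pi.one_apply, map_one]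
  add_mem' hx hy m := by
    simp only [Set.mem_ofPred_eq] at hx hy
    rw [Pi.add_apply, Pi.add_apply, map_add, hx, hy]
  zero_mem' m := by rw [Pi.zero_apply, Pi.zero_apply, map_zero]
  neg_mem' hx m := by
    simp only [Set.mem_ofPred_eq] at hx
    rw [Pi.neg_apply, Pi.neg_apply, map_neg, hx]

/-- The completion `lim A / J ^ m` of a ring `A` along the powers of a two-sided ideal `J`. -/
def Compl (J : Ideal A) [J.IsTwoSided] : Type _ := complSubring J

instance (J : Ideal A) [J.IsTwoSided] : Ring (Compl J) := inferInstanceAs (Ring (complSubring J))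

/-- The projection `lim A / J ^ m → A / J ^ m`. -/
def Compl.proj {J : Ideal A} [J.IsTwoSided] (m : ℕ) : Compl J →+* A ⧸ J ^ m :=
  (Pi.evalRingHom (fun m : ℕ => A ⧸ J ^ m) m).comp (complSubring J).subtype

theorem Compl.ext {J : Ideal A} [J.IsTwoSided] {x y : Compl J}
    (h : ∀ m, Compl.proj m x = Compl.proj m y) : x = y := Subtype.ext (funext h)

/-- The element of the completion given by a compatible family. -/
def Compl.mk {J : Ideal A} [J.IsTwoSided] (x : ∀ m : ℕ, A ⧸ J ^ m)
    (h : ∀ m, Ideal.Quotient.factorPowSucc J m (x (m + 1)) = x m) : Compl J := ⟨x, h⟩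

@[simp] theorem Compl.proj_mk {J : Ideal A} [J.IsTwoSided] (x : ∀ m : ℕ, A ⧸ J ^ m)
    (h : ∀ m, Ideal.Quotient.factorPowSucc J m (x (m + 1)) = x m) (m : ℕ) :
    Compl.proj m (Compl.mk x h) = x m := rfl

theorem Compl.factor_proj {J : Ideal A} [J.IsTwoSided] (x : Compl J) (m : ℕ) :
    Ideal.Quotient.factorPowSucc J m (Compl.proj (m + 1) x) = Compl.proj m x := x.2 m

theorem pow_le_comap (f : A →+* B) {J : Ideal A} {K : Ideal B} [K.IsTwoSided]
    (h : J ≤ K.comap f) (m : ℕ) : J ^ m ≤ (K ^ m).comap f := by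
  induction m with
  | zero =>
    intro x _
    simp [Submodule.pow_zero, Ideal.one_eq_top]
  | succ m ih =>
    rw [Submodule.pow_succ, Submodule.pow_succ, Ideal.mul_le]
    intro r hr s hs
    rw [Ideal.mem_comap, map_mul]
    exact Ideal.mul_mem_mul (ih hr) (h hs)

/-- The map `A / J ^ m → B / K ^ m` induced by `f : A → B` with `f J ⊆ K`. -/
def levelMap (f : A →+* B) {J : Ideal A} {K : Ideal B} [J.IsTwoSided] [K.IsTwoSided]
    (h : J ≤ K.comap f) (m : ℕ) : A ⧸ J ^ m →+* B ⧸ K ^ m :=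
  Ideal.Quotient.lift (J ^ m) ((Ideal.Quotient.mk (K ^ m)).comp f) fun a ha => by
    rw [RingHom.comp_apply, Ideal.Quotient.eq_zero_iff_mem]
    exact pow_le_comap f h m ha

@[simp] theorem levelMap_mk (f : A →+* B) {J : Ideal A} {K : Ideal B} [J.IsTwoSided]
    [K.IsTwoSided] (h : J ≤ K.comap f) (m : ℕ) (a : A) :
    levelMap f h m (Ideal.Quotient.mk (J ^ m) a) = Ideal.Quotient.mk (K ^ m) (f a) := rfl

/-- The ring morphism between completions induced by `f : A → B` with `f J ⊆ K`. -/
def Compl.map (f : A →+* B) {J : Ideal A} {K : Ideal B} [J.IsTwoSided] [K.IsTwoSided]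
    (h : J ≤ K.comap f) : Compl J →+* Compl K where
  toFun x := Compl.mk (fun m => levelMap f h m (Compl.proj m x)) fun m => by
    have hx := Compl.factor_proj x m
    obtain ⟨a, ha⟩ := Ideal.Quotient.mk_surjective (Compl.proj (m + 1) x)
    rw [← hx, ← ha]
    rfl
  map_one' := Compl.ext fun m => by rw [Compl.proj_mk, map_one, map_one, map_one]
  map_zero' := Compl.ext fun m => by rw [Compl.proj_mk, map_zero, map_zero, map_zero]
  map_mul' x y := Compl.ext fun m => by
    rw [map_mul, Compl.proj_mk, Compl.proj_mk, Compl.proj_mk, map_mul, map_mul]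
  map_add' x y := Compl.ext fun m => by
    rw [map_add, Compl.proj_mk, Compl.proj_mk, Compl.proj_mk, map_add, map_add]

theorem Compl.proj_map (f : A →+* B) {J : Ideal A} {K : Ideal B} [J.IsTwoSided] [K.IsTwoSided]
    (h : J ≤ K.comap f) (x : Compl J) (m : ℕ) :
    Compl.proj m (Compl.map f h x) = levelMap f h m (Compl.proj m x) := rfl

/-- For `ε : A → B`, the map from the completion along `ker ε` to `B` extending `ε`. -/
def Compl.aug (ε : A →+* B) : Compl (RingHom.ker ε) →+* B :=
  (Ideal.Quotient.lift (RingHom.ker ε ^ 1) ε fun a ha => by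
      rwa [Submodule.pow_one] at ha).comp (Compl.proj 1)

end Completion

/-! ### Prounipotent completion relative to a finite quotient -/

section RelativeCompletion

variable (k : Type u) [CommRing k] {G H S T : Type} [Group G] [Group H] [Group S] [Group T]

/-- The linear extension `k[G] → k[S]` of a group morphism `π : G → S`. -/
abbrev groupAlg (π : G →* S) : MonoidAlgebra k G →+* MonoidAlgebra k S :=
  MonoidAlgebra.mapDomainRingHom k π

/-- The completion of `k[G]` along the kernel of `k[G] → k[S]`. -/
abbrev GroupAlgCompl (π : G →* S) : Type u := Compl (RingHom.ker (groupAlg k π))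

variable {k}

theorem ker_groupAlg_le {π : G →* S} {ρ : H →* T} (f : G →* H) (g : S →* T)
    (h : ρ.comp f = g.comp π) :
    RingHom.ker (groupAlg k π) ≤ (RingHom.ker (groupAlg k ρ)).comap (groupAlg k f) := by
  have key : (groupAlg k ρ).comp (groupAlg k f) = (groupAlg k g).comp (groupAlg k π) := by
    rw [← MonoidAlgebra.mapDomainRingHom_comp, ← MonoidAlgebra.mapDomainRingHom_comp, h]
  intro a ha
  rw [Ideal.mem_comap, RingHom.mem_ker, ← RingHom.comp_apply, key, RingHom.comp_apply,
    RingHom.mem_ker.1 ha, map_zero]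

variable (k)

/-- Completed coproduct of `k[G]`, `γ ↦ γ ⊗ γ`; the completed tensor square of
`k[G]` is the completion of `k[G × G]` along the kernel of `k[G × G] → k[S × S]`. -/
def comulHat (π : G →* S) : GroupAlgCompl k π →+* GroupAlgCompl k (π.prodMap π) :=
  Compl.map (groupAlg k ((MonoidHom.id G).prod (MonoidHom.id G)))
    (ker_groupAlg_le _ ((MonoidHom.id S).prod (MonoidHom.id S)) rfl)

/-- The map `a ↦ a ⊗ 1` into the completed tensor square. -/
def inlHat (π : G →* S) : GroupAlgCompl k π →+* GroupAlgCompl k (π.prodMap π) :=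
  Compl.map (groupAlg k (MonoidHom.inl G G))
    (ker_groupAlg_le _ (MonoidHom.inl S S) (by ext <;> simp))

/-- The map `a ↦ 1 ⊗ a` into the completed tensor square. -/
def inrHat (π : G →* S) : GroupAlgCompl k π →+* GroupAlgCompl k (π.prodMap π) :=
  Compl.map (groupAlg k (MonoidHom.inr G G))
    (ker_groupAlg_le _ (MonoidHom.inr S S) (by ext <;> simp))

theorem commute_inl_inr (a b : MonoidAlgebra k G) :
    Commute (groupAlg k (MonoidHom.inl G G) a) (groupAlg k (MonoidHom.inr G G) b) := by
  induction a using MonoidAlgebra.induction_linear with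
  | zero => rw [map_zero]; exact Commute.zero_left _
  | add f g hf hg => rw [map_add]; exact hf.add_left hg
  | single g r =>
    induction b using MonoidAlgebra.induction_linear with
    | zero => rw [map_zero]; exact Commute.zero_right _
    | add f g hf hg => rw [map_add]; exact hf.add_right hg
    | single h s =>
      simp [Commute, SemiconjBy, MonoidAlgebra.single_mul_single, mul_comm]

theorem commute_inlHat_inrHat (π : G →* S) (x y : GroupAlgCompl k π) :
    Commute (inlHat k π x) (inrHat k π y) := by
  refine Compl.ext fun m => ?_
  obtain ⟨a, ha⟩ := Ideal.Quotient.mk_surjective (Compl.proj m x)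
  obtain ⟨b, hb⟩ := Ideal.Quotient.mk_surjective (Compl.proj m y)
  rw [map_mul, map_mul, inlHat, inrHat, Compl.proj_map, Compl.proj_map, ← ha, ← hb, levelMap_mk,
    levelMap_mk, ← map_mul, ← map_mul, (commute_inl_inr k a b).eq]

/-- The group of `k`-points of the prounipotent completion of a group `G` relative to a morphism
`π : G → S` onto a finite group: the group-like elements of the completion of `k[G]` along
`ker (k[G] → k[S])` whose image in `k[S]` is an element `s` of `S`, recorded together with `s`.
For `S = 1` these are the group-like elements of the completion of `k[G]` along its augmentation
ideal, i.e. the `k`-points of the prounipotent (Malcev) completion of `G`; in general this is the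
extension of `S` by the `k`-points of the prounipotent completion of `ker π`. -/
def RelCompletion (π : G →* S) : Subgroup ((GroupAlgCompl k π)ˣ × S) where
  carrier := {p | comulHat k π p.1 = inlHat k π p.1 * inrHat k π p.1 ∧
    Compl.aug (groupAlg k π) p.1 = MonoidAlgebra.of k S p.2}
  one_mem' := by
    refine ⟨?_, ?_⟩
    · simp
    · simp [MonoidAlgebra.one_def]
  mul_mem' {p q} hp hq := by
    refine ⟨?_, ?_⟩
    · simp only [Prod.fst_mul, Units.val_mul, map_mul]
      rw [hp.1, hq.1, mul_assoc, mul_assoc, ← mul_assoc (inrHat k π p.1),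
        ← (commute_inlHat_inrHat k π q.1 p.1).eq, mul_assoc]
    · simp only [Prod.fst_mul, Prod.snd_mul, Units.val_mul, map_mul]
      rw [hp.2, hq.2]
  inv_mem' {p} hp := by
    refine ⟨?_, ?_⟩
    · have h := congrArg (fun u => u⁻¹) (show Units.map (comulHat k π).toMonoidHom p.1 =
        Units.map (inlHat k π).toMonoidHom p.1 * Units.map (inrHat k π).toMonoidHom p.1 from
          Units.ext hp.1)
      simp only [mul_inv_rev, ← map_inv] at h
      have h' := congrArg Units.val h
      simp only [Units.val_mul, Units.coe_map] at h'
      exact h'.trans (commute_inlHat_inrHat k π _ _).eq.symm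
    · have h := congrArg (fun u => u⁻¹) (show
        Units.map (Compl.aug (groupAlg k π)).toMonoidHom p.1 =
          Units.map (MonoidAlgebra.of k S) (toUnits p.2) from Units.ext hp.2)
      simp only [← map_inv] at h
      exact congrArg Units.val h

end RelativeCompletion

/-! ### The group `exp` of a completed Lie algebra -/

section Enveloping

attribute [local instance 100] LieRing.ofAssociativeRing

variable (k : Type u) [CommRing k] (L : Type*) [LieRing L] [LieAlgebra k L]

/-- The augmentation `U(L) → k`. -/
def augU : UniversalEnvelopingAlgebra k L →ₐ[k] k :=
  UniversalEnvelopingAlgebra.lift k (0 : L →ₗ⁅k⁆ k)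

/-- The augmentation ideal of `U(L)`. -/
abbrev augIdeal : Ideal (UniversalEnvelopingAlgebra k L) :=
  RingHom.ker (augU k L : UniversalEnvelopingAlgebra k L →+* k)

/-- The completion of `U(L)` along the powers of its augmentation ideal. If `L` is graded and
generated in degree one, this is the degree completion. -/
abbrev UHat := Compl (augIdeal k L)

/-- Membership in the completed Lie algebra `lim L / L_{≥ m}` inside the completion of `U(L)`. -/
def IsLieElement (x : UHat k L) : Prop :=
  ∀ m, ∃ y : L, Compl.proj m x = Ideal.Quotient.mk (augIdeal k L ^ m) (UniversalEnvelopingAlgebra.ι k y)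

variable {k L} {L' L'' : Type*} [LieRing L'] [LieAlgebra k L'] [LieRing L''] [LieAlgebra k L'']

theorem augU_ι (y : L) : augU k L (UniversalEnvelopingAlgebra.ι k y) = 0 := by
  rw [augU, UniversalEnvelopingAlgebra.lift_ι_apply]; rfl

theorem ι_mem_augIdeal (y : L) : UniversalEnvelopingAlgebra.ι k y ∈ augIdeal k L := augU_ι y

/-- The algebra morphism `U(L) → U(L')` induced by a Lie algebra morphism. -/
def mapU (f : L →ₗ⁅k⁆ L') :
    UniversalEnvelopingAlgebra k L →ₐ[k] UniversalEnvelopingAlgebra k L' :=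
  UniversalEnvelopingAlgebra.lift k ((UniversalEnvelopingAlgebra.ι k).comp f)

theorem mapU_ι (f : L →ₗ⁅k⁆ L') (y : L) :
    mapU f (UniversalEnvelopingAlgebra.ι k y) = UniversalEnvelopingAlgebra.ι k (f y) := by
  rw [mapU, UniversalEnvelopingAlgebra.lift_ι_apply]; rfl

/-- `mapU` as a ring morphism. -/
def mapURing (f : L →ₗ⁅k⁆ L') :
    UniversalEnvelopingAlgebra k L →+* UniversalEnvelopingAlgebra k L' :=
  (mapU f).toRingHom

theorem augU_comp_mapU (f : L →ₗ⁅k⁆ L') : (augU k L').comp (mapU f) = augU k L := by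
  apply UniversalEnvelopingAlgebra.hom_ext
  ext y
  change augU k L' (mapU f (UniversalEnvelopingAlgebra.ι k y)) =
    augU k L (UniversalEnvelopingAlgebra.ι k y)
  rw [mapU_ι, augU_ι, augU_ι]

theorem mapU_id : mapU (LieHom.id : L →ₗ⁅k⁆ L) = AlgHom.id k _ := by
  apply UniversalEnvelopingAlgebra.hom_ext
  ext y
  exact mapU_ι _ y

theorem mapU_comp (g : L' →ₗ⁅k⁆ L'') (f : L →ₗ⁅k⁆ L') :
    mapU (g.comp f) = (mapU g).comp (mapU f) := by
  apply UniversalEnvelopingAlgebra.hom_ext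
  ext y
  change mapU (g.comp f) (UniversalEnvelopingAlgebra.ι k y) =
    mapU g (mapU f (UniversalEnvelopingAlgebra.ι k y))
  rw [mapU_ι, mapU_ι, mapU_ι]; rfl

theorem augIdeal_le_comap (f : L →ₗ⁅k⁆ L') :
    augIdeal k L ≤ (augIdeal k L').comap (mapURing f) := by
  intro a ha
  change augU k L' (mapU f a) = 0
  rw [← AlgHom.comp_apply, augU_comp_mapU]
  exact ha

/-- The morphism of completed enveloping algebras induced by a Lie algebra morphism. -/
def UHat.map (f : L →ₗ⁅k⁆ L') : UHat k L →+* UHat k L' :=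
  Compl.map (mapURing f) (augIdeal_le_comap f)

theorem UHat.map_id : UHat.map (LieHom.id : L →ₗ⁅k⁆ L) = RingHom.id _ := by
  refine RingHom.ext fun x => ?_
  refine Compl.ext fun m => ?_
  rw [UHat.map, Compl.proj_map]
  obtain ⟨a, ha⟩ := Ideal.Quotient.mk_surjective (Compl.proj m x)
  rw [RingHom.id_apply, ← ha, levelMap_mk, mapURing, mapU_id]; rfl

theorem UHat.map_comp (g : L' →ₗ⁅k⁆ L'') (f : L →ₗ⁅k⁆ L') :
    UHat.map (g.comp f) = (UHat.map g).comp (UHat.map f) := by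
  refine RingHom.ext fun x => ?_
  refine Compl.ext fun m => ?_
  rw [RingHom.comp_apply, UHat.map, UHat.map, UHat.map, Compl.proj_map, Compl.proj_map,
    Compl.proj_map]
  obtain ⟨a, ha⟩ := Ideal.Quotient.mk_surjective (Compl.proj m x)
  rw [← ha, levelMap_mk, levelMap_mk, levelMap_mk, mapURing, mapU_comp]; rfl

theorem mk_ι_pow (y : L) (m : ℕ) :
    (Ideal.Quotient.mk (augIdeal k L ^ m) (UniversalEnvelopingAlgebra.ι k y)) ^ m = 0 := by
  rw [← map_pow, Ideal.Quotient.eq_zero_iff_mem]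
  exact Ideal.pow_mem_pow (ι_mem_augIdeal y) m

theorem levelMap_mapU_smul (f : L →ₗ⁅k⁆ L') (m : ℕ) (c : k)
    (z : UniversalEnvelopingAlgebra k L ⧸ augIdeal k L ^ m) :
    levelMap (mapURing f) (augIdeal_le_comap f) m (c • z) =
      c • levelMap (mapURing f) (augIdeal_le_comap f) m z := by
  obtain ⟨a, rfl⟩ := Ideal.Quotient.mk_surjective z
  change Ideal.Quotient.mk _ (mapU f (c • a)) = c • Ideal.Quotient.mk _ (mapU f a)
  rw [map_smul]; rfl

end Enveloping

section ExpGroup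

attribute [local instance 100] LieRing.ofAssociativeRing

/-- The exponential series truncated at order `m`. -/
def truncExp (k : Type u) [CommRing k] [Algebra ℚ k] {A : Type*} [Ring A] [Algebra k A]
    (m : ℕ) (a : A) : A :=
  ∑ j ∈ range m, algebraMap ℚ k ((j.factorial : ℚ)⁻¹) • a ^ j

variable (k : Type u) [CommRing k] [Algebra ℚ k] {L L' L'' : Type*} [LieRing L] [LieAlgebra k L]
  [LieRing L'] [LieAlgebra k L'] [LieRing L''] [LieAlgebra k L'']

/-- `u = exp x` in the completion of `U(L)`, for `x` with zero augmentation: the `m`-th power of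
the `m`-th component of `x` vanishes, so the series may be truncated there. -/
def IsExpOf (u x : UHat k L) : Prop := ∀ m, Compl.proj m u = truncExp k m (Compl.proj m x)

variable (L)

/-- The group `exp` of the completed Lie algebra of `L`, as a subgroup of the units of the completion
of `U(L)`: its elements are the exponentials `exp x` of elements `x` of the completed Lie
algebra. (By the Campbell-Hausdorff formula these are closed under multiplication, so that taking
the generated subgroup adds no element.) -/
def expSubgroup : Subgroup (UHat k L)ˣ :=
  Subgroup.closure {u | ∃ x : UHat k L, IsLieElement k L x ∧ IsExpOf k (u : UHat k L) x}

/-- The group `exp` of the completed Lie algebra of `L`. -/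
def ExpGroup : Type _ := expSubgroup k L

instance : Group (ExpGroup k L) := inferInstanceAs (Group (expSubgroup k L))

variable {k L}

theorem truncExp_mul_neg {A : Type*} [Ring A] [Algebra k A] {m : ℕ} {a : A} (h : a ^ m = 0) :
    truncExp k m a * truncExp k m (-a) = 1 := by
  let _ : Module ℚ A := Module.compHom A (algebraMap ℚ k)
  have h' : (-a) ^ m = 0 := by rw [neg_pow, h, mul_zero]
  have h1 : truncExp k m a = IsNilpotent.exp a := (IsNilpotent.exp_eq_sum h).symm
  have h2 : truncExp k m (-a) = IsNilpotent.exp (-a) := (IsNilpotent.exp_eq_sum h').symm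
  rw [h1, h2, IsNilpotent.exp_mul_exp_neg_self ⟨m, h⟩]

/-- The image of `y ∈ L` in the completion of `U(L)`. -/
def ιHat (y : L) : UHat k L :=
  Compl.mk (fun m => Ideal.Quotient.mk (augIdeal k L ^ m) (UniversalEnvelopingAlgebra.ι k y))
    fun _ => rfl

/-- The exponential of `y ∈ L` in the completion of `U(L)`. -/
def expVal (y : L) : UHat k L :=
  Compl.mk (fun m => truncExp k m
      (Ideal.Quotient.mk (augIdeal k L ^ m) (UniversalEnvelopingAlgebra.ι k y))) fun m => by
    have hs : ∀ (c : k) (z : UniversalEnvelopingAlgebra k L ⧸ augIdeal k L ^ (m + 1)),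
        Ideal.Quotient.factorPowSucc (augIdeal k L) m (c • z) =
          c • Ideal.Quotient.factorPowSucc (augIdeal k L) m z := by
      intro c z
      obtain ⟨a, rfl⟩ := Ideal.Quotient.mk_surjective z
      rfl
    rw [truncExp, map_sum, sum_range_succ]
    simp only [hs, map_pow, Ideal.Quotient.factor_mk, mk_ι_pow, smul_zero, add_zero]
    rfl

theorem expVal_mul_neg (y : L) : expVal (k := k) y * expVal (-y) = 1 := by
  refine Compl.ext fun m => ?_
  rw [map_mul, map_one, expVal, expVal, Compl.proj_mk, Compl.proj_mk, map_neg, map_neg]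
  exact truncExp_mul_neg (mk_ι_pow y m)

/-- The exponential `e^y` of `y ∈ L`, as an element of `exp` of the completed Lie algebra. -/
def expOf (y : L) : ExpGroup k L :=
  ⟨⟨expVal y, expVal (-y), expVal_mul_neg y, by
      simpa only [neg_neg] using expVal_mul_neg (k := k) (-y)⟩,
    Subgroup.subset_closure ⟨ιHat y, fun _ => ⟨y, rfl⟩, fun _ => rfl⟩⟩

/-- The inclusion of the group `exp` into the units of the completion of `U(L)`. -/
def ExpGroup.toUnits : ExpGroup k L →* (UHat k L)ˣ := (expSubgroup k L).subtype

theorem ExpGroup.ext {u v : ExpGroup k L}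
    (h : (ExpGroup.toUnits u).val = (ExpGroup.toUnits v).val) : u = v :=
  Subtype.ext (Units.ext h)

theorem map_mem_expSubgroup (f : L →ₗ⁅k⁆ L') :
    expSubgroup k L ≤ (expSubgroup k L').comap (Units.map (UHat.map f).toMonoidHom) := by
  rw [expSubgroup, Subgroup.closure_le]
  rintro u ⟨x, hx, hu⟩
  refine Subgroup.subset_closure ⟨UHat.map f x, fun m => ?_, fun m => ?_⟩
  · obtain ⟨y, hy⟩ := hx m
    refine ⟨f y, ?_⟩
    rw [UHat.map, Compl.proj_map, hy, levelMap_mk, ← mapU_ι]; rfl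
  · change levelMap _ (augIdeal_le_comap f) m (Compl.proj m (u : UHat k L)) =
      truncExp k m (levelMap _ (augIdeal_le_comap f) m (Compl.proj m x))
    rw [hu m, truncExp, truncExp, map_sum]
    simp only [levelMap_mapU_smul, map_pow]

/-- The group morphism between `exp` groups induced by a Lie algebra morphism. -/
def expMap (f : L →ₗ⁅k⁆ L') : ExpGroup k L →* ExpGroup k L' where
  toFun u := ⟨Units.map (UHat.map f).toMonoidHom u.1, map_mem_expSubgroup f u.2⟩
  map_one' := Subtype.ext (map_one _)
  map_mul' _ _ := Subtype.ext (map_mul _ _ _)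

theorem expMap_val (f : L →ₗ⁅k⁆ L') (u : ExpGroup k L) :
    (ExpGroup.toUnits (expMap f u)).val = UHat.map f (ExpGroup.toUnits u).val := rfl

theorem expMap_id : expMap (LieHom.id : L →ₗ⁅k⁆ L) = MonoidHom.id _ := by
  refine MonoidHom.ext fun u => ExpGroup.ext ?_
  rw [expMap_val, UHat.map_id]; rfl

theorem expMap_comp (g : L' →ₗ⁅k⁆ L'') (f : L →ₗ⁅k⁆ L') :
    expMap (g.comp f) = (expMap g).comp (expMap f) := by
  refine MonoidHom.ext fun u => ExpGroup.ext ?_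
  rw [expMap_val, UHat.map_comp, MonoidHom.comp_apply, expMap_val, expMap_val]; rfl

theorem expMap_eq_of_comp_eq_id {g : L' →ₗ⁅k⁆ L} {f : L →ₗ⁅k⁆ L'} (h : g.comp f = LieHom.id)
    (u : ExpGroup k L) : expMap g (expMap f u) = u := by
  rw [← MonoidHom.comp_apply, ← expMap_comp, h, expMap_id, MonoidHom.id_apply]

/-- The automorphism of `exp` induced by a pair of mutually inverse Lie algebra morphisms. -/
def expAut (f g : L →ₗ⁅k⁆ L) (hgf : g.comp f = LieHom.id) (hfg : f.comp g = LieHom.id) :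
    MulAut (ExpGroup k L) where
  toFun := expMap f
  invFun := expMap g
  left_inv := expMap_eq_of_comp_eq_id hgf
  right_inv := expMap_eq_of_comp_eq_id hfg
  map_mul' := map_mul (expMap f)

/-- An action of a group on `L` by Lie algebra automorphisms induces an action on `exp`. -/
def expAct {S : Type} [Group S] (ρ : S → (L →ₗ⁅k⁆ L)) (h1 : ρ 1 = LieHom.id)
    (hmul : ∀ s t, ρ (s * t) = (ρ s).comp (ρ t)) : S →* MulAut (ExpGroup k L) where
  toFun s := expAut (ρ s) (ρ s⁻¹)
    (by rw [← hmul, inv_mul_cancel, h1]) (by rw [← hmul, mul_inv_cancel, h1])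
  map_one' := MulEquiv.ext fun u => by
    have h : expMap (ρ 1) u = u := by rw [h1, expMap_id, MonoidHom.id_apply]
    exact h
  map_mul' s t := MulEquiv.ext fun u => by
    have h : expMap (ρ (s * t)) u = expMap (ρ s) (expMap (ρ t) u) := by
      rw [hmul, expMap_comp, MonoidHom.comp_apply]
    exact h

end ExpGroup

/-! ### Lie algebras given by relations -/

section LieQuotient

variable (k : Type u) [CommRing k] {L L' : Type*} [LieRing L] [LieAlgebra k L] [LieRing L']
  [LieAlgebra k L']

/-- The quotient of a Lie algebra by the Lie ideal generated by a set. -/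
def LieQuot (R : Set L) : Type _ := L ⧸ LieSubmodule.lieSpan k L R

instance (R : Set L) : LieRing (LieQuot k R) :=
  inferInstanceAs (LieRing (L ⧸ LieSubmodule.lieSpan k L R))

instance (R : Set L) : LieAlgebra k (LieQuot k R) :=
  inferInstanceAs (LieAlgebra k (L ⧸ LieSubmodule.lieSpan k L R))

/-- The quotient map. -/
def LieQuot.mk (R : Set L) : L →ₗ⁅k⁆ LieQuot k R where
  toFun x := LieSubmodule.Quotient.mk (N := LieSubmodule.lieSpan k L R) x
  map_add' _ _ := rfl
  map_smul' _ _ := rfl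
  map_lie' := rfl

theorem LieQuot.mk_surjective (R : Set L) : Function.Surjective (LieQuot.mk k R) :=
  Quot.mk_surjective

variable {k}

/-- A morphism killing the relations factors through the quotient. -/
def LieQuot.lift {R : Set L} (f : L →ₗ⁅k⁆ L') (h : ∀ x ∈ R, f x = 0) :
    LieQuot k R →ₗ⁅k⁆ L' where
  __ := Submodule.liftQ (LieSubmodule.lieSpan k L R).toSubmodule (f : L →ₗ[k] L') (by
    have : LieSubmodule.lieSpan k L R ≤ f.ker := LieSubmodule.lieSpan_le.2 h
    exact this)
  map_lie' {x y} := by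
    obtain ⟨x, rfl⟩ := LieQuot.mk_surjective k R x
    obtain ⟨y, rfl⟩ := LieQuot.mk_surjective k R y
    exact LieHom.map_lie f x y

@[simp] theorem LieQuot.lift_mk {R : Set L} (f : L →ₗ⁅k⁆ L') (h : ∀ x ∈ R, f x = 0) (x : L) :
    LieQuot.lift f h (LieQuot.mk k R x) = f x := rfl

theorem LieQuot.mk_eq_zero {R : Set L} {x : L} (h : x ∈ R) : LieQuot.mk k R x = 0 :=
  (LieSubmodule.Quotient.mk_eq_zero' (N := LieSubmodule.lieSpan k L R)).2
    (LieSubmodule.subset_lieSpan h)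

theorem LieQuot.hom_ext {R : Set L} {f g : LieQuot k R →ₗ⁅k⁆ L'}
    (h : f.comp (LieQuot.mk k R) = g.comp (LieQuot.mk k R)) : f = g := by
  apply LieHom.ext
  intro x
  obtain ⟨x, rfl⟩ := LieQuot.mk_surjective k R x
  exact DFunLike.congr_fun h x

end LieQuotient

/-! ### The Lie algebras `t_n` and `p_n` -/

section DrinfeldKohno

variable (k : Type u) [CommRing k] (n : ℕ)

/-- The defining relations of `t_n`. A generator `t_ii`, set equal to `0`, is added for
convenience. -/
inductive TRel : FreeLieAlgebra k (Fin n × Fin n) → Prop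
  | diag (i : Fin n) : TRel (FreeLieAlgebra.of k (i, i))
  | symm (i j : Fin n) : TRel (FreeLieAlgebra.of k (j, i) - FreeLieAlgebra.of k (i, j))
  | triangle (i j l : Fin n) (hij : i ≠ j) (hil : i ≠ l) (hjl : j ≠ l) :
      TRel ⁅FreeLieAlgebra.of k (i, j), FreeLieAlgebra.of k (i, l) + FreeLieAlgebra.of k (j, l)⁆
  | comm (i j l m : Fin n) (hij : i ≠ j) (hil : i ≠ l) (him : i ≠ m) (hjl : j ≠ l)
      (hjm : j ≠ m) (hlm : l ≠ m) :
      TRel ⁅FreeLieAlgebra.of k (i, j), FreeLieAlgebra.of k (l, m)⁆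

/-- The Lie algebra `t_n` over `k`. -/
def TLie : Type u := LieQuot k {x | TRel k n x}

instance : LieRing (TLie k n) := inferInstanceAs (LieRing (LieQuot k {x | TRel k n x}))

instance : LieAlgebra k (TLie k n) :=
  inferInstanceAs (LieAlgebra k (LieQuot k {x | TRel k n x}))

/-- The quotient map onto `t_n` from the free Lie algebra on its generators. -/
def TLie.mk : FreeLieAlgebra k (Fin n × Fin n) →ₗ⁅k⁆ TLie k n := LieQuot.mk k {x | TRel k n x}

variable {n}

/-- The generator `t_ij` of `t_n`. -/
def tGen (i j : Fin n) : TLie k n := TLie.mk k n (FreeLieAlgebra.of k (i, j))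

variable {k} in
theorem TLie.mk_rel {x : FreeLieAlgebra k (Fin n × Fin n)} (h : TRel k n x) :
    TLie.mk k n x = 0 := LieQuot.mk_eq_zero h

variable {k} in
theorem TLie.hom_ext {L' : Type*} [LieRing L'] [LieAlgebra k L'] {f g : TLie k n →ₗ⁅k⁆ L'}
    (h : ∀ i j, f (tGen k i j) = g (tGen k i j)) : f = g := by
  apply LieQuot.hom_ext
  apply FreeLieAlgebra.hom_ext
  rintro ⟨i, j⟩
  exact h i j

/-- The automorphism of `t_n` with `t_ij ↦ t_{s(i) s(j)}`. -/
def tPerm (s : Equiv.Perm (Fin n)) : TLie k n →ₗ⁅k⁆ TLie k n :=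
  LieQuot.lift (FreeLieAlgebra.lift k fun p => tGen k (s p.1) (s p.2)) (by
    have hof : ∀ i j, FreeLieAlgebra.lift k (fun p : Fin n × Fin n => tGen k (s p.1) (s p.2))
        (FreeLieAlgebra.of k (i, j)) = TLie.mk k n (FreeLieAlgebra.of k (s i, s j)) :=
      fun i j => FreeLieAlgebra.lift_of_apply _ _
    intro x hx
    cases hx with
    | diag i => rw [hof]; exact TLie.mk_rel (.diag _)
    | symm i j => rw [map_sub, hof, hof, ← map_sub]; exact TLie.mk_rel (.symm _ _)
    | triangle i j l hij hil hjl =>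
      rw [LieHom.map_lie, map_add, hof, hof, hof, ← map_add, ← LieHom.map_lie]
      exact TLie.mk_rel (.triangle _ _ _ (s.injective.ne hij) (s.injective.ne hil)
        (s.injective.ne hjl))
    | comm i j l m hij hil him hjl hjm hlm =>
      rw [LieHom.map_lie, hof, hof, ← LieHom.map_lie]
      exact TLie.mk_rel (.comm _ _ _ _ (s.injective.ne hij) (s.injective.ne hil)
        (s.injective.ne him) (s.injective.ne hjl) (s.injective.ne hjm) (s.injective.ne hlm)))

@[simp] theorem tPerm_tGen (s : Equiv.Perm (Fin n)) (i j : Fin n) :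
    tPerm k s (tGen k i j) = tGen k (s i) (s j) := FreeLieAlgebra.lift_of_apply _ _

theorem tPerm_one : tPerm k (1 : Equiv.Perm (Fin n)) = LieHom.id :=
  TLie.hom_ext fun i j => tPerm_tGen k 1 i j

theorem tPerm_mul (s t : Equiv.Perm (Fin n)) : tPerm k (s * t) = (tPerm k s).comp (tPerm k t) :=
  TLie.hom_ext fun i j => by
    rw [LieHom.comp_apply, tPerm_tGen, tPerm_tGen, tPerm_tGen]; rfl

variable (n)

/-- The elements `∑_{j ≠ i} t_ij` of `t_n`. -/
def pRels : Set (TLie k n) := Set.range fun i : Fin n => ∑ j ∈ univ.erase i, tGen k i j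

/-- The Lie algebra `p_n` over `k`: the quotient of `t_n` by the relations
`∑_{j ≠ i} t_ij = 0`. -/
def PLie : Type u := LieQuot k (pRels k n)

instance : LieRing (PLie k n) := inferInstanceAs (LieRing (LieQuot k (pRels k n)))

instance : LieAlgebra k (PLie k n) := inferInstanceAs (LieAlgebra k (LieQuot k (pRels k n)))

/-- The projection `t_n → p_n`. -/
def tToP : TLie k n →ₗ⁅k⁆ PLie k n := LieQuot.mk k (pRels k n)

variable {n}

variable {k} in
theorem PLie.hom_ext {L' : Type*} [LieRing L'] [LieAlgebra k L'] {f g : PLie k n →ₗ⁅k⁆ L'}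
    (h : f.comp (tToP k n) = g.comp (tToP k n)) : f = g := LieQuot.hom_ext h

/-- The automorphism of `p_n` with `t_ij ↦ t_{s(i) s(j)}`. -/
def pPerm (s : Equiv.Perm (Fin n)) : PLie k n →ₗ⁅k⁆ PLie k n :=
  LieQuot.lift ((tToP k n).comp (tPerm k s)) (by
    rintro _ ⟨i, rfl⟩
    have h : tPerm k s (∑ j ∈ univ.erase i, tGen k i j) =
        ∑ j ∈ univ.erase (s i), tGen k (s i) j := by
      rw [map_sum]
      simp only [tPerm_tGen]
      exact sum_bij (fun j _ => s j) (by simp) (by simp)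
        (fun j hj => ⟨s⁻¹ j, by
          simp only [mem_erase, mem_univ, and_true] at hj ⊢
          rintro rfl
          simp at hj, by simp⟩) (by simp)
    change tToP k n (tPerm k s _) = 0
    rw [h]
    exact LieQuot.mk_eq_zero ⟨s i, rfl⟩)

theorem pPerm_comp_tToP (s : Equiv.Perm (Fin n)) :
    (pPerm k s).comp (tToP k n) = (tToP k n).comp (tPerm k s) := rfl

theorem pPerm_one : pPerm k (1 : Equiv.Perm (Fin n)) = LieHom.id :=
  PLie.hom_ext (by rw [pPerm_comp_tToP, tPerm_one]; rfl)

theorem pPerm_mul (s t : Equiv.Perm (Fin n)) : pPerm k (s * t) = (pPerm k s).comp (pPerm k t) :=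
  PLie.hom_ext (by rw [pPerm_comp_tToP, tPerm_mul]; rfl)

variable [Algebra ℚ k] (n)

/-- The group `exp(t̂_n) ⋊ S_n`, where `S_n` acts by permutation of the indices. -/
abbrev ExpT : Type u :=
  ExpGroup k (TLie k n) ⋊[expAct (tPerm k) (tPerm_one k) (tPerm_mul k)] Equiv.Perm (Fin n)

/-- The group `exp(p̂_n) ⋊ S_n`, where `S_n` acts by permutation of the indices. -/
abbrev ExpP : Type u :=
  ExpGroup k (PLie k n) ⋊[expAct (pPerm k) (pPerm_one k) (pPerm_mul k)] Equiv.Perm (Fin n)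

/-- The morphism `exp(t̂_n) ⋊ S_n → exp(p̂_n) ⋊ S_n` induced by `t_n → p_n`. -/
def expTToExpP : ExpT k n →* ExpP k n :=
  SemidirectProduct.map (expMap (tToP k n)) (MonoidHom.id _) fun s => by
    refine MonoidHom.ext fun u => ?_
    change expMap (tToP k n) (expMap (tPerm k s) u) = expMap (pPerm k s) (expMap (tToP k n) u)
    rw [← MonoidHom.comp_apply, ← MonoidHom.comp_apply, ← expMap_comp, ← expMap_comp,
      pPerm_comp_tToP]

end DrinfeldKohno

/-! ### Braid groups and mapping class groups in genus zero -/

section Braids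

variable (n : ℕ)

/-- The Artin relations; the index `i : Fin (n - 1)` stands for `σ_{i+1}`. -/
inductive BraidRel : FreeGroup (Fin (n - 1)) → Prop
  | braid (i j : Fin (n - 1)) (h : (i : ℕ) + 1 = j) :
      BraidRel (FreeGroup.of i * FreeGroup.of j * FreeGroup.of i *
        (FreeGroup.of j * FreeGroup.of i * FreeGroup.of j)⁻¹)
  | far (i j : Fin (n - 1)) (h : (i : ℕ) + 1 < j) :
      BraidRel (FreeGroup.of i * FreeGroup.of j * (FreeGroup.of j * FreeGroup.of i)⁻¹)

/-- The braid group `B_n` of `n` strands in the plane. -/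
abbrev BraidGroup : Type := PresentedGroup {r | BraidRel n r}

variable {n}

/-- The Artin generator `σ_{i+1}` of `B_n`. -/
def sigma (i : Fin (n - 1)) : BraidGroup n := PresentedGroup.of i

/-- The strand at position `i` (counted from `0`) for a generator index `i`. -/
def strand (i : Fin (n - 1)) : Fin n := ⟨i, by omega⟩

/-- The strand following `strand i`. -/
def strandSucc (i : Fin (n - 1)) : Fin n := ⟨i + 1, by omega⟩

/-- The transposition `s_{i+1}` of two consecutive indices. -/
def adjSwap (i : Fin (n - 1)) : Equiv.Perm (Fin n) := Equiv.swap (strand i) (strandSucc i)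

theorem adjSwap_braid (i j : Fin (n - 1)) (h : (i : ℕ) + 1 = j) :
    adjSwap i * adjSwap j * adjSwap i = adjSwap j * adjSwap i * adjSwap j := by
  have e : strandSucc i = strand j := Fin.ext h
  have h1 : strand i ≠ strand j := by simp [strand, Fin.ext_iff]; omega
  have h2 : strand j ≠ strandSucc j := by simp [strand, strandSucc, Fin.ext_iff]
  have h3 : strand i ≠ strandSucc j := by simp [strand, strandSucc, Fin.ext_iff]; omega
  rw [adjSwap, adjSwap, e]
  have k1 := Equiv.swap_mul_swap_mul_swap h2.symm h3.symm
  have k2 := Equiv.swap_mul_swap_mul_swap h1 h3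
  rw [Equiv.swap_comm (strand j) (strand i), Equiv.swap_comm (strandSucc j) (strand j),
    Equiv.swap_comm (strand i) (strandSucc j)] at k1
  rw [k1, k2]

theorem adjSwap_far (i j : Fin (n - 1)) (h : (i : ℕ) + 1 < j) :
    adjSwap i * adjSwap j = adjSwap j * adjSwap i := by
  refine (Equiv.Perm.Disjoint.commute ?_).eq
  have h1 : strand i ≠ strand j := by simp [strand, Fin.ext_iff]; omega
  have h2 : strand i ≠ strandSucc j := by simp [strand, strandSucc, Fin.ext_iff]; omega
  have h3 : strandSucc i ≠ strand j := by simp [strand, strandSucc, Fin.ext_iff]; omega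
  have h4 : strandSucc i ≠ strandSucc j := by simp [strandSucc, Fin.ext_iff]; omega
  intro x
  by_cases hx : x = strand i
  · right; rw [adjSwap, hx]; exact Equiv.swap_apply_of_ne_of_ne h1 h2
  · by_cases hx' : x = strandSucc i
    · right; rw [adjSwap, hx']; exact Equiv.swap_apply_of_ne_of_ne h3 h4
    · left; exact Equiv.swap_apply_of_ne_of_ne hx hx'

variable (n)

/-- The morphism `B_n → S_n`, `σ_i ↦ s_i`. -/
def braidPerm : BraidGroup n →* Equiv.Perm (Fin n) :=
  PresentedGroup.toGroup (f := adjSwap) (by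
    rintro _ (⟨i, j, h⟩ | ⟨i, j, h⟩)
    · simp only [map_mul, map_inv, FreeGroup.lift_apply_of]
      rw [adjSwap_braid i j h, mul_inv_cancel]
    · simp only [map_mul, map_inv, FreeGroup.lift_apply_of]
      rw [adjSwap_far i j h, mul_inv_cancel])

theorem braidPerm_sigma (i : Fin (n - 1)) : braidPerm n (sigma i) = adjSwap i :=
  PresentedGroup.toGroup.of _

/-- The word `σ_1 σ_2 ⋯ σ_{n-1}`. -/
def rhoElt : BraidGroup n := (List.ofFn fun i : Fin (n - 1) => sigma i).prod

/-- The word `σ_{n-1} ⋯ σ_2 σ_1`. -/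
def rhoRev : BraidGroup n := (List.ofFn fun i : Fin (n - 1) => sigma i).reverse.prod

/-- The full twist `(σ_1 ⋯ σ_{n-1})^n` and the sphere word
`σ_1 ⋯ σ_{n-2} σ_{n-1}^2 σ_{n-2} ⋯ σ_1`. -/
def mcgRels : Set (BraidGroup n) := {rhoElt n ^ n, rhoElt n * rhoRev n}

/-- The mapping class group `Γ_{0,n}` of type `(0,n)`. -/
abbrev Gamma : Type := BraidGroup n ⧸ Subgroup.normalClosure (mcgRels n)

/-- The projection `B_n → Γ_{0,n}`. -/
def braidToGamma : BraidGroup n →* Gamma n := QuotientGroup.mk' _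

theorem prod_swap_eq_formPerm {α : Type} [DecidableEq α] (m : ℕ) (f : Fin (m + 1) → α) :
    (List.ofFn fun i : Fin m => Equiv.swap (f i.castSucc) (f i.succ)).prod =
      (List.ofFn f).formPerm := by
  induction m with
  | zero => simp
  | succ m ih =>
    rw [List.ofFn_succ, List.prod_cons, List.ofFn_succ (f := f), List.ofFn_succ,
      List.formPerm_cons_cons]
    have := ih (fun i => f i.succ)
    rw [List.ofFn_succ] at this
    rw [← this]
    rfl

theorem braidPerm_rho_pow : braidPerm n (rhoElt n) ^ n = 1 := by
  cases n with
  | zero => rfl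
  | succ m =>
    have h : braidPerm (m + 1) (rhoElt (m + 1)) = (List.ofFn (id : Fin (m + 1) → _)).formPerm := by
      rw [← prod_swap_eq_formPerm, rhoElt, map_list_prod, List.map_ofFn]
      congr 1
    rw [h]
    have hn : (List.ofFn (id : Fin (m + 1) → _)).Nodup := List.nodup_ofFn.2 fun _ _ h => h
    have := List.formPerm_pow_length_eq_one_of_nodup _ hn
    rwa [List.length_ofFn] at this

theorem braidPerm_sphere : braidPerm n (rhoElt n * rhoRev n) = 1 := by
  have key : ∀ l : List (Fin (n - 1)),
      (l.map adjSwap).prod * (l.map adjSwap).reverse.prod = 1 := by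
    intro l
    induction l with
    | nil => simp
    | cons i l ih =>
      rw [List.map_cons, List.prod_cons, List.reverse_cons, List.prod_append, List.prod_singleton,
        mul_assoc, ← mul_assoc (List.prod _), ih, one_mul, adjSwap, Equiv.swap_mul_self]
  have h := key (List.ofFn id)
  rw [List.map_ofFn] at h
  rw [map_mul, rhoElt, rhoRev, map_list_prod, map_list_prod, List.map_reverse, List.map_ofFn]
  exact h

/-- The morphism `Γ_{0,n} → S_n` induced by `B_n → S_n`. -/
def gammaPerm : Gamma n →* Equiv.Perm (Fin n) :=
  QuotientGroup.lift _ (braidPerm n) (by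
    have h : Subgroup.normalClosure (mcgRels n) ≤ (braidPerm n).ker := by
      apply Subgroup.normalClosure_le_normal
      rintro _ (rfl | rfl)
      · change braidPerm n _ = 1
        rw [map_pow]; exact braidPerm_rho_pow n
      · exact braidPerm_sphere n
    exact h)

end Braids

/-! ### Associators -/

section Associators

variable {k : Type u} [CommRing k] [Algebra ℚ k]

/-- The free Lie algebra `f_2` on two generators. -/
abbrev FreeLie2 (k : Type u) [CommRing k] : Type u := FreeLieAlgebra k (Fin 2)

/-- The substitution `Φ ↦ Φ(x, y)` from `exp(f̂_2)` to `exp(L̂)`, for `x, y ∈ L`. -/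
def substExp {L : Type*} [LieRing L] [LieAlgebra k L] (x y : L) :
    ExpGroup k (FreeLie2 k) →* ExpGroup k L :=
  expMap (FreeLieAlgebra.lift k ![x, y])

/-- `e^{μ x / 2}`. -/
def expHalf {L : Type*} [LieRing L] [LieAlgebra k L] (μ : k) (x : L) : ExpGroup k L :=
  expOf ((μ * algebraMap ℚ k (1 / 2)) • x)

/-- The first generator `A` of `f_2`. -/
def genA (k : Type u) [CommRing k] : FreeLie2 k := FreeLieAlgebra.of k 0

/-- The second generator `B` of `f_2`. -/
def genB (k : Type u) [CommRing k] : FreeLie2 k := FreeLieAlgebra.of k 1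

/-- The element `C = -A - B` of `f_2`. -/
def genC (k : Type u) [CommRing k] : FreeLie2 k := -genA k - genB k

/-- `(μ, Φ)` is a Drinfeld associator over `k`. With strands numbered from `1`, the conditions are
`Φ(B, A) = Φ(A, B)⁻¹`,
`e^{μA/2} Φ(C, A) e^{μC/2} Φ(B, C) e^{μB/2} Φ(A, B) = 1` where `A + B + C = 0`, and
`Φ(t₁₂, t₂₃ + t₂₄) Φ(t₁₃ + t₂₃, t₃₄) = Φ(t₂₃, t₃₄) Φ(t₁₂ + t₁₃, t₂₄ + t₃₄) Φ(t₁₂, t₂₃)`. -/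
structure IsAssociator (μ : k) (Φ : ExpGroup k (FreeLie2 k)) : Prop where
  duality : substExp (genB k) (genA k) Φ = Φ⁻¹
  hexagon : expHalf μ (genA k) * substExp (genC k) (genA k) Φ * expHalf μ (genC k) *
    substExp (genB k) (genC k) Φ * expHalf μ (genB k) * Φ = 1
  pentagon :
    substExp (tGen k (0 : Fin 4) 1) (tGen k 1 2 + tGen k 1 3) Φ *
        substExp (tGen k (0 : Fin 4) 2 + tGen k 1 2) (tGen k 2 3) Φ =
      substExp (tGen k (1 : Fin 4) 2) (tGen k 2 3) Φ *
        substExp (tGen k (0 : Fin 4) 1 + tGen k 0 2) (tGen k 1 3 + tGen k 2 3) Φ *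
        substExp (tGen k (0 : Fin 4) 1) (tGen k 1 2) Φ

/-! ### The morphisms attached to an associator and a parenthesization -/

variable {n : ℕ}

/-- The strands in positions `a, a + 1, …, b - 1` (counted from `0`). -/
def seg (n a b : ℕ) : Finset (Fin n) := univ.filter fun x => a ≤ (x : ℕ) ∧ (x : ℕ) < b

/-- `∑_{i ∈ I, j ∈ J} t_ij`. -/
def tSum (k : Type u) [CommRing k] (I J : Finset (Fin n)) : TLie k n :=
  ∑ i ∈ I, ∑ j ∈ J, tGen k i j

/-- The element `Φ^{I,J,K}` of `exp(t̂_n)`: the associativity constraint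
`(X ⊗ Y) ⊗ Z → X ⊗ (Y ⊗ Z)` for objects `X, Y, Z` whose letters are the blocks of strands
`I, J, K`. -/
def assocElt (Φ : ExpGroup k (FreeLie2 k)) (I J K : Finset (Fin n)) : ExpGroup k (TLie k n) :=
  substExp (tSum k I J) (tSum k J K) Φ

/-- A composite of associativity constraints from `ℓ_a ⊗ t` to `ℓ_{a + |t|}`, where `ℓ_m` is the
word in `m` letters with all parentheses on the left, `ℓ_{m+1} = ℓ_m ⊗ •`, and `ℓ_a` occupies the
strands in positions `0, …, a - 1`. For `t = t' ⊗ t''` it is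
`ℓ_a ⊗ (t' ⊗ t'') → (ℓ_a ⊗ t') ⊗ t'' → ℓ_{a + |t'|} ⊗ t'' → ℓ_{a + |t'| + |t''|}`. -/
def combElt (Φ : ExpGroup k (FreeLie2 k)) (n : ℕ) :
    ℕ → FreeMagma Unit → ExpGroup k (TLie k n)
  | _, .of _ => 1
  | a, .mul t' t'' =>
    combElt Φ n (a + t'.length) t'' * combElt Φ n a t' *
      (assocElt Φ (seg n 0 a) (seg n a (a + t'.length))
        (seg n (a + t'.length) (a + t'.length + t''.length)))⁻¹

/-- The image of `σ_{i+1}` under the morphism attached to `(μ, Φ)` and the word with all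
parentheses on the left: `(Φ^{1…i, i+1, i+2})⁻¹ e^{μ t_{i+1,i+2} / 2} s_{i+1} Φ^{1…i, i+1, i+2}`. -/
def leftImage (μ : k) (Φ : ExpGroup k (FreeLie2 k)) (i : Fin (n - 1)) : ExpT k n :=
  SemidirectProduct.inl (assocElt Φ (seg n 0 i) {strand i} {strandSucc i})⁻¹ *
    SemidirectProduct.inl (expHalf μ (tGen k (strand i) (strandSucc i))) *
    SemidirectProduct.inr (adjSwap i) *
    SemidirectProduct.inl (assocElt Φ (seg n 0 i) {strand i} {strandSucc i})

/-- The image of `σ_{i+1}` under the morphism `i_{t,Φ}` attached to `(μ, Φ)` and a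
parenthesization `t`. -/
def sigmaImage (μ : k) (Φ : ExpGroup k (FreeLie2 k)) (t : FreeMagma Unit) (i : Fin (n - 1)) :
    ExpT k n :=
  SemidirectProduct.inl (combElt Φ n 0 t)⁻¹ * leftImage μ Φ i *
    SemidirectProduct.inl (combElt Φ n 0 t)

end Associators

/-! ### Morphisms out of the relative completion -/

section Induced

variable {k : Type u} [CommRing k] [Algebra ℚ k] {L : Type u} [LieRing L] [LieAlgebra k L]
  {G S : Type} [Group G] [Group S] [DecidableEq S] {φ : S →* MulAut (ExpGroup k L)}

/-- The image of `(u, s) ∈ exp(L̂) ⋊ S` in the level `m` truncation `⊕_{s ∈ S} (U(L) / I ^ m) s`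
of the crossed product of the completion of `U(L)` with `S`. -/
def crossCoord (m : ℕ) (w : ExpGroup k L ⋊[φ] S) :
    S → UniversalEnvelopingAlgebra k L ⧸ augIdeal k L ^ m :=
  Pi.single w.right (Compl.proj m (ExpGroup.toUnits w.left : UHat k L))

/-- `F` is the morphism of relative completions induced by `f`: it is compatible with the
projections to `S`, and is given by the `k`-linear continuous extension of `f`, i.e. if `g` is
represented modulo `J ^ m` by `∑ c_γ γ ∈ k[G]`, then `F g` is represented at level `m` by
`∑ c_γ f(γ)`. -/
def IsInducedBy (π : G →* S) (f : G →* ExpGroup k L ⋊[φ] S)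
    (F : RelCompletion k π → ExpGroup k L ⋊[φ] S) : Prop :=
  (∀ g, (F g).right = g.1.2) ∧
    ∀ (g : RelCompletion k π) (m : ℕ) (a : MonoidAlgebra k G),
      Ideal.Quotient.mk (RingHom.ker (groupAlg k π) ^ m) a =
          Compl.proj m (g.1.1 : GroupAlgCompl k π) →
        crossCoord m (F g) = a.coeff.sum fun γ c => c • crossCoord m (f γ)

end Induced

end GenusZero

end

open GenusZero

/-!
Write `J` for the kernel of `k[Γ] → k[S]`, where `Γ = Γ_{0,n}` and `S = S_n`, and `I` for the
augmentation ideal of the enveloping algebra `U` of `p_n`.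

*The morphism.* The pentagon gives `Φ(x, 0) = 1`, hence `Φ(x, y) = 1` for commuting `x` and `y`
(`IsAssociator.subst_of_commute`), so that the hexagon extends to three elements whose sum is
central (`IsAssociator.hexagon_central`). Together with the pentagon for blocks of strands
(`IsAssociator.pentagon_blocks`), this reduces the braid relation for consecutive crossings to the
case of three strands (`crossing_braid`). The same equations show that the turn of a strand around a
block of strands is sent to the exponential of `μ` times the sum of the corresponding `t_ij`
(`crossing_monodromy`, `leftHom_turn`), and the full twist to the exponential of `μ` times the sum
of all `t_ij` (`leftHom_fullTwist`). For the two relators of the mapping class group these sums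
vanish in `p_n`, so `i_{t,Φ}` descends to `f = gammaHom`. The parenthesization only enters through a
conjugation.

*The isomorphism.* The components of `f` in `exp` define a cocycle on `Γ` with values in the
completion of `U`, and a morphism from `k[Γ]` to the crossed product of this completion with `S`.
The claim is that it induces isomorphisms of `k[Γ] / J ^ m` with `⨁_S U / I ^ m` for all `m`. The
data needed for this are collected in the structure `Expansion`:

* elements of `ker π`, whose images have the leading terms `μ p_ij`, and whose classes span
  `J / J ^ 2` over `S`;
* a morphism `θ` from `p_n` to the associated graded algebra of `J`, mapping `p_ij` to these classes.

Every element of `J ^ m` then has leading terms in `U`, homogeneous of degree `m`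
(`Expansion.hasLead`). If these vanish, then applying `θ` shows that the element belongs to
`J ^ (m + 1)`, which gives injectivity (`Expansion.mem_pow_of_eval_mem`). Successive approximation,
with `μ` invertible, gives surjectivity (`Expansion.exists_eval_sub_mem`).

Group-like elements are transferred by applying this to `Γ × Γ` as well (`Expansion.square`), since
coproducts lie in its completed group algebra. That group-like elements of the completion of `U`
belong to `exp` is reduced by the logarithm to primitive elements
(`IsGradedBy.mem_expSubgroup`). On `U`, graded with generators in degree one, the Dynkin operator
maps a word to the iterated bracket of its letters, and multiplies primitive elements by their
degree; hence primitive elements are Lie elements (`IsGradedBy.exists_ι_of_primitive`). Neither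
freeness nor the Poincaré–Birkhoff–Witt theorem is needed. The conclusion is
`Expansion.existsUnique_isInducedBy`.

*The mapping class group.* No presentation of `ker π` is required. By the Coxeter presentation of
`S_n`, this kernel is generated by the conjugates of the `σ_m ^ 2` (`ker_gammaPerm_le`). The class of
such a conjugate in `J / J ^ 2` depends only on the pair of strands involved
(`Carries.symb_twist`), and these classes satisfy the relations of `p_n` in the associated graded
algebra (`pureSymb_triangle`, `pureSymb_lie_comm`, `sum_pureSymb`), which defines `θ`.
-/

noncomputable section

namespace GenusZero

open Finset

attribute [local instance 100] LieRing.ofAssociativeRing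

/-! ### Exponentials of commuting elements -/

section Exp

variable {k : Type u} [CommRing k]

theorem adjoin_range_ι (L : Type*) [LieRing L] [LieAlgebra k L] :
    Algebra.adjoin k (Set.range (UniversalEnvelopingAlgebra.ι k : L → _)) = ⊤ := by
  set S := Algebra.adjoin k (Set.range (UniversalEnvelopingAlgebra.ι k : L → _)) with hS
  let j : L →ₗ⁅k⁆ S :=
    { toFun := fun x => ⟨UniversalEnvelopingAlgebra.ι k x, Algebra.subset_adjoin ⟨x, rfl⟩⟩
      map_add' := fun x y => Subtype.ext (map_add _ _ _)
      map_smul' := fun c x => Subtype.ext (map_smul _ _ _)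
      map_lie' := fun {x y} => Subtype.ext (LieHom.map_lie _ _ _) }
  have h : S.val.comp (UniversalEnvelopingAlgebra.lift k j) = AlgHom.id k _ := by
    apply UniversalEnvelopingAlgebra.hom_ext
    ext x
    change S.val (UniversalEnvelopingAlgebra.lift k j (UniversalEnvelopingAlgebra.ι k x)) = _
    rw [UniversalEnvelopingAlgebra.lift_ι_apply]; rfl
  refine eq_top_iff.2 fun x _ => ?_
  have := DFunLike.congr_fun h x
  rw [AlgHom.comp_apply] at this
  rw [show x = S.val (UniversalEnvelopingAlgebra.lift k j x) from this.symm]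
  exact Subtype.property _

/-- Elements of an enveloping algebra are obtained from scalars and elements of the Lie algebra by
sums and products. -/
theorem envelopingAlgebra_induction {L : Type*} [LieRing L] [LieAlgebra k L]
    {p : UniversalEnvelopingAlgebra k L → Prop} (hι : ∀ y, p (UniversalEnvelopingAlgebra.ι k y))
    (hc : ∀ c, p (algebraMap k _ c)) (hadd : ∀ x y, p x → p y → p (x + y))
    (hmul : ∀ x y, p x → p y → p (x * y)) (x : UniversalEnvelopingAlgebra k L) : p x := by
  have hx : x ∈ Algebra.adjoin k (Set.range (UniversalEnvelopingAlgebra.ι k : L → _)) := by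
    rw [adjoin_range_ι]; trivial
  refine Algebra.adjoin_induction (p := fun x _ => p x) ?_ hc (fun x y _ _ => hadd x y)
    (fun x y _ _ => hmul x y) hx
  rintro _ ⟨y, rfl⟩
  exact hι y

variable {L L' L'' : Type*} [LieRing L] [LieAlgebra k L] [LieRing L'] [LieAlgebra k L']
  [LieRing L''] [LieAlgebra k L'']

theorem commute_mapU {f : L →ₗ⁅k⁆ L''} {g : L' →ₗ⁅k⁆ L''} (h : ∀ a b, ⁅f a, g b⁆ = 0)
    (p : UniversalEnvelopingAlgebra k L) (q : UniversalEnvelopingAlgebra k L') :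
    Commute (mapU f p) (mapU g q) := by
  induction p using envelopingAlgebra_induction with
  | hc c => rw [AlgHom.commutes]; exact Algebra.commutes _ _
  | hadd x y hx hy => rw [map_add]; exact hx.add_left hy
  | hmul x y hx hy => rw [map_mul]; exact hx.mul_left hy
  | hι a =>
    induction q using envelopingAlgebra_induction with
    | hc c => rw [AlgHom.commutes]; exact (Algebra.commutes _ _).symm
    | hadd x y hx hy => rw [map_add]; exact hx.add_right hy
    | hmul x y hx hy => rw [map_mul]; exact hx.mul_right hy
    | hι b =>
      rw [mapU_ι, mapU_ι, commute_iff_lie_eq, ← LieHom.map_lie, h, map_zero]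

theorem commute_UHat_map {f : L →ₗ⁅k⁆ L''} {g : L' →ₗ⁅k⁆ L''} (h : ∀ a b, ⁅f a, g b⁆ = 0)
    (x : UHat k L) (y : UHat k L') : Commute (UHat.map f x) (UHat.map g y) := by
  refine Compl.ext fun m => ?_
  obtain ⟨a, ha⟩ := Ideal.Quotient.mk_surjective (Compl.proj m x)
  obtain ⟨b, hb⟩ := Ideal.Quotient.mk_surjective (Compl.proj m y)
  rw [map_mul, map_mul, UHat.map, UHat.map, Compl.proj_map, Compl.proj_map, ← ha, ← hb,
    levelMap_mk, levelMap_mk, ← map_mul, ← map_mul]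
  exact congrArg _ (commute_mapU h a b).eq

theorem proj_map_ι (f : L →ₗ⁅k⁆ L') {x : UHat k L} {m : ℕ} {y : L}
    (h : Compl.proj m x = Ideal.Quotient.mk _ (UniversalEnvelopingAlgebra.ι k y)) :
    Compl.proj m (UHat.map f x) = Ideal.Quotient.mk _ (UniversalEnvelopingAlgebra.ι k (f y)) := by
  rw [UHat.map, Compl.proj_map, h, levelMap_mk, ← mapU_ι]; rfl

variable [Algebra ℚ k]

/-- The truncated exponential agrees with the exponential of nilpotent elements. -/
theorem truncExp_eq_exp {A : Type*} [Ring A] [Algebra k A] [Module ℚ A]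
    (hs : ∀ (q : ℚ) (a : A), q • a = algebraMap ℚ k q • a) {m : ℕ} {a : A} (h : a ^ m = 0) :
    truncExp k m a = IsNilpotent.exp a := by
  rw [IsNilpotent.exp_eq_sum h, truncExp]
  exact sum_congr rfl fun j _ => (hs _ _).symm

theorem truncExp_add {A : Type*} [Ring A] [Algebra k A] {m : ℕ} {a b : A} (hc : Commute a b)
    (ha : a ^ m = 0) (hb : b ^ m = 0) (hab : (a + b) ^ m = 0) :
    truncExp k m (a + b) = truncExp k m a * truncExp k m b := by
  let _ : Module ℚ A := Module.compHom A (algebraMap ℚ k)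
  have hs : ∀ (q : ℚ) (a : A), q • a = algebraMap ℚ k q • a := fun _ _ => rfl
  rw [truncExp_eq_exp hs ha, truncExp_eq_exp hs hb, truncExp_eq_exp hs hab,
    IsNilpotent.exp_add_of_commute hc ⟨m, ha⟩ ⟨m, hb⟩]

theorem expMap_commute {f : L →ₗ⁅k⁆ L''} {g : L' →ₗ⁅k⁆ L''} (h : ∀ a b, ⁅f a, g b⁆ = 0)
    (u : ExpGroup k L) (v : ExpGroup k L') : Commute (expMap f u) (expMap g v) :=
  ExpGroup.ext (commute_UHat_map h _ _)

theorem ExpGroup.induction {p : ExpGroup k L → Prop}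
    (hexp : ∀ u x, IsLieElement k L x → IsExpOf k (ExpGroup.toUnits u).val x → p u) (h1 : p 1)
    (hmul : ∀ u v, p u → p v → p (u * v)) (hinv : ∀ u, p u → p u⁻¹) (u : ExpGroup k L) : p u := by
  obtain ⟨u, hu⟩ := u
  refine Subgroup.closure_induction (p := fun u hu => p ⟨u, hu⟩) ?_ h1
    (fun x y hx hy => hmul ⟨x, hx⟩ ⟨y, hy⟩) (fun x hx => hinv ⟨x, hx⟩) hu
  rintro x ⟨y, hy, hxy⟩
  exact hexp _ y hy hxy

theorem isExpOf_map (f : L →ₗ⁅k⁆ L') {u x : UHat k L} (h : IsExpOf k u x) :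
    IsExpOf k (UHat.map f u) (UHat.map f x) := fun m => by
  change levelMap _ (augIdeal_le_comap f) m (Compl.proj m u) =
    truncExp k m (levelMap _ (augIdeal_le_comap f) m (Compl.proj m x))
  rw [h m, truncExp, truncExp, map_sum]
  simp only [levelMap_mapU_smul, map_pow]

/-- If two Lie algebra morphisms have commuting images, their sum is a Lie algebra morphism, and it
is sent to the product by `exp`. -/
theorem expMap_eq_mul {e f g : L →ₗ⁅k⁆ L'} (he : ∀ a, e a = f a + g a)
    (h : ∀ a b, ⁅f a, g b⁆ = 0) (u : ExpGroup k L) : expMap e u = expMap f u * expMap g u := by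
  induction u using ExpGroup.induction with
  | h1 => simp only [map_one, mul_one]
  | hmul u v hu hv =>
    rw [map_mul, map_mul, map_mul, hu, hv, mul_assoc, mul_assoc, ← mul_assoc (expMap g u),
      ← (expMap_commute h v u).eq, mul_assoc]
  | hinv u hu =>
    rw [map_inv, map_inv, map_inv, hu, mul_inv_rev, ← mul_inv_rev, ← mul_inv_rev,
      (expMap_commute h u u).eq]
  | hexp u x hx hu =>
    refine ExpGroup.ext (Compl.ext fun m => ?_)
    rw [map_mul, Units.val_mul, map_mul, expMap_val, expMap_val, expMap_val,
      isExpOf_map e hu m, isExpOf_map f hu m, isExpOf_map g hu m]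
    obtain ⟨y, hy⟩ := hx m
    rw [proj_map_ι e hy, proj_map_ι f hy, proj_map_ι g hy, he, map_add, map_add]
    refine truncExp_add ?_ (mk_ι_pow _ _) (mk_ι_pow _ _) ?_
    · refine Commute.map (f := Ideal.Quotient.mk _) ?_
      rw [commute_iff_lie_eq, ← LieHom.map_lie, h, map_zero]
    · rw [← map_add, ← map_add, mk_ι_pow]

theorem expOf_toUnits (y : L) : (ExpGroup.toUnits (expOf (k := k) y)).val = expVal y := rfl

theorem expMap_expOf (f : L →ₗ⁅k⁆ L') (y : L) : expMap f (expOf (k := k) y) = expOf (f y) := by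
  refine ExpGroup.ext (Compl.ext fun m => ?_)
  rw [expMap_val]
  have := isExpOf_map (k := k) f (u := expVal y) (x := ιHat y) (fun _ => rfl) m
  rw [expOf_toUnits, this, proj_map_ι f rfl]
  rfl

theorem expOf_add {x y : L} (h : ⁅x, y⁆ = 0) : expOf (k := k) (x + y) = expOf x * expOf y := by
  refine ExpGroup.ext (Compl.ext fun m => ?_)
  rw [map_mul, Units.val_mul, map_mul]
  change truncExp k m _ = truncExp k m _ * truncExp k m _
  rw [map_add, map_add]
  refine truncExp_add ?_ (mk_ι_pow _ _) (mk_ι_pow _ _) ?_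
  · refine Commute.map (f := Ideal.Quotient.mk _) ?_
    rw [commute_iff_lie_eq, ← LieHom.map_lie, h, map_zero]
  · rw [← map_add, ← map_add, mk_ι_pow]

theorem expOf_zero : expOf (k := k) (0 : L) = 1 := by
  have h := expOf_add (k := k) (x := (0 : L)) (y := 0) (lie_zero _)
  rwa [add_zero, left_eq_mul] at h

theorem expMap_commute_expOf {f : L →ₗ⁅k⁆ L'} {y : L'} (h : ∀ a, ⁅f a, y⁆ = 0) (u : ExpGroup k L) :
    Commute (expMap f u) (expOf y) := by
  induction u using ExpGroup.induction with
  | h1 => rw [map_one]; exact Commute.one_left _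
  | hmul u v hu hv => rw [map_mul]; exact hu.mul_left hv
  | hinv u hu => rw [map_inv]; exact hu.inv_left
  | hexp u x hx hu =>
    refine ExpGroup.ext (Compl.ext fun m => ?_)
    rw [map_mul, map_mul, Units.val_mul, Units.val_mul, map_mul, map_mul, expMap_val,
      isExpOf_map f hu m]
    obtain ⟨z, hz⟩ := hx m
    rw [proj_map_ι f hz]
    change Commute (truncExp k m _) (truncExp k m _)
    have hc : Commute (Ideal.Quotient.mk (augIdeal k L' ^ m) (UniversalEnvelopingAlgebra.ι k (f z)))
        (Ideal.Quotient.mk (augIdeal k L' ^ m) (UniversalEnvelopingAlgebra.ι k y)) := by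
      refine Commute.map (f := Ideal.Quotient.mk _) ?_
      rw [commute_iff_lie_eq, ← LieHom.map_lie, h, map_zero]
    exact Commute.sum_left _ _ _ fun i _ => Commute.sum_right _ _ _ fun j _ =>
      ((hc.pow_pow _ _).smul_left _).smul_right _

end Exp

/-! ### Lie algebra morphisms out of `t_n` and out of the free Lie algebra -/

section Lifts

variable {k : Type u} [CommRing k]

/-- The Lie algebra morphism out of `t_n` given by elements satisfying the defining relations. -/
def TLie.lift {n : ℕ} {L : Type*} [LieRing L] [LieAlgebra k L] (τ : Fin n → Fin n → L)
    (h0 : ∀ i, τ i i = 0) (hs : ∀ i j, τ j i = τ i j)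
    (ht : ∀ i j l, i ≠ j → i ≠ l → j ≠ l → ⁅τ i j, τ i l + τ j l⁆ = 0)
    (hc : ∀ i j l m, i ≠ j → i ≠ l → i ≠ m → j ≠ l → j ≠ m → l ≠ m → ⁅τ i j, τ l m⁆ = 0) :
    TLie k n →ₗ⁅k⁆ L :=
  LieQuot.lift (FreeLieAlgebra.lift k fun p => τ p.1 p.2) (by
    have hof : ∀ i j, FreeLieAlgebra.lift k (fun p : Fin n × Fin n => τ p.1 p.2)
        (FreeLieAlgebra.of k (i, j)) = τ i j := fun i j => FreeLieAlgebra.lift_of_apply _ _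
    intro x hx
    cases hx with
    | diag i => rw [hof, h0]
    | symm i j => rw [map_sub, hof, hof, hs, sub_self]
    | triangle i j l hij hil hjl => rw [LieHom.map_lie, map_add, hof, hof, hof, ht i j l hij hil hjl]
    | comm i j l m hij hil him hjl hjm hlm =>
      rw [LieHom.map_lie, hof, hof, hc i j l m hij hil him hjl hjm hlm])

theorem TLie.lift_tGen {n : ℕ} {L : Type*} [LieRing L] [LieAlgebra k L] (τ : Fin n → Fin n → L)
    (h0 hs ht hc) (i j : Fin n) : TLie.lift (k := k) τ h0 hs ht hc (tGen k i j) = τ i j :=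
  FreeLieAlgebra.lift_of_apply _ _

variable {L L' : Type*} [LieRing L] [LieAlgebra k L] [LieRing L'] [LieAlgebra k L']

theorem FreeLieAlgebra_lift_mem {X : Type*} (K : LieSubalgebra k L) {x : X → L} (hx : ∀ i, x i ∈ K)
    (a : FreeLieAlgebra k X) : FreeLieAlgebra.lift k x a ∈ K := by
  have h : FreeLieAlgebra.lift k x =
      K.incl.comp (FreeLieAlgebra.lift k fun i => (⟨x i, hx i⟩ : K)) := by
    apply FreeLieAlgebra.hom_ext
    intro i
    rw [LieHom.comp_apply, FreeLieAlgebra.lift_of_apply, FreeLieAlgebra.lift_of_apply]; rfl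
  rw [h]
  exact Subtype.property _

/-- The centralizer of an element. -/
def lieCentralizer (k : Type u) [CommRing k] {L : Type*} [LieRing L] [LieAlgebra k L] (w : L) :
    LieSubalgebra k L where
  carrier := {z | ⁅z, w⁆ = 0}
  add_mem' {a b} ha hb := by
    change ⁅a + b, w⁆ = 0
    rw [add_lie, show ⁅a, w⁆ = 0 from ha, show ⁅b, w⁆ = 0 from hb, add_zero]
  zero_mem' := zero_lie w
  smul_mem' c a ha := by
    change ⁅c • a, w⁆ = 0
    rw [smul_lie, show ⁅a, w⁆ = 0 from ha, smul_zero]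
  lie_mem' {a b} ha hb := by
    change ⁅⁅a, b⁆, w⁆ = 0
    rw [lie_lie, show ⁅a, w⁆ = 0 from ha, show ⁅b, w⁆ = 0 from hb, lie_zero, lie_zero, sub_zero]

theorem lift_lie_eq_zero {x y w : L} (hx : ⁅x, w⁆ = 0) (hy : ⁅y, w⁆ = 0) (a : FreeLie2 k) :
    ⁅FreeLieAlgebra.lift k ![x, y] a, w⁆ = 0 :=
  FreeLieAlgebra_lift_mem (lieCentralizer k w) (x := ![x, y])
    (by intro i; fin_cases i; exacts [hx, hy]) a

theorem lift_lie_lift {x y z w : L} (hxz : ⁅x, z⁆ = 0) (hxw : ⁅x, w⁆ = 0) (hyz : ⁅y, z⁆ = 0)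
    (hyw : ⁅y, w⁆ = 0) (a b : FreeLie2 k) :
    ⁅FreeLieAlgebra.lift k ![x, y] a, FreeLieAlgebra.lift k ![z, w] b⁆ = 0 := by
  refine lift_lie_eq_zero ?_ ?_ a <;> rw [← lie_skew, lift_lie_eq_zero, neg_zero] <;>
    rw [← lie_skew, neg_eq_zero] <;> assumption

theorem comp_lift (f : L →ₗ⁅k⁆ L') (x y : L) :
    f.comp (FreeLieAlgebra.lift k ![x, y]) = FreeLieAlgebra.lift k ![f x, f y] := by
  apply FreeLieAlgebra.hom_ext
  intro i
  rw [LieHom.comp_apply, FreeLieAlgebra.lift_of_apply, FreeLieAlgebra.lift_of_apply]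
  fin_cases i <;> rfl

theorem lift_genA (x y : L) : FreeLieAlgebra.lift k ![x, y] (genA k) = x :=
  FreeLieAlgebra.lift_of_apply _ _

theorem lift_genB (x y : L) : FreeLieAlgebra.lift k ![x, y] (genB k) = y :=
  FreeLieAlgebra.lift_of_apply _ _

end Lifts

/-! ### Consequences of the associator equations -/

section Assoc

variable {k : Type u} [CommRing k] [Algebra ℚ k] {L L' : Type*} [LieRing L] [LieAlgebra k L]
  [LieRing L'] [LieAlgebra k L']

theorem expMap_substExp (f : L →ₗ⁅k⁆ L') (x y : L) (u : ExpGroup k (FreeLie2 k)) :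
    expMap f (substExp x y u) = substExp (f x) (f y) u := by
  rw [substExp, ← MonoidHom.comp_apply, ← expMap_comp, comp_lift]; rfl

theorem expMap_expHalf (f : L →ₗ⁅k⁆ L') (μ : k) (x : L) :
    expMap f (expHalf μ x) = expHalf μ (f x) := by
  rw [expHalf, expMap_expOf, map_smul]; rfl

theorem expHalf_add (μ : k) {x y : L} (h : ⁅x, y⁆ = 0) :
    expHalf μ (x + y) = expHalf μ x * expHalf μ y := by
  rw [expHalf, smul_add, expOf_add (by rw [smul_lie, lie_smul, h, smul_zero, smul_zero])]; rfl

theorem expHalf_zero (μ : k) : expHalf μ (0 : L) = 1 := by rw [expHalf, smul_zero, expOf_zero]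

theorem commute_expHalf (μ : k) {x y : L} (h : ⁅x, y⁆ = 0) :
    Commute (expHalf μ x) (expHalf μ y) := by
  have h' : ⁅y, x⁆ = 0 := by rw [← lie_skew, h, neg_zero]
  change _ * _ = _ * _
  rw [← expHalf_add μ h, ← expHalf_add μ h', add_comm]

theorem commute_substExp_expHalf (μ : k) {x y z : L} (hx : ⁅x, z⁆ = 0) (hy : ⁅y, z⁆ = 0)
    (u : ExpGroup k (FreeLie2 k)) : Commute (substExp x y u) (expHalf μ z) :=
  expMap_commute_expOf (fun a => by
    rw [lie_smul, lift_lie_eq_zero hx hy, smul_zero]) u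

theorem commute_substExp {x y z w : L} (hxz : ⁅x, z⁆ = 0) (hxw : ⁅x, w⁆ = 0) (hyz : ⁅y, z⁆ = 0)
    (hyw : ⁅y, w⁆ = 0) (u v : ExpGroup k (FreeLie2 k)) :
    Commute (substExp x y u) (substExp z w v) :=
  expMap_commute (lift_lie_lift hxz hxw hyz hyw) u v

theorem substExp_add {x y z w : L} (hxz : ⁅x, z⁆ = 0) (hxw : ⁅x, w⁆ = 0) (hyz : ⁅y, z⁆ = 0)
    (hyw : ⁅y, w⁆ = 0) (u : ExpGroup k (FreeLie2 k)) :
    substExp (x + z) (y + w) u = substExp x y u * substExp z w u := by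
  have hl := lift_lie_lift (k := k) hxz hxw hyz hyw
  let s : FreeLie2 k →ₗ⁅k⁆ L :=
    { toLinearMap := (FreeLieAlgebra.lift k ![x, y] : FreeLie2 k →ₗ[k] L) +
        (FreeLieAlgebra.lift k ![z, w] : FreeLie2 k →ₗ[k] L)
      map_lie' := fun {a b} => by
        change FreeLieAlgebra.lift k ![x, y] ⁅a, b⁆ + FreeLieAlgebra.lift k ![z, w] ⁅a, b⁆ =
          ⁅FreeLieAlgebra.lift k ![x, y] a + FreeLieAlgebra.lift k ![z, w] a,
            FreeLieAlgebra.lift k ![x, y] b + FreeLieAlgebra.lift k ![z, w] b⁆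
        rw [lie_add, add_lie, add_lie, hl, ← lie_skew (FreeLieAlgebra.lift k ![z, w] a), hl,
          LieHom.map_lie, LieHom.map_lie]
        simp }
  have hs : FreeLieAlgebra.lift k ![x + z, y + w] = s := by
    apply FreeLieAlgebra.hom_ext
    intro i
    change _ = FreeLieAlgebra.lift k ![x, y] (FreeLieAlgebra.of k i) +
      FreeLieAlgebra.lift k ![z, w] (FreeLieAlgebra.of k i)
    rw [FreeLieAlgebra.lift_of_apply, FreeLieAlgebra.lift_of_apply, FreeLieAlgebra.lift_of_apply]
    fin_cases i <;> rfl
  rw [substExp, hs]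
  exact expMap_eq_mul (fun _ => rfl) hl u

namespace IsAssociator

variable {μ : k} {Φ : ExpGroup k (FreeLie2 k)}

theorem subst_swap (hΦ : IsAssociator μ Φ) (x y : L) : substExp y x Φ = (substExp x y Φ)⁻¹ := by
  have h := congrArg (substExp x y) hΦ.duality
  rw [map_inv] at h
  rw [← h, substExp, substExp, substExp, ← MonoidHom.comp_apply, ← expMap_comp, comp_lift,
    lift_genA, lift_genB]

/-- Sending `t₁₂` to `x` and the other generators of `t₄` to `0` turns the pentagon equation into
`Φ(x, 0) Φ(0, 0) = Φ(0, 0) Φ(x, 0) Φ(x, 0)`, where `Φ(0, 0) = 1`. -/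
theorem subst_zero_right (hΦ : IsAssociator μ Φ) (x : L) : substExp x 0 Φ = 1 := by
  let τ : Fin 4 → Fin 4 → L := fun i j => if i < 2 ∧ j < 2 ∧ i ≠ j then x else 0
  have hτ : ∀ i j l m, ⁅τ i j, τ l m⁆ = 0 := by
    intro i j l m
    simp only [τ]
    split_ifs <;> simp
  let f : TLie k 4 →ₗ⁅k⁆ L := TLie.lift τ (by simp [τ])
    (fun i j => by simp only [τ]; congr 1; exact propext (by tauto))
    (fun i j l _ _ _ => by rw [lie_add, hτ, hτ, add_zero])
    (fun i j l m _ _ _ _ _ _ => hτ i j l m)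
  have hf : ∀ i j, f (tGen k i j) = τ i j := TLie.lift_tGen _ _ _ _ _
  have h := congrArg (expMap f) hΦ.pentagon
  simp only [map_mul, expMap_substExp, map_add, hf] at h
  have e01 : τ 0 1 = x := by simp [τ]
  have e12 : τ 1 2 = 0 := by simp [τ]
  have e13 : τ 1 3 = 0 := by simp [τ]
  have e02 : τ 0 2 = 0 := by simp [τ]
  have e23 : τ 2 3 = 0 := by simp [τ]
  rw [e01, e12, e13, e02, e23, add_zero, add_zero] at h
  have h00 : substExp (0 : L) 0 Φ = 1 := by
    have := substExp_add (x := (0 : L)) (y := 0) (z := 0) (w := 0) (lie_zero _) (lie_zero _)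
      (lie_zero _) (lie_zero _) Φ
    rwa [add_zero, left_eq_mul] at this
  rwa [h00, mul_one, one_mul, left_eq_mul] at h

/-- If `x` and `y` commute, then `Φ(x, y) = Φ(x, 0) Φ(0, y)`, and both factors are trivial. -/
theorem subst_of_commute (hΦ : IsAssociator μ Φ) {x y : L} (h : ⁅x, y⁆ = 0) :
    substExp x y Φ = 1 := by
  have := substExp_add (x := x) (y := 0) (z := 0) (w := y) (lie_zero _) h (lie_zero _)
    (zero_lie _) Φ
  rw [add_zero, zero_add] at this
  rw [this, hΦ.subst_zero_right, hΦ.subst_swap, hΦ.subst_zero_right, inv_one, one_mul]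

/-- The associator is unchanged by shifting its arguments by central elements. -/
theorem subst_add_central (hΦ : IsAssociator μ Φ) {x y z w : L} (hxz : ⁅x, z⁆ = 0)
    (hxw : ⁅x, w⁆ = 0) (hyz : ⁅y, z⁆ = 0) (hyw : ⁅y, w⁆ = 0) (hzw : ⁅z, w⁆ = 0) :
    substExp (x + z) (y + w) Φ = substExp x y Φ := by
  rw [substExp_add hxz hxw hyz hyw, hΦ.subst_of_commute hzw, mul_one]

/-- The hexagon equation for three elements whose sum is central. -/
theorem hexagon_central (hΦ : IsAssociator μ Φ) {x y z T : L} (hT : T = x + y + z)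
    (hx : ⁅x, T⁆ = 0) (hy : ⁅y, T⁆ = 0) (hz : ⁅z, T⁆ = 0) :
    expHalf μ x * substExp z x Φ * expHalf μ z * substExp y z Φ * expHalf μ y * substExp x y Φ =
      expHalf μ T := by
  have h := congrArg (expMap (FreeLieAlgebra.lift k ![x, y])) hΦ.hexagon
  have hC : FreeLieAlgebra.lift k ![x, y] (genC k) = z + -T := by
    rw [genC, map_sub, map_neg, lift_genA, lift_genB, hT]; abel
  have hxT : ⁅x, -T⁆ = 0 := by rw [lie_neg, hx, neg_zero]
  have hyT : ⁅y, -T⁆ = 0 := by rw [lie_neg, hy, neg_zero]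
  have hzT : ⁅z, -T⁆ = 0 := by rw [lie_neg, hz, neg_zero]
  simp only [map_mul, map_one, expMap_substExp, expMap_expHalf, hC, lift_genA, lift_genB] at h
  have h1 : substExp (z + -T) x Φ = substExp z x Φ := by
    have := hΦ.subst_add_central (x := z) (y := x) (z := -T) (w := 0) hzT (lie_zero _) hxT
      (lie_zero _) (lie_zero _)
    rwa [add_zero] at this
  have h2 : substExp y (z + -T) Φ = substExp y z Φ := by
    have := hΦ.subst_add_central (x := y) (y := z) (z := 0) (w := -T) (lie_zero _) hyT (lie_zero _)
      hzT (zero_lie _)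
    rwa [add_zero] at this
  have hTT : ⁅-T, T⁆ = 0 := by rw [neg_lie, lie_self, neg_zero]
  have h3 : expHalf μ (-T) * expHalf μ T = 1 := by
    rw [← expHalf_add μ hTT, neg_add_cancel, expHalf_zero]
  have h4 : substExp x y Φ = expMap (FreeLieAlgebra.lift k ![x, y]) Φ := rfl
  rw [h1, h2, expHalf_add μ hzT, ← h4] at h
  have c1 := (commute_substExp_expHalf μ hyT hzT Φ).eq
  have c2 := (commute_expHalf μ hyT).eq
  have c3 := (commute_substExp_expHalf μ hxT hyT Φ).eq
  rw [← mul_left_inj (expHalf μ T), one_mul] at h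
  rw [← h]
  simp only [mul_assoc]
  rw [← mul_assoc (expHalf μ (-T)) (substExp y z Φ), ← c1, mul_assoc (substExp y z Φ),
    ← mul_assoc (expHalf μ (-T)) (expHalf μ y), ← c2, mul_assoc (expHalf μ y),
    ← mul_assoc (expHalf μ (-T)) (substExp x y Φ), ← c3, mul_assoc (substExp x y Φ), h3, mul_one]

end IsAssociator

end Assoc

/-! ### Sums of generators of `t_n` over blocks of strands -/

section Blocks

variable {k : Type u} [CommRing k] {n : ℕ}

theorem tGen_self (i : Fin n) : tGen k i i = 0 := TLie.mk_rel (.diag i)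

theorem tGen_symm (i j : Fin n) : tGen k i j = tGen k j i := by
  have h := TLie.mk_rel (k := k) (.symm j i)
  rw [map_sub, sub_eq_zero] at h
  exact h

theorem tGen_triangle {i j l : Fin n} (hij : i ≠ j) (hil : i ≠ l) (hjl : j ≠ l) :
    ⁅tGen k i j, tGen k i l + tGen k j l⁆ = 0 := by
  have h := TLie.mk_rel (k := k) (.triangle i j l hij hil hjl)
  rwa [LieHom.map_lie, map_add] at h

theorem tGen_comm {i j l m : Fin n} (hil : i ≠ l) (him : i ≠ m) (hjl : j ≠ l) (hjm : j ≠ m) :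
    ⁅tGen k i j, tGen k l m⁆ = 0 := by
  by_cases hij : i = j
  · rw [hij, tGen_self, zero_lie]
  by_cases hlm : l = m
  · rw [hlm, tGen_self, lie_zero]
  have h := TLie.mk_rel (k := k) (.comm i j l m hij hil him hjl hjm hlm)
  rwa [LieHom.map_lie] at h

theorem tSum_singleton (i j : Fin n) : tSum k {i} {j} = tGen k i j := by
  rw [tSum, sum_singleton, sum_singleton]

theorem tSum_comm (I J : Finset (Fin n)) : tSum k I J = tSum k J I := by
  rw [tSum, sum_comm, tSum]
  exact sum_congr rfl fun i _ => sum_congr rfl fun j _ => tGen_symm _ _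

theorem tSum_union_left {I J : Finset (Fin n)} (h : Disjoint I J) (K : Finset (Fin n)) :
    tSum k (I ∪ J) K = tSum k I K + tSum k J K := sum_union h

theorem tSum_union_right {J K : Finset (Fin n)} (h : Disjoint J K) (I : Finset (Fin n)) :
    tSum k I (J ∪ K) = tSum k I J + tSum k I K := by
  rw [tSum_comm, tSum_union_left h, tSum_comm J, tSum_comm K]

theorem tSum_empty (J : Finset (Fin n)) : tSum k ∅ J = 0 := sum_empty

theorem tPerm_tSum (s : Equiv.Perm (Fin n)) (I J : Finset (Fin n)) :
    tPerm k s (tSum k I J) = tSum k (I.map s.toEmbedding) (J.map s.toEmbedding) := by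
  simp only [tSum, map_sum, tPerm_tGen, sum_map]
  rfl

/-- The generator `t_ij` commutes with the sum of all `t_mk`, `m ∈ M`, if `i, j ∈ M`. -/
theorem lie_tGen_tSum {i j : Fin n} {M K : Finset (Fin n)} (hi : i ∈ M) (hj : j ∈ M)
    (hMK : Disjoint M K) : ⁅tGen k i j, tSum k M K⁆ = 0 := by
  by_cases hij : i = j
  · rw [hij, tGen_self, zero_lie]
  rw [tSum, sum_comm, lie_sum]
  refine sum_eq_zero fun l hl => ?_
  have hlM : ∀ m ∈ M, m ≠ l := fun m hm => disjoint_iff_ne.1 hMK m hm l hl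
  rw [← add_sum_erase _ _ hi, ← add_sum_erase _ _ (mem_erase.2 ⟨Ne.symm hij, hj⟩), ← add_assoc,
    lie_add, tGen_triangle hij (hlM i hi) (hlM j hj), zero_add, lie_sum]
  refine sum_eq_zero fun m hm => ?_
  rw [mem_erase, mem_erase] at hm
  exact tGen_comm hm.2.1.symm (hlM i hi) hm.1.symm (hlM j hj)

theorem lie_tSum_tSum {I J M K : Finset (Fin n)} (hI : I ⊆ M) (hJ : J ⊆ M) (hMK : Disjoint M K) :
    ⁅tSum k I J, tSum k M K⁆ = 0 := by
  rw [tSum, sum_lie]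
  refine sum_eq_zero fun i hi => ?_
  rw [sum_lie]
  exact sum_eq_zero fun j hj => lie_tGen_tSum (hI hi) (hJ hj) hMK

theorem lie_tSum_disjoint {I J K L : Finset (Fin n)} (hIK : Disjoint I K) (hIL : Disjoint I L)
    (hJK : Disjoint J K) (hJL : Disjoint J L) : ⁅tSum k I J, tSum k K L⁆ = 0 := by
  simp only [tSum, sum_lie, lie_sum]
  refine sum_eq_zero fun i hi => sum_eq_zero fun j hj => sum_eq_zero fun l hl =>
    sum_eq_zero fun m hm => ?_
  rw [disjoint_iff_ne] at hIK hIL hJK hJL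
  exact tGen_comm (hIK _ (by assumption) _ (by assumption)) (hIL _ (by assumption) _ (by assumption))
    (hJK _ (by assumption) _ (by assumption)) (hJL _ (by assumption) _ (by assumption))

/-- The sum `t_IJ + t_JK + t_IK` commutes with `t_IJ`. -/
theorem lie_tSum_total {I J K : Finset (Fin n)} (hIJ : Disjoint I J) (hIK : Disjoint I K)
    (hJK : Disjoint J K) : ⁅tSum k I J, tSum k I J + tSum k J K + tSum k I K⁆ = 0 := by
  have h : tSum k I J + tSum k J K + tSum k I K = tSum k I J + tSum k (I ∪ J) K := by
    rw [tSum_union_left hIJ]; abel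
  rw [h, lie_add, lie_self, zero_add]
  exact lie_tSum_tSum subset_union_left subset_union_right (disjoint_union_left.2 ⟨hIK, hJK⟩)

end Blocks

section BlockEquations

variable {k : Type u} [CommRing k] [Algebra ℚ k] {n : ℕ} {μ : k} {Φ : ExpGroup k (FreeLie2 k)}

/-- The image of the pentagon equation under the morphism `t₄ → t_n` attached to four disjoint blocks
of strands, which sends a generator to the sum of the `t_ij` over the two blocks. -/
theorem IsAssociator.pentagon_blocks (hΦ : IsAssociator μ Φ) {I J K L : Finset (Fin n)}
    (hIJ : Disjoint I J) (hIK : Disjoint I K) (hIL : Disjoint I L) (hJK : Disjoint J K)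
    (hJL : Disjoint J L) (hKL : Disjoint K L) :
    assocElt Φ I J (K ∪ L) * assocElt Φ (I ∪ J) K L =
      assocElt Φ J K L * assocElt Φ I (J ∪ K) L * assocElt Φ I J K := by
  let B : Fin 4 → Finset (Fin n) := ![I, J, K, L]
  have hB : ∀ i j, i ≠ j → Disjoint (B i) (B j) := by
    intro i j hij
    fin_cases i <;> fin_cases j <;> first | exact absurd rfl hij | assumption |
      (apply Disjoint.symm; assumption)
  let τ : Fin 4 → Fin 4 → TLie k n := fun i j => if i = j then 0 else tSum k (B i) (B j)
  have hτ : ∀ i j, i ≠ j → τ i j = tSum k (B i) (B j) := fun i j h => if_neg h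
  let f : TLie k 4 →ₗ⁅k⁆ TLie k n := TLie.lift τ (fun i => if_pos rfl)
    (fun i j => by
      by_cases h : i = j
      · rw [h]
      · rw [hτ _ _ h, hτ _ _ (Ne.symm h), tSum_comm])
    (fun i j l h1 h2 h3 => by
      rw [hτ _ _ h1, hτ _ _ h2, hτ _ _ h3, ← tSum_union_left (hB _ _ h1)]
      exact lie_tSum_tSum subset_union_left subset_union_right
        (disjoint_union_left.2 ⟨hB _ _ h2, hB _ _ h3⟩))
    (fun i j l m h1 h2 h3 h4 h5 h6 => by
      rw [hτ _ _ h1, hτ _ _ h6]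
      exact lie_tSum_disjoint (hB _ _ h2) (hB _ _ h3) (hB _ _ h4) (hB _ _ h5))
  have hf : ∀ i j, f (tGen k i j) = τ i j := TLie.lift_tGen _ _ _ _ _
  have h := congrArg (expMap f) hΦ.pentagon
  simp only [map_mul, expMap_substExp, map_add, hf] at h
  have e01 : τ 0 1 = tSum k I J := hτ 0 1 (by decide)
  have e02 : τ 0 2 = tSum k I K := hτ 0 2 (by decide)
  have e12 : τ 1 2 = tSum k J K := hτ 1 2 (by decide)
  have e13 : τ 1 3 = tSum k J L := hτ 1 3 (by decide)
  have e23 : τ 2 3 = tSum k K L := hτ 2 3 (by decide)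
  rw [e01, e02, e12, e13, e23] at h
  rw [assocElt, assocElt, assocElt, assocElt, assocElt, tSum_union_left hIJ, tSum_union_left hJK,
    tSum_union_right hKL, tSum_union_right hJK, h]

/-- The hexagon equation for three disjoint blocks of strands. -/
theorem IsAssociator.hexagon_blocks (hΦ : IsAssociator μ Φ) {I J K : Finset (Fin n)}
    (hIJ : Disjoint I J) (hIK : Disjoint I K) (hJK : Disjoint J K) :
    expHalf μ (tSum k I J) * substExp (tSum k I K) (tSum k I J) Φ * expHalf μ (tSum k I K) *
        substExp (tSum k J K) (tSum k I K) Φ * expHalf μ (tSum k J K) *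
        substExp (tSum k I J) (tSum k J K) Φ =
      expHalf μ (tSum k I J + tSum k J K + tSum k I K) := by
  have h1 := lie_tSum_total (k := k) hIJ hIK hJK
  have h2 := lie_tSum_total (k := k) hJK hIJ.symm hIK.symm
  have h3 := lie_tSum_total (k := k) hIK.symm hJK.symm hIJ
  rw [tSum_comm K I, tSum_comm J I] at h2
  rw [tSum_comm K I, tSum_comm K J] at h3
  refine hΦ.hexagon_central rfl h1 ?_ ?_
  · rw [← h2]; congr 1; abel
  · rw [← h3]; congr 1; abel

end BlockEquations

/-! ### The semidirect product `exp(t̂_n) ⋊ S_n` -/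

section Semidirect

variable {k : Type u} [CommRing k] [Algebra ℚ k] {n : ℕ} {μ : k} {Φ : ExpGroup k (FreeLie2 k)}

theorem ExpT.mul_left (x y : ExpT k n) :
    (x * y).left = x.left * expMap (tPerm k x.right) y.left := rfl

theorem ExpT.commute_inr_inl {s : Equiv.Perm (Fin n)} {g : ExpGroup k (TLie k n)}
    (h : expMap (tPerm k s) g = g) :
    Commute (SemidirectProduct.inr s : ExpT k n) (SemidirectProduct.inl g) := by
  refine SemidirectProduct.ext ?_ ?_
  · rw [ExpT.mul_left, ExpT.mul_left]
    simp [h]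
  · simp

theorem map_swap_singleton_left (p q : Fin n) :
    ({p} : Finset (Fin n)).map (Equiv.swap p q).toEmbedding = {q} := by
  simp

theorem map_swap_singleton_right (p q : Fin n) :
    ({q} : Finset (Fin n)).map (Equiv.swap p q).toEmbedding = {p} := by
  simp

theorem map_swap_of_notMem {p q : Fin n} {I : Finset (Fin n)} (hp : p ∉ I) (hq : q ∉ I) :
    I.map (Equiv.swap p q).toEmbedding = I := by
  ext x
  simp only [mem_map_equiv, Equiv.symm_swap]
  by_cases hxp : x = p
  · rw [hxp, Equiv.swap_apply_left]; tauto
  by_cases hxq : x = q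
  · rw [hxq, Equiv.swap_apply_right]; tauto
  rw [Equiv.swap_apply_of_ne_of_ne hxp hxq]

theorem map_swap_of_mem {p q : Fin n} {I : Finset (Fin n)} (hp : p ∈ I) (hq : q ∈ I) :
    I.map (Equiv.swap p q).toEmbedding = I := by
  ext x
  simp only [mem_map_equiv, Equiv.symm_swap]
  by_cases hxp : x = p
  · rw [hxp, Equiv.swap_apply_left]; tauto
  by_cases hxq : x = q
  · rw [hxq, Equiv.swap_apply_right]; tauto
  rw [Equiv.swap_apply_of_ne_of_ne hxp hxq]

end Semidirect

/-! ### The braid relations -/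

section Swap

variable {k : Type u} [CommRing k] {n : ℕ} {I : Finset (Fin n)} {p q : Fin n}

theorem tPerm_swap_left (hp : p ∉ I) (hq : q ∉ I) :
    tPerm k (Equiv.swap p q) (tSum k I {p}) = tSum k I {q} := by
  rw [tPerm_tSum, map_swap_of_notMem hp hq, map_swap_singleton_left]

theorem tPerm_swap_right (hp : p ∉ I) (hq : q ∉ I) :
    tPerm k (Equiv.swap p q) (tSum k I {q}) = tSum k I {p} := by
  rw [tPerm_tSum, map_swap_of_notMem hp hq, map_swap_singleton_right]

theorem tPerm_swap_mid (p q : Fin n) :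
    tPerm k (Equiv.swap p q) (tSum k {p} {q}) = tSum k {p} {q} := by
  rw [tPerm_tSum, map_swap_singleton_left, map_swap_singleton_right, tSum_comm]

end Swap

section Crossing

variable {k : Type u} [CommRing k] [Algebra ℚ k] {n : ℕ} {μ : k} {Φ : ExpGroup k (FreeLie2 k)}

/-- The half twist `e^{μ t_pq / 2} (p q)` of two strands. -/
def halfTwist (μ : k) (p q : Fin n) : ExpT k n :=
  SemidirectProduct.inl (expHalf μ (tSum k {p} {q})) * SemidirectProduct.inr (Equiv.swap p q)

/-- The half twist of the strands `p, q` to the right of a block `I`, conjugated by the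
associativity constraint. -/
def crossing (μ : k) (Φ : ExpGroup k (FreeLie2 k)) (I : Finset (Fin n)) (p q : Fin n) :
    ExpT k n :=
  SemidirectProduct.inl (assocElt Φ I {p} {q})⁻¹ * halfTwist μ p q *
    SemidirectProduct.inl (assocElt Φ I {p} {q})

theorem leftImage_eq_crossing (i : Fin (n - 1)) :
    leftImage μ Φ i = crossing μ Φ (seg n 0 i) (strand i) (strandSucc i) := by
  rw [leftImage, crossing, halfTwist, tSum_singleton, adjSwap, mul_assoc (SemidirectProduct.inl _)]

variable {I : Finset (Fin n)} {p q r : Fin n}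

theorem crossing_left (hp : p ∉ I) (hq : q ∉ I) :
    (crossing μ Φ I p q).left = (substExp (tSum k I {p}) (tSum k {p} {q}) Φ)⁻¹ *
      expHalf μ (tSum k {p} {q}) * substExp (tSum k I {q}) (tSum k {p} {q}) Φ := by
  have h : expMap (tPerm k (Equiv.swap p q)) (assocElt Φ I {p} {q}) =
      substExp (tSum k I {q}) (tSum k {p} {q}) Φ := by
    rw [assocElt, expMap_substExp, tPerm_swap_left hp hq, tPerm_swap_mid]
  rw [← h]
  simp only [crossing, halfTwist, ExpT.mul_left, assocElt]
  simp [tPerm_one, expMap_id]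

theorem crossing_right : (crossing μ Φ I p q).right = Equiv.swap p q := by
  simp [crossing, halfTwist]

theorem halfTwist_left : (halfTwist μ p q).left = expHalf μ (tSum k {p} {q}) := by
  simp only [halfTwist, ExpT.mul_left]
  simp

theorem halfTwist_right : (halfTwist μ p q).right = Equiv.swap p q := by
  simp [halfTwist]

theorem swap_braid (hpq : p ≠ q) (hpr : p ≠ r) (hqr : q ≠ r) :
    Equiv.swap p q * Equiv.swap q r * Equiv.swap p q =
      Equiv.swap q r * Equiv.swap p q * Equiv.swap q r := by
  have k1 := Equiv.swap_mul_swap_mul_swap hqr.symm hpr.symm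
  have k2 := Equiv.swap_mul_swap_mul_swap hpq hpr
  rw [Equiv.swap_comm q p, Equiv.swap_comm r q, Equiv.swap_comm p r] at k1
  rw [k1, k2]

/-- The braid relation for three strands, a consequence of the hexagon equation. -/
theorem braid_three (hΦ : IsAssociator μ Φ) (hpq : p ≠ q) (hpr : p ≠ r) (hqr : q ≠ r) :
    halfTwist μ p q * crossing μ Φ {p} q r * halfTwist μ p q =
      crossing μ Φ {p} q r * halfTwist μ p q * crossing μ Φ {p} q r := by
  have dpq : Disjoint ({p} : Finset (Fin n)) {q} := disjoint_singleton.2 hpq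
  have dpr : Disjoint ({p} : Finset (Fin n)) {r} := disjoint_singleton.2 hpr
  have dqr : Disjoint ({q} : Finset (Fin n)) {r} := disjoint_singleton.2 hqr
  have hex1 := hΦ.hexagon_blocks dpq dpr dqr
  have hex2 := hΦ.hexagon_blocks dqr.symm dpr.symm dpq.symm
  have hT := lie_tSum_total (k := k) dpq dpr dqr
  have hT' := lie_tSum_total (k := k) dqr.symm dpr.symm dpq.symm
  rw [tSum_comm {r} {q}, tSum_comm {r} {p}, tSum_comm {q} {p}] at hex2 hT'
  have s1A : tPerm k (Equiv.swap p q) (tSum k {p} {q}) = tSum k {p} {q} := tPerm_swap_mid _ _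
  have s1B : tPerm k (Equiv.swap p q) (tSum k {q} {r}) = tSum k {p} {r} := by
    rw [tSum_comm, Equiv.swap_comm, tPerm_swap_left, tSum_comm] <;> simp [*]
  have s1C : tPerm k (Equiv.swap p q) (tSum k {p} {r}) = tSum k {q} {r} := by
    rw [tSum_comm, tPerm_swap_left, tSum_comm] <;> simp [*]
  have s2A : tPerm k (Equiv.swap q r) (tSum k {p} {q}) = tSum k {p} {r} := by
    rw [tPerm_swap_left] <;> simp [*, hpq.symm, hpr.symm]
  have s2B : tPerm k (Equiv.swap q r) (tSum k {q} {r}) = tSum k {q} {r} := tPerm_swap_mid _ _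
  have s2C : tPerm k (Equiv.swap q r) (tSum k {p} {r}) = tSum k {p} {q} := by
    rw [tPerm_swap_right] <;> simp [*, hpq.symm, hpr.symm]
  have hcl : (crossing μ Φ {p} q r).left = _ :=
    crossing_left (by simpa using hpq.symm) (by simpa using hpr.symm)
  refine SemidirectProduct.ext ?_ ?_
  · simp only [ExpT.mul_left, hcl, halfTwist_left, crossing_right, halfTwist_right,
      SemidirectProduct.mul_right, tPerm_mul, expMap_comp, MonoidHom.comp_apply, map_mul, map_inv,
      expMap_substExp, expMap_expHalf, s1A, s1B, s1C, s2A, s2B, s2C]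
    set A := tSum k {p} {q}
    set B := tSum k {q} {r}
    set C := tSum k {p} {r}
    have eT : B + A + C = A + B + C := by abel
    rw [eT] at hex2 hT'
    have hc : Commute (substExp A B Φ) (expHalf μ (A + B + C)) :=
      commute_substExp_expHalf μ hT hT' Φ
    rw [← hΦ.subst_swap A C, ← hΦ.subst_swap C A, ← mul_left_inj (substExp A B Φ)]
    rw [hΦ.subst_swap A B, ← eq_mul_inv_iff_mul_eq, inv_inv] at hex2
    calc _ = expHalf μ (A + B + C) := by rw [← hex1]; simp only [mul_assoc]
      _ = (substExp A B Φ)⁻¹ * (expHalf μ (A + B + C) * substExp A B Φ) * 1 := by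
        rw [← hc.eq, inv_mul_cancel_left, mul_one]
      _ = _ := by rw [← hex2, hΦ.subst_swap A B]; group
  · simp only [SemidirectProduct.mul_right, crossing_right, halfTwist_right]
    exact swap_braid hpq hpr hqr

theorem commute_halfTwist_inl {g : ExpGroup k (TLie k n)}
    (h1 : Commute (expHalf μ (tSum k {p} {q})) g) (h2 : expMap (tPerm k (Equiv.swap p q)) g = g) :
    Commute (halfTwist μ p q) (SemidirectProduct.inl g) :=
  Commute.mul_left (h1.map SemidirectProduct.inl) (ExpT.commute_inr_inl h2)

theorem conj_halfTwist_of_commute {g h : ExpGroup k (TLie k n)}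
    (hc : Commute (halfTwist μ p q) (SemidirectProduct.inl g)) :
    SemidirectProduct.inl (g * h)⁻¹ * halfTwist μ p q * SemidirectProduct.inl (g * h) =
      SemidirectProduct.inl h⁻¹ * halfTwist μ p q * SemidirectProduct.inl h := by
  simp only [mul_inv_rev, map_mul, mul_assoc]
  rw [← mul_assoc (halfTwist μ p q), hc.eq, mul_assoc, ← mul_assoc (SemidirectProduct.inl g⁻¹),
    ← map_mul, inv_mul_cancel, map_one, one_mul]

/-- The braid relation for two consecutive crossings. Conjugating by the associativity constraint
`((I p) q) r → I ((p q) r)` reduces it to the case of three strands. -/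
theorem crossing_braid (hΦ : IsAssociator μ Φ) (hp : p ∉ I) (hq : q ∉ I) (hr : r ∉ I)
    (hpq : p ≠ q) (hpr : p ≠ r) (hqr : q ≠ r) :
    crossing μ Φ I p q * crossing μ Φ (I ∪ {p}) q r * crossing μ Φ I p q =
      crossing μ Φ (I ∪ {p}) q r * crossing μ Φ I p q * crossing μ Φ (I ∪ {p}) q r := by
  have dp : Disjoint I {p} := disjoint_singleton_right.2 hp
  have dq : Disjoint I {q} := disjoint_singleton_right.2 hq
  have dr : Disjoint I {r} := disjoint_singleton_right.2 hr
  have dpq : Disjoint ({p} : Finset (Fin n)) {q} := disjoint_singleton.2 hpq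
  have dpr : Disjoint ({p} : Finset (Fin n)) {r} := disjoint_singleton.2 hpr
  have dqr : Disjoint ({q} : Finset (Fin n)) {r} := disjoint_singleton.2 hqr
  set Θ := assocElt Φ I ({p} ∪ {q}) {r} * assocElt Φ I {p} {q} with hΘ
  have c1 : Commute (halfTwist μ p q)
      (SemidirectProduct.inl (assocElt Φ I ({p} ∪ {q}) {r}) : ExpT k n) := by
    refine commute_halfTwist_inl (commute_substExp_expHalf μ ?_ ?_ Φ).symm ?_
    · rw [← lie_skew, tSum_comm I, lie_tSum_tSum subset_union_left subset_union_right
        (disjoint_union_left.2 ⟨dp.symm, dq.symm⟩), neg_zero]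
    · rw [← lie_skew, lie_tSum_tSum subset_union_left subset_union_right
        (disjoint_union_left.2 ⟨dpr, dqr⟩), neg_zero]
    · have h : ({p} ∪ {q} : Finset (Fin n)).map (Equiv.swap p q).toEmbedding = {p} ∪ {q} :=
        map_swap_of_mem (by simp) (by simp)
      rw [assocElt, expMap_substExp, tPerm_tSum, tPerm_tSum, h, map_swap_of_notMem hp hq,
        map_swap_of_notMem (by simpa using hpr) (by simpa using hqr)]
  have c2 : Commute (halfTwist μ q r)
      (SemidirectProduct.inl (assocElt Φ I {p} ({q} ∪ {r}))⁻¹ : ExpT k n) := by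
    rw [map_inv]
    refine Commute.inv_right (commute_halfTwist_inl (commute_substExp_expHalf μ ?_ ?_ Φ).symm ?_)
    · exact lie_tSum_disjoint dq dr dpq dpr
    · rw [← lie_skew, tSum_comm {p}, lie_tSum_tSum subset_union_left subset_union_right
        (disjoint_union_left.2 ⟨dpq.symm, dpr.symm⟩), neg_zero]
    · have h : ({q} ∪ {r} : Finset (Fin n)).map (Equiv.swap q r).toEmbedding = {q} ∪ {r} :=
        map_swap_of_mem (by simp) (by simp)
      rw [assocElt, expMap_substExp, tPerm_tSum, tPerm_tSum, h, map_swap_of_notMem hq hr,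
        map_swap_of_notMem (by simpa using hpq.symm) (by simpa using hpr.symm)]
  have e1 : crossing μ Φ I p q = SemidirectProduct.inl Θ⁻¹ * halfTwist μ p q *
      SemidirectProduct.inl Θ := by
    rw [hΘ, conj_halfTwist_of_commute c1, crossing]
  have e2 : crossing μ Φ (I ∪ {p}) q r = SemidirectProduct.inl Θ⁻¹ * crossing μ Φ {p} q r *
      SemidirectProduct.inl Θ := by
    have hpent := hΦ.pentagon_blocks dp dq dr dpq dpr dqr
    rw [mul_assoc, ← hΘ, ← eq_inv_mul_iff_mul_eq] at hpent
    rw [crossing, hpent, conj_halfTwist_of_commute c2, crossing]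
    simp only [mul_inv_rev, map_mul, mul_assoc]
  have hb := congrArg (fun x => (SemidirectProduct.inl Θ⁻¹ : ExpT k n) * x *
    SemidirectProduct.inl Θ) (braid_three (μ := μ) hΦ hpq hpr hqr)
  have hΘΘ : ∀ x : ExpT k n, SemidirectProduct.inl Θ * (SemidirectProduct.inl Θ⁻¹ * x) = x :=
    fun x => by rw [map_inv, mul_inv_cancel_left]
  simp only [mul_assoc] at hb
  rw [e1, e2]
  simp only [mul_assoc, hΘΘ]
  exact hb

/-- Crossings far apart commute. -/
theorem crossing_comm {J : Finset (Fin n)} {r' : Fin n}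
    (hI : I ⊆ J) (hpJ : p ∈ J) (hqJ : q ∈ J) (hr : r ∉ J) (hr' : r' ∉ J) :
    Commute (crossing μ Φ I p q) (crossing μ Φ J r r') := by
  have hne : ∀ {x y : Fin n}, x ∈ J → y ∉ J → x ≠ y := fun hx hy h => hy (h ▸ hx)
  have hs : ({p} : Finset (Fin n)) ⊆ J ∧ ({q} : Finset (Fin n)) ⊆ J := by simp [hpJ, hqJ]
  have djr : Disjoint J {r} := disjoint_singleton_right.2 hr
  have djr' : Disjoint J {r'} := disjoint_singleton_right.2 hr'
  have b1 : ∀ {M N : Finset (Fin n)}, M ⊆ J → N ⊆ J → ⁅tSum k M N, tSum k J {r}⁆ = 0 :=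
    fun hM hN => lie_tSum_tSum hM hN djr
  have b2 : ∀ {M N : Finset (Fin n)}, M ⊆ J → N ⊆ J → ⁅tSum k M N, tSum k {r} {r'}⁆ = 0 :=
    fun hM hN => lie_tSum_disjoint (djr.mono_left hM) (djr'.mono_left hM) (djr.mono_left hN)
      (djr'.mono_left hN)
  have b3 : ∀ {M N : Finset (Fin n)}, M ⊆ J → N ⊆ J → ⁅tSum k J {r}, tSum k M N⁆ = 0 :=
    fun hM hN => by rw [← lie_skew, b1 hM hN, neg_zero]
  have b4 : ∀ {M N : Finset (Fin n)}, M ⊆ J → N ⊆ J → ⁅tSum k {r} {r'}, tSum k M N⁆ = 0 :=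
    fun hM hN => by rw [← lie_skew, b2 hM hN, neg_zero]
  have hJmap : J.map (Equiv.swap p q).toEmbedding = J := map_swap_of_mem hpJ hqJ
  have hrmap : ∀ x, x ∉ J → ({x} : Finset (Fin n)).map (Equiv.swap p q).toEmbedding = {x} :=
    fun x hx => map_swap_of_notMem (by simpa using hne hpJ hx) (by simpa using hne hqJ hx)
  have hMmap : ∀ M ⊆ J, M.map (Equiv.swap r r').toEmbedding = M := fun M hM =>
    map_swap_of_notMem (fun h => hr (hM h)) (fun h => hr' (hM h))
  have f1 : expMap (tPerm k (Equiv.swap p q)) (assocElt Φ J {r} {r'}) = assocElt Φ J {r} {r'} := by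
    rw [assocElt, expMap_substExp, tPerm_tSum, tPerm_tSum, hJmap, hrmap r hr, hrmap r' hr']
  have f2 : expMap (tPerm k (Equiv.swap p q)) (expHalf μ (tSum k {r} {r'})) =
      expHalf μ (tSum k {r} {r'}) := by
    rw [expMap_expHalf, tPerm_tSum, hrmap r hr, hrmap r' hr']
  have f3 : expMap (tPerm k (Equiv.swap r r')) (assocElt Φ I {p} {q}) = assocElt Φ I {p} {q} := by
    rw [assocElt, expMap_substExp, tPerm_tSum, tPerm_tSum, hMmap I hI, hMmap _ hs.1, hMmap _ hs.2]
  have f4 : expMap (tPerm k (Equiv.swap r r')) (expHalf μ (tSum k {p} {q})) =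
      expHalf μ (tSum k {p} {q}) := by
    rw [expMap_expHalf, tPerm_tSum, hMmap _ hs.1, hMmap _ hs.2]
  have g1 : Commute (assocElt Φ I {p} {q}) (assocElt Φ J {r} {r'}) :=
    commute_substExp (b1 hI hs.1) (b2 hI hs.1) (b1 hs.1 hs.2) (b2 hs.1 hs.2) Φ Φ
  have c1 : Commute (halfTwist μ p q) (SemidirectProduct.inl (assocElt Φ J {r} {r'})) :=
    commute_halfTwist_inl (commute_substExp_expHalf μ (b3 hs.1 hs.2) (b4 hs.1 hs.2) Φ).symm f1
  have c2 : Commute (halfTwist μ r r') (SemidirectProduct.inl (assocElt Φ I {p} {q})) :=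
    commute_halfTwist_inl (commute_substExp_expHalf μ (b2 hI hs.1) (b2 hs.1 hs.2) Φ).symm f3
  have c3 : Commute (halfTwist μ p q) (halfTwist μ r r') := by
    refine Commute.mul_right (commute_halfTwist_inl (commute_expHalf μ (b2 hs.1 hs.2)) f2) ?_
    refine Commute.mul_left (ExpT.commute_inr_inl f4).symm ?_
    refine Commute.map (f := SemidirectProduct.inr) (Equiv.Perm.Disjoint.commute ?_)
    intro x
    by_cases hx : x ∈ J
    · exact .inr (Equiv.swap_apply_of_ne_of_ne (hne hx hr) (hne hx hr'))
    · exact .inl (Equiv.swap_apply_of_ne_of_ne (hne hpJ hx).symm (hne hqJ hx).symm)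
  have d1 : Commute (crossing μ Φ I p q) (SemidirectProduct.inl (assocElt Φ J {r} {r'})) := by
    rw [crossing, map_inv]
    exact ((g1.map SemidirectProduct.inl).inv_left.mul_left c1).mul_left
      (g1.map SemidirectProduct.inl)
  have d2 : Commute (crossing μ Φ I p q) (halfTwist μ r r') := by
    rw [crossing, map_inv]
    exact (c2.symm.inv_left.mul_left c3).mul_left c2.symm
  rw [crossing.eq_def μ Φ J, map_inv]
  exact (d1.inv_right.mul_right d2).mul_right d1

/-- If the strand `p` turns once around the block `I`, then pulling it through `q` gives a turn of
`q` around `I ∪ {p}`. -/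
theorem crossing_monodromy (hΦ : IsAssociator μ Φ) (hp : p ∉ I) (hq : q ∉ I) (hpq : p ≠ q) :
    crossing μ Φ I p q *
        SemidirectProduct.inl (expHalf μ (tSum k I {p}) * expHalf μ (tSum k I {p})) *
        crossing μ Φ I p q =
      SemidirectProduct.inl (expHalf μ (tSum k (I ∪ {p}) {q}) *
        expHalf μ (tSum k (I ∪ {p}) {q})) := by
  have dp : Disjoint I {p} := disjoint_singleton_right.2 hp
  have dq : Disjoint I {q} := disjoint_singleton_right.2 hq
  have dpq : Disjoint ({p} : Finset (Fin n)) {q} := disjoint_singleton.2 hpq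
  have hex1 := hΦ.hexagon_blocks dp dq dpq
  have hex2 := hΦ.hexagon_blocks dpq.symm dq.symm dp.symm
  have hT := lie_tSum_total (k := k) dp dq dpq
  have hT' := lie_tSum_total (k := k) dpq.symm dq.symm dp.symm
  rw [tSum_comm {q} {p}, tSum_comm {q} I, tSum_comm {p} I] at hex2 hT'
  have hT0 : ⁅tSum k I {p}, tSum k (I ∪ {p}) {q}⁆ = 0 :=
    lie_tSum_tSum subset_union_left subset_union_right (disjoint_union_left.2 ⟨dq, dpq⟩)
  refine SemidirectProduct.ext ?_ ?_
  · simp only [ExpT.mul_left, crossing_left hp hq, crossing_right, SemidirectProduct.left_inl,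
      SemidirectProduct.right_inl, SemidirectProduct.mul_right, map_mul, map_inv, expMap_expHalf,
      expMap_substExp, tPerm_swap_left hp hq, tPerm_swap_right hp hq, tPerm_swap_mid, mul_one,
      tPerm_one, LieHom.coe_id, id_eq]
    set A := tSum k I {p}
    set B := tSum k {p} {q}
    set C := tSum k I {q}
    have eU : tSum k (I ∪ {p}) {q} = C + B := tSum_union_left dp _
    rw [eU] at hT0 ⊢
    have eT : A + B + C = A + (C + B) := by abel
    have eT' : B + A + C = A + (C + B) := by abel
    have hA : expHalf μ (A + (C + B)) = expHalf μ A * expHalf μ (C + B) := expHalf_add μ hT0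
    rw [eT] at hex1 hT
    rw [eT'] at hex2 hT'
    have hc : Commute (substExp A B Φ) (expHalf μ (A + (C + B))) :=
      commute_substExp_expHalf μ hT hT' Φ
    have hcA : Commute (expHalf μ A) (expHalf μ (C + B)) := commute_expHalf μ hT0
    rw [hA] at hc hex1 hex2
    -- the two hexagons express both halves of the product through `Φ(A, C)`
    have h1 : expHalf μ B * substExp A B Φ = substExp C B Φ * (expHalf μ C)⁻¹ *
        substExp A C Φ * expHalf μ (C + B) := by
      simp only [mul_assoc] at hex1
      rw [mul_right_inj, hΦ.subst_swap A C, hΦ.subst_swap C B] at hex1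
      rw [← hex1]
      group
    have h2 : (substExp A B Φ)⁻¹ * expHalf μ B * substExp C B Φ =
        expHalf μ (C + B) * (substExp A C Φ)⁻¹ * (expHalf μ C)⁻¹ := by
      rw [hΦ.subst_swap A B, mul_inv_eq_iff_eq_mul, ← hc.eq, hcA.eq] at hex2
      simp only [← mul_assoc] at hex2
      rw [mul_left_inj] at hex2
      rw [mul_assoc, inv_mul_eq_iff_eq_mul, ← mul_assoc, ← mul_assoc, eq_mul_inv_iff_mul_eq,
        eq_mul_inv_iff_mul_eq, hex2]
    rw [h2, mul_assoc (substExp C B Φ)⁻¹, h1]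
    group
  · simp [crossing_right]

end Crossing

/-! ### Words in groups with Artin relations -/

section Words

variable {G : Type*} [Group G] (s : ℕ → G)

/-- The word `s_0 s_1 ⋯ s_{m-1}`. -/
def ascWord (m : ℕ) : G := ((List.range m).map s).prod

/-- The word `s_{m-1} ⋯ s_1 s_0`. -/
def descWord (m : ℕ) : G := ((List.range m).map s).reverse.prod

/-- The word `s_a s_{a-1} ⋯ s_{a-j+1}` of length `j`. -/
def descFrom (a : ℕ) : ℕ → G
  | 0 => 1
  | j + 1 => descFrom a j * s (a - j)

theorem ascWord_succ (m : ℕ) : ascWord s (m + 1) = ascWord s m * s m := by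
  simp [ascWord, List.range_succ]

theorem descWord_succ (m : ℕ) : descWord s (m + 1) = s m * descWord s m := by
  simp [descWord, List.range_succ]

theorem descWord_mul_ascWord_succ (m : ℕ) : descWord s (m + 1) * ascWord s (m + 1) =
    s m * (descWord s m * ascWord s m) * s m := by
  rw [ascWord_succ, descWord_succ]; group

theorem descFrom_mul_descWord (a j : ℕ) (h : j ≤ a + 1) :
    descFrom s a j * descWord s (a + 1 - j) = descWord s (a + 1) := by
  induction j with
  | zero => simp [descFrom]
  | succ j ih =>
    rw [← ih (by omega), show a + 1 - j = (a - j) + 1 by omega, descWord_succ, descFrom,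
      show a + 1 - (j + 1) = a - j by omega, mul_assoc]

variable {s} {N : ℕ} (hb : ∀ i, i + 1 < N → s i * s (i + 1) * s i = s (i + 1) * s i * s (i + 1))
  (hc : ∀ i j, i + 1 < j → j < N → s i * s j = s j * s i)

include hc in
theorem ascWord_comm (m j : ℕ) (hm : m < j) (hj : j < N) : Commute (s j) (ascWord s m) := by
  induction m with
  | zero => simp [ascWord]
  | succ m ih =>
    rw [ascWord_succ]
    exact (ih (by omega)).mul_right (hc m j (by omega) hj).symm

include hb hc in
theorem ascWord_shift (m i : ℕ) (hi : i + 1 < m) (hm : m ≤ N) :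
    s (i + 1) * ascWord s m = ascWord s m * s i := by
  induction m with
  | zero => omega
  | succ m ih =>
    rw [ascWord_succ]
    rcases Nat.lt_or_ge (i + 1) m with h | h
    · rw [← mul_assoc, ih h (by omega), mul_assoc, hc i m h (by omega), mul_assoc]
    · obtain rfl : m = i + 1 := by omega
      have h1 := (ascWord_comm hc i (i + 1) (by omega) (by omega)).eq
      rw [ascWord_succ, ← mul_assoc, ← mul_assoc, h1, mul_assoc (ascWord s i), mul_assoc (ascWord s i),
        ← hb i (by omega)]
      simp only [mul_assoc]

include hb hc in
theorem descFrom_mul_ascWord (m j : ℕ) (hj : j ≤ m) (hm : m + 1 ≤ N) :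
    descFrom s m j * ascWord s (m + 1) = ascWord s m * descFrom s m (j + 1) := by
  induction j with
  | zero => simp [descFrom, ascWord_succ]
  | succ j ih =>
    have h : s (m - j) * ascWord s (m + 1) = ascWord s (m + 1) * s (m - (j + 1)) := by
      rw [show m - j = m - (j + 1) + 1 by omega]
      exact ascWord_shift hb hc _ _ (by omega) hm
    rw [descFrom, mul_assoc, h, ← mul_assoc, ih (by omega), mul_assoc]
    rfl

include hb hc in
theorem ascWord_pow (m j : ℕ) (hj : j ≤ m + 1) (hm : m + 1 ≤ N) :
    ascWord s (m + 1) ^ j = ascWord s m ^ j * descFrom s m j := by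
  induction j with
  | zero => simp [descFrom]
  | succ j ih =>
    rw [pow_succ, ih (by omega), mul_assoc, descFrom_mul_ascWord hb hc m j (by omega) hm,
      ← mul_assoc, ← pow_succ]

include hb hc in
/-- The full twist on `m + 2` strands is the full twist on the first `m + 1` strands followed by
one turn of the last strand around the others. -/
theorem fullTwist_succ (m : ℕ) (hm : m + 1 ≤ N) :
    ascWord s (m + 1) ^ (m + 2) =
      ascWord s m ^ (m + 1) * (descWord s (m + 1) * ascWord s (m + 1)) := by
  have h := descFrom_mul_descWord s m (m + 1) le_rfl
  rw [Nat.sub_self, show descWord s 0 = 1 by simp [descWord], mul_one] at h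
  rw [pow_succ, ascWord_pow hb hc m (m + 1) le_rfl hm, h, mul_assoc]

end Words

section BraidWords

variable {n : ℕ}

/-- The generators of the braid group indexed by `ℕ`, continued by `1`. -/
def sigmaNat (n i : ℕ) : BraidGroup n := if h : i < n - 1 then sigma ⟨i, h⟩ else 1

theorem sigmaNat_of_lt {i : ℕ} (h : i < n - 1) : sigmaNat n i = sigma ⟨i, h⟩ := dif_pos h

theorem sigma_braid (i j : Fin (n - 1)) (h : (i : ℕ) + 1 = j) :
    sigma i * sigma j * sigma i = sigma j * sigma i * sigma j := by
  have := PresentedGroup.one_of_mem (rels := {r | BraidRel n r}) (BraidRel.braid i j h)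
  rw [map_mul, map_inv, mul_inv_eq_one] at this
  simp only [map_mul] at this
  exact this

theorem sigma_far (i j : Fin (n - 1)) (h : (i : ℕ) + 1 < j) :
    sigma i * sigma j = sigma j * sigma i := by
  have := PresentedGroup.one_of_mem (rels := {r | BraidRel n r}) (BraidRel.far i j h)
  rw [map_mul, map_inv, mul_inv_eq_one] at this
  simp only [map_mul] at this
  exact this

theorem sigmaNat_braid (i : ℕ) (h : i + 1 < n - 1) :
    sigmaNat n i * sigmaNat n (i + 1) * sigmaNat n i =
      sigmaNat n (i + 1) * sigmaNat n i * sigmaNat n (i + 1) := by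
  rw [sigmaNat_of_lt h, sigmaNat_of_lt (show i < n - 1 by omega)]
  exact sigma_braid _ _ rfl

theorem sigmaNat_far (i j : ℕ) (h : i + 1 < j) (hj : j < n - 1) :
    sigmaNat n i * sigmaNat n j = sigmaNat n j * sigmaNat n i := by
  rw [sigmaNat_of_lt hj, sigmaNat_of_lt (show i < n - 1 by omega)]
  exact sigma_far _ _ h

theorem ofFn_sigma : (List.ofFn fun i : Fin (n - 1) => sigma i) =
    (List.range (n - 1)).map (sigmaNat n) := by
  refine List.ext_getElem (by simp) fun i h1 h2 => ?_
  simp only [List.length_ofFn] at h1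
  simp [sigmaNat_of_lt h1]

theorem rhoElt_eq : rhoElt n = ascWord (sigmaNat n) (n - 1) := by
  rw [rhoElt, ofFn_sigma, ascWord]

theorem rhoRev_eq : rhoRev n = descWord (sigmaNat n) (n - 1) := by
  rw [rhoRev, ofFn_sigma, descWord]

end BraidWords

/-! ### The morphism attached to a left-normed word -/

section Seg

variable {k : Type u} [CommRing k] {n : ℕ}

theorem mem_seg {a b : ℕ} {x : Fin n} : x ∈ seg n a b ↔ a ≤ (x : ℕ) ∧ (x : ℕ) < b := by
  simp [seg]

theorem seg_succ {m : ℕ} (hm : m < n) : seg n 0 (m + 1) = seg n 0 m ∪ {⟨m, hm⟩} := by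
  ext x
  simp only [mem_seg, mem_union, mem_singleton, Fin.ext_iff]
  omega

/-- The sum of all `t_ij` with `i < j ≤ m`. -/
def triSum (k : Type u) [CommRing k] (n m : ℕ) : TLie k n :=
  ∑ j ∈ seg n 0 (m + 1), tSum k (seg n 0 j) {j}

theorem triSum_succ {m : ℕ} (hm : m + 1 < n) : triSum k n (m + 1) =
    triSum k n m + tSum k (seg n 0 (m + 1)) {⟨m + 1, hm⟩} := by
  rw [triSum, seg_succ hm, sum_union, sum_singleton]
  · rfl
  · simp [mem_seg]

theorem lie_triSum {m : ℕ} (hm : m + 1 < n) :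
    ⁅triSum k n m, tSum k (seg n 0 (m + 1)) {⟨m + 1, hm⟩}⁆ = 0 := by
  rw [triSum, sum_lie]
  refine sum_eq_zero fun j hj => lie_tSum_tSum ?_ ?_ ?_
  · intro x
    simp only [mem_seg] at hj ⊢
    omega
  · simpa using hj
  · simp [mem_seg]

theorem tToP_sum_erase (i : Fin n) : tToP k n (∑ j ∈ univ.erase i, tGen k i j) = 0 :=
  LieQuot.mk_eq_zero ⟨i, rfl⟩

theorem tToP_turn (m : ℕ) (hm : m + 1 = n) :
    tToP k n (tSum k (seg n 0 m) {⟨m, by omega⟩}) = 0 := by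
  have h : seg n 0 m = univ.erase ⟨m, by omega⟩ := by
    ext x
    simp only [mem_seg, mem_erase, mem_univ, and_true, ne_eq, Fin.ext_iff]
    omega
  rw [← tToP_sum_erase ⟨m, by omega⟩, h, tSum_comm, tSum, sum_singleton]

end Seg

section LeftNormed

variable {k : Type u} [CommRing k] [Algebra ℚ k] {n : ℕ} {μ : k} {Φ : ExpGroup k (FreeLie2 k)}

theorem leftImage_braid (hΦ : IsAssociator μ Φ) (i j : Fin (n - 1)) (h : (i : ℕ) + 1 = j) :
    leftImage μ Φ i * leftImage μ Φ j * leftImage μ Φ i =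
      leftImage μ Φ j * leftImage μ Φ i * leftImage μ Φ j := by
  simp only [leftImage_eq_crossing]
  have e1 : seg n 0 j = seg n 0 i ∪ {strand i} := by rw [← h, seg_succ]; rfl
  have e2 : strandSucc i = strand j := Fin.ext h
  rw [e1, e2]
  refine crossing_braid hΦ ?_ ?_ ?_ ?_ ?_ ?_ <;>
    simp [mem_seg, strand, strandSucc, Fin.ext_iff] <;> omega

theorem leftImage_far (i j : Fin (n - 1)) (h : (i : ℕ) + 1 < j) :
    leftImage μ Φ i * leftImage μ Φ j = leftImage μ Φ j * leftImage μ Φ i := by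
  simp only [leftImage_eq_crossing]
  refine crossing_comm ?_ ?_ ?_ ?_ ?_
  · intro x
    simp only [mem_seg]
    omega
  all_goals simp [mem_seg, strand, strandSucc] <;> omega

/-- The morphism attached to the word with all parentheses on the left. -/
def leftHom (hΦ : IsAssociator μ Φ) (n : ℕ) : BraidGroup n →* ExpT k n :=
  PresentedGroup.toGroup (f := leftImage μ Φ) (by
    rintro _ (⟨i, j, h⟩ | ⟨i, j, h⟩)
    · simp only [map_mul, map_inv, FreeGroup.lift_apply_of]
      rw [leftImage_braid hΦ i j h, mul_inv_cancel]
    · simp only [map_mul, map_inv, FreeGroup.lift_apply_of]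
      rw [leftImage_far i j h, mul_inv_cancel])

theorem leftHom_sigma (hΦ : IsAssociator μ Φ) (i : Fin (n - 1)) :
    leftHom hΦ n (sigma i) = leftImage μ Φ i := PresentedGroup.toGroup.of _

/-- One turn of a strand around all strands to its left is sent to an exponential. -/
theorem leftHom_turn (hΦ : IsAssociator μ Φ) (m : ℕ) (hm : m < n) :
    leftHom hΦ n (descWord (sigmaNat n) m * ascWord (sigmaNat n) m) =
      SemidirectProduct.inl (expHalf μ (tSum k (seg n 0 m) {⟨m, hm⟩}) *
        expHalf μ (tSum k (seg n 0 m) {⟨m, hm⟩})) := by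
  induction m with
  | zero =>
    have h : seg n 0 0 = ∅ := by ext x; simp [mem_seg]
    simp [h, tSum_empty, expHalf_zero, ascWord, descWord]
  | succ m ih =>
    have hm' : m < n - 1 := by omega
    rw [descWord_mul_ascWord_succ, map_mul, map_mul, ih (by omega), sigmaNat_of_lt hm',
      leftHom_sigma, leftImage_eq_crossing, seg_succ (show m < n by omega)]
    refine crossing_monodromy hΦ ?_ ?_ ?_ <;> simp [mem_seg, strand, strandSucc]

/-- The full twist of the first `m + 1` strands is sent to an exponential. -/
theorem leftHom_fullTwist (hΦ : IsAssociator μ Φ) (m : ℕ) (hm : m < n) :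
    leftHom hΦ n (ascWord (sigmaNat n) m ^ (m + 1)) =
      SemidirectProduct.inl (expHalf μ (triSum k n m) * expHalf μ (triSum k n m)) := by
  induction m with
  | zero =>
    have h : triSum k n 0 = 0 := by
      refine sum_eq_zero fun j hj => ?_
      have h : seg n 0 j = ∅ := by
        ext x
        simp only [mem_seg] at hj ⊢
        simp
        omega
      rw [h, tSum_empty]
    simp [h, expHalf_zero, ascWord]
  | succ m ih =>
    have hc := lie_triSum (k := k) hm
    rw [fullTwist_succ (fun i => sigmaNat_braid i) (fun i j => sigmaNat_far i j) m (by omega),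
      map_mul, ih (by omega), leftHom_turn hΦ (m + 1) hm, ← map_mul, triSum_succ hm,
      expHalf_add μ hc]
    congr 1
    have hcc := (commute_expHalf μ hc).eq
    set a := expHalf μ (triSum k n m)
    set b := expHalf μ (tSum k (seg n 0 (m + 1)) {⟨m + 1, hm⟩})
    rw [mul_assoc, mul_assoc a b, ← mul_assoc b a, ← hcc]
    simp only [mul_assoc]

/-! ### The relations of the mapping class group -/

/-- Twice the sum of all `t_ij` with `i < j` is the sum over `i` of the relations `∑ j, t_ij` of
`p_n`; hence it vanishes in `p_n`, since `2` is invertible. -/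
theorem tToP_triSum (m : ℕ) (hm : m + 1 = n) : tToP k n (triSum k n m) = 0 := by
  have hu : seg n 0 (m + 1) = univ := by
    ext x
    simp only [mem_seg, mem_univ, iff_true]
    omega
  have h2 : triSum k n m + triSum k n m = ∑ i, ∑ j ∈ univ.erase i, tGen k i j := by
    have e1 : triSum k n m = ∑ i : Fin n, ∑ j : Fin n, if j < i then tGen k i j else 0 := by
      rw [triSum, hu]
      refine sum_congr rfl fun i _ => ?_
      rw [tSum_comm, tSum, sum_singleton, ← sum_filter]
      refine sum_congr ?_ fun _ _ => rfl
      ext x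
      simp only [mem_seg, mem_filter_univ, Fin.lt_def]
      omega
    have e2 : triSum k n m = ∑ i : Fin n, ∑ j : Fin n, if i < j then tGen k i j else 0 := by
      rw [e1, sum_comm]
      refine sum_congr rfl fun i _ => sum_congr rfl fun j _ => ?_
      rw [tGen_symm]
    nth_rewrite 1 [e1]
    rw [e2, ← sum_add_distrib]
    refine sum_congr rfl fun i _ => ?_
    rw [← sum_add_distrib, ← add_sum_erase _ _ (mem_univ i)]
    simp only [lt_irrefl, if_false, add_zero, zero_add]
    refine sum_congr rfl fun j hj => ?_
    rcases lt_or_gt_of_ne (ne_of_mem_erase hj) with h | h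
    · rw [if_pos h, if_neg (not_lt_of_gt h), add_zero]
    · rw [if_pos h, if_neg (not_lt_of_gt h), zero_add]
  have h3 : tToP k n (triSum k n m) + tToP k n (triSum k n m) = 0 := by
    rw [← map_add, h2, map_sum]
    exact sum_eq_zero fun i _ => tToP_sum_erase i
  have h4 : algebraMap ℚ k (1 / 2) + algebraMap ℚ k (1 / 2) = 1 := by
    rw [← map_add, ← map_one (algebraMap ℚ k)]; norm_num
  rw [← one_smul k (tToP k n (triSum k n m)), ← h4, add_smul, ← smul_add, h3, smul_zero]

theorem expTToExpP_inl (g : ExpGroup k (TLie k n)) :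
    expTToExpP k n (SemidirectProduct.inl g) = SemidirectProduct.inl (expMap (tToP k n) g) :=
  SemidirectProduct.map_inl _ _ _ _

/-- The full twist and the turn of the last strand around all the others are sent to exponentials
of elements of `t_n` which vanish in `p_n`. -/
theorem expTToExpP_leftHom_rel (hΦ : IsAssociator μ Φ) (hn : n ≠ 0) {r : BraidGroup n}
    (hr : r ∈ mcgRels n) : expTToExpP k n (leftHom hΦ n r) = 1 := by
  have hm : n - 1 + 1 = n := by omega
  rcases hr with rfl | rfl
  · have h := leftHom_fullTwist (n := n) hΦ (n - 1) (by omega)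
    rw [hm, ← rhoElt_eq] at h
    rw [h, expTToExpP_inl, map_mul, expMap_expHalf, tToP_triSum _ hm, expHalf_zero, mul_one,
      map_one]
  · -- the sphere word is conjugate to one turn of the last strand
    have h := leftHom_turn (n := n) hΦ (n - 1) (by omega)
    have hconj : rhoElt n * rhoRev n = rhoElt n * (rhoRev n * rhoElt n) * (rhoElt n)⁻¹ := by
      group
    rw [← rhoElt_eq, ← rhoRev_eq] at h
    have h' : expTToExpP k n (leftHom hΦ n (rhoRev n * rhoElt n)) = 1 := by
      rw [h, expTToExpP_inl, map_mul, expMap_expHalf, tToP_turn _ hm, expHalf_zero, mul_one,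
        map_one]
    rw [hconj]
    exact (MonoidHom.normal_ker ((expTToExpP k n).comp (leftHom hΦ n))).conj_mem _ h' (rhoElt n)

/-- The morphism `i_{t,Φ}` attached to a parenthesization. -/
def treeHom (hΦ : IsAssociator μ Φ) (n : ℕ) (t : FreeMagma Unit) : BraidGroup n →* ExpT k n :=
  (MulAut.conj (SemidirectProduct.inl (combElt Φ n 0 t)⁻¹ : ExpT k n)).toMonoidHom.comp
    (leftHom hΦ n)

theorem treeHom_apply (hΦ : IsAssociator μ Φ) (t : FreeMagma Unit) (b : BraidGroup n) :
    treeHom hΦ n t b = SemidirectProduct.inl (combElt Φ n 0 t)⁻¹ * leftHom hΦ n b *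
      (SemidirectProduct.inl (combElt Φ n 0 t)⁻¹)⁻¹ := rfl

theorem treeHom_sigma (hΦ : IsAssociator μ Φ) (t : FreeMagma Unit) (i : Fin (n - 1)) :
    treeHom hΦ n t (sigma i) = sigmaImage μ Φ t i := by
  rw [treeHom_apply, leftHom_sigma, sigmaImage, ← map_inv, inv_inv]

/-- The morphism out of the mapping class group induced by `i_{t,Φ}`. -/
def gammaHom (hΦ : IsAssociator μ Φ) (hn : n ≠ 0) (t : FreeMagma Unit) : Gamma n →* ExpP k n :=
  QuotientGroup.lift _ ((expTToExpP k n).comp (treeHom hΦ n t)) (by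
    have h : Subgroup.normalClosure (mcgRels n) ≤
        ((expTToExpP k n).comp (treeHom hΦ n t)).ker := by
      apply Subgroup.normalClosure_le_normal
      intro r hr
      change expTToExpP k n (treeHom hΦ n t r) = 1
      rw [treeHom_apply, map_mul, map_mul, expTToExpP_leftHom_rel hΦ hn hr, mul_one, ← map_mul,
        mul_inv_cancel, map_one]
    exact h)

theorem gammaHom_braidToGamma (hΦ : IsAssociator μ Φ) (hn : n ≠ 0) (t : FreeMagma Unit)
    (b : BraidGroup n) :
    gammaHom hΦ hn t (braidToGamma n b) = expTToExpP k n (treeHom hΦ n t b) := rfl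

end LeftNormed

/-! ### Logarithms of unipotent elements -/

section Log

theorem exp_eq_one_add_mul {A : Type*} [Ring A] [Algebra ℚ A] {a : A} (ha : IsNilpotent a) :
    ∃ r, Commute a r ∧ IsNilpotent.exp a = 1 + a + a * a * r := by
  obtain ⟨m, hm⟩ := ha
  have hm' : a ^ (m + 2) = 0 := by rw [pow_add, hm, zero_mul]
  refine ⟨∑ i ∈ range m, ((i + 2).factorial : ℚ)⁻¹ • a ^ i,
    Commute.sum_right _ _ _ fun i _ => ((Commute.refl a).pow_right i).smul_right _, ?_⟩
  rw [IsNilpotent.exp_eq_sum hm', sum_range_succ', sum_range_succ', mul_sum]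
  have h : ∀ i, a * a * ((i + 2).factorial : ℚ)⁻¹ • a ^ i =
      ((i + 1 + 1).factorial : ℚ)⁻¹ • a ^ (i + 1 + 1) := fun i => by
    rw [mul_smul_comm, pow_succ', pow_succ', mul_assoc]
  rw [sum_congr rfl fun i _ => (h i)]
  simp
  abel

/-- The exponential is injective on commuting nilpotent elements. -/
theorem exp_injective_of_commute {A : Type*} [Ring A] [Algebra ℚ A] {a b : A}
    (ha : IsNilpotent a) (hb : IsNilpotent b) (hab : Commute a b)
    (h : IsNilpotent.exp a = IsNilpotent.exp b) : a = b := by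
  have hc : IsNilpotent (a - b) := hab.isNilpotent_sub ha hb
  have h1 : IsNilpotent.exp (a - b) = 1 := by
    rw [sub_eq_add_neg, IsNilpotent.exp_add_of_commute hab.neg_right ha hb.neg, h,
      IsNilpotent.exp_mul_exp_neg_self hb]
  obtain ⟨r, hr, hexp⟩ := exp_eq_one_add_mul hc
  rw [h1, add_assoc, left_eq_add, mul_assoc, ← mul_one_add (a - b)] at hexp
  have hu : IsUnit (1 + (a - b) * r) := (hr.isNilpotent_mul_right hc).isUnit_one_add
  exact sub_eq_zero.1 ((hu.mul_left_eq_zero).1 hexp)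

/-- In a commutative ring, unipotent elements are exponentials. The logarithm is constructed by
successive approximation. -/
theorem exists_exp_eq_one_add {R : Type*} [CommRing R] [Algebra ℚ R] {x : R}
    (hx : IsNilpotent x) : ∃ s, IsNilpotent.exp (x * s) = 1 + x := by
  have key : ∀ j : ℕ, ∃ s r, IsNilpotent.exp (x * s) = 1 + x + x ^ (j + 1) * r := by
    intro j
    induction j with
    | zero => exact ⟨0, -1, by simp⟩
    | succ j ih =>
      obtain ⟨s, r, h⟩ := ih
      have n1 : IsNilpotent (x * s) := (Commute.all _ _).isNilpotent_mul_right hx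
      have n2 : IsNilpotent (x * (-(x ^ j * r))) := (Commute.all _ _).isNilpotent_mul_right hx
      obtain ⟨p, -, hp⟩ := exp_eq_one_add_mul n1
      obtain ⟨q, -, hq⟩ := exp_eq_one_add_mul n2
      refine ⟨s + -(x ^ j * r), -r * (s + x * s * s * p) + (1 + x + x ^ (j + 1) * r) *
        (x ^ j * r * r * q), ?_⟩
      rw [mul_add, IsNilpotent.exp_add_of_commute (Commute.all _ _) n1 n2, hq, mul_add, h]
      have e : (1 + x + x ^ (j + 1) * r) = 1 + x * s + x * s * (x * s) * p := by rw [← h, hp]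
      have : (1 + x + x ^ (j + 1) * r) * (1 + x * -(x ^ j * r)) = 1 + x + x ^ (j + 1) * r -
          x ^ (j + 1) * r * (1 + x * s + x * s * (x * s) * p) := by rw [← e]; ring
      rw [this]
      ring
  obtain ⟨m, hm⟩ := hx
  obtain ⟨s, r, h⟩ := key m
  exact ⟨s, by rw [h, pow_succ, hm, zero_mul, zero_mul, add_zero]⟩

/-- A unipotent element `1 + x` is the exponential of a polynomial in `x` without constant term. -/
theorem exists_exp_aeval {A : Type*} [Ring A] [Algebra ℚ A] {x : A} (hx : IsNilpotent x) :
    ∃ P : Polynomial ℚ, IsNilpotent.exp (x * Polynomial.aeval x P) = 1 + x := by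
  let _ : CommRing (Algebra.adjoin ℚ {x}) :=
    { (inferInstance : Ring (Algebra.adjoin ℚ {x})) with
      mul_comm := fun a b => (Algebra.isMulCommutative_adjoin_singleton ℚ x).is_comm.comm a b }
  let x' : Algebra.adjoin ℚ {x} := ⟨x, Algebra.self_mem_adjoin_singleton ℚ x⟩
  have hx' : IsNilpotent x' := by
    obtain ⟨m, hm⟩ := hx
    exact ⟨m, Subtype.ext hm⟩
  obtain ⟨s, hs⟩ := exists_exp_eq_one_add hx'
  obtain ⟨P, hP⟩ := (Algebra.adjoin_singleton_eq_range_aeval ℚ x).le s.2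
  refine ⟨P, ?_⟩
  have h := congrArg (Algebra.adjoin ℚ {x}).val hs
  rw [IsNilpotent.map_exp ((Commute.all _ _).isNilpotent_mul_right hx')] at h
  rw [show Polynomial.aeval x P = (s : A) from hP]
  exact h

end Log

section CompletedLog

theorem Compl.mk_eq_proj_of_le {A : Type*} [Ring A] {J : Ideal A} [J.IsTwoSided] {x : Compl J}
    {a : A} {m j : ℕ} (h : Ideal.Quotient.mk (J ^ m) a = Compl.proj m x) (hj : j ≤ m) :
    Ideal.Quotient.mk (J ^ j) a = Compl.proj j x := by
  induction m, hj using Nat.le_induction with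
  | base => exact h
  | succ m hm ih =>
    refine ih ?_
    rw [← Compl.factor_proj, ← h]
    rfl

variable {k : Type u} [CommRing k] {L L' : Type*} [LieRing L] [LieAlgebra k L] [LieRing L']
  [LieAlgebra k L']

theorem proj_pow_eq_zero {x : UHat k L} (hx : Compl.proj 1 x = 0) (m : ℕ) :
    Compl.proj m x ^ m = 0 := by
  obtain ⟨a, ha⟩ := Ideal.Quotient.mk_surjective (Compl.proj m x)
  rcases Nat.eq_zero_or_pos m with rfl | hm
  · rw [← ha, ← map_pow, Ideal.Quotient.eq_zero_iff_mem, Submodule.pow_zero, Ideal.one_eq_top]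
    trivial
  · have h := Compl.mk_eq_proj_of_le ha hm
    rw [hx, Ideal.Quotient.eq_zero_iff_mem, Submodule.pow_one] at h
    rw [← ha, ← map_pow, Ideal.Quotient.eq_zero_iff_mem]
    exact Ideal.pow_mem_pow h m

variable [Algebra ℚ k]

/-- The rational structure of the truncated enveloping algebra over a commutative `ℚ`-algebra. -/
abbrev ratAlgebraLevel (m : ℕ) : Algebra ℚ (UniversalEnvelopingAlgebra k L ⧸ augIdeal k L ^ m) :=
  Algebra.compHom _ (algebraMap ℚ k)

theorem map_aeval_rat {A B : Type*} [Ring A] [Ring B] [Algebra ℚ A] [Algebra ℚ B] (f : A →+* B)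
    (x : A) (P : Polynomial ℚ) : f (Polynomial.aeval x P) = Polynomial.aeval (f x) P :=
  (Polynomial.aeval_algHom_apply f.toRatAlgHom x P).symm

theorem commute_aeval {A : Type*} [Ring A] [Algebra ℚ A] {x y : A} (h : Commute y x)
    (P : Polynomial ℚ) : Commute y (Polynomial.aeval x P) := by
  induction P using Polynomial.induction_on' with
  | add p q hp hq => rw [map_add]; exact hp.add_right hq
  | monomial n c =>
    rw [Polynomial.aeval_monomial]
    have hc : Commute y (algebraMap ℚ A c) := (Algebra.commutes c y).symm
    exact hc.mul_right (h.pow_right n)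

attribute [local instance] ratAlgebraLevel in
/-- Every element of the completed enveloping algebra with augmentation `1` is an exponential. -/
theorem exists_isExpOf {u : UHat k L} (hu : Compl.proj 1 u = 1) : ∃ x : UHat k L,
    IsExpOf k u x ∧ Compl.proj 1 x = 0 ∧ ∀ m, ∃ P : Polynomial ℚ,
      Compl.proj m x = Polynomial.aeval (Compl.proj m u - 1) P := by
  have hnil : ∀ m, (Compl.proj m u - 1) ^ m = 0 := fun m => by
    have h := proj_pow_eq_zero (x := u - 1) (by rw [map_sub, hu, map_one, sub_self]) m
    rwa [map_sub, map_one] at h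
  have hlog := fun m => exists_exp_aeval ⟨m, hnil m⟩
  choose P hP using hlog
  set l := fun m => (Compl.proj m u - 1) * Polynomial.aeval (Compl.proj m u - 1) (P m) with hl
  have hcomm : ∀ m y, Commute y (Compl.proj m u) → Commute y (l m) := fun m y hy =>
    have h1 : Commute y (Compl.proj m u - 1) := hy.sub_right (Commute.one_right y)
    h1.mul_right (commute_aeval h1 _)
  have hlm : ∀ m, l m ^ m = 0 := fun m => by
    rw [hl, (commute_aeval (Commute.refl _) _).mul_pow, hnil, zero_mul]
  have hcompat : ∀ m, Ideal.Quotient.factorPowSucc (augIdeal k L) m (l (m + 1)) = l m := by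
    intro m
    set f := Ideal.Quotient.factorPowSucc (augIdeal k L) m with hf
    have hfu : f (Compl.proj (m + 1) u) = Compl.proj m u := Compl.factor_proj u m
    have e : f (l (m + 1)) = (Compl.proj m u - 1) *
        Polynomial.aeval (Compl.proj m u - 1) (P (m + 1)) := by
      rw [hl, map_mul, map_aeval_rat, map_sub, map_one, hfu]
    have h1 : Commute (f (l (m + 1))) (Compl.proj m u) := by
      rw [← hfu]
      exact (hcomm (m + 1) _ (Commute.refl _)).symm.map f
    refine exp_injective_of_commute ?_ ⟨m, hlm m⟩ (hcomm m _ h1) ?_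
    · exact ⟨m + 1, by rw [← map_pow, hlm, map_zero]⟩
    · rw [← IsNilpotent.map_exp ⟨m + 1, hlm _⟩ f, hP, hP, map_add, map_one, map_sub, map_one, hfu]
  refine ⟨Compl.mk l hcompat, fun m => ?_, ?_, fun m => ⟨Polynomial.X * P m, ?_⟩⟩
  · rw [Compl.proj_mk, truncExp_eq_exp (k := k) (fun _ _ => rfl) (hlm m), hP, add_sub_cancel]
  · rw [Compl.proj_mk, ← pow_one (l 1), hlm]
  · rw [Compl.proj_mk, map_mul, Polynomial.aeval_X]

attribute [local instance] ratAlgebraLevel in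
/-- The logarithm of a group-like element is primitive. -/
theorem map_add_of_map_mul {u x : UHat k L} (hx : IsExpOf k u x) (hx1 : Compl.proj 1 x = 0)
    (hpoly : ∀ m, ∃ P : Polynomial ℚ, Compl.proj m x = Polynomial.aeval (Compl.proj m u - 1) P)
    {d f g : L →ₗ⁅k⁆ L'} (hfg : ∀ a b, ⁅f a, g b⁆ = 0)
    (hu : UHat.map d u = UHat.map f u * UHat.map g u) :
    UHat.map d x = UHat.map f x + UHat.map g x := by
  have hmap1 : ∀ e : L →ₗ⁅k⁆ L', Compl.proj 1 (UHat.map e x) = 0 := fun e => by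
    rw [UHat.map, Compl.proj_map, hx1, map_zero]
  refine Compl.ext fun m => ?_
  have ha := proj_pow_eq_zero (hmap1 d) m
  have hf := proj_pow_eq_zero (hmap1 f) m
  have hg := proj_pow_eq_zero (hmap1 g) m
  have hfg0 : Compl.proj 1 (UHat.map f x + UHat.map g x) = 0 := by
    rw [map_add, hmap1, hmap1, add_zero]
  have hb := proj_pow_eq_zero hfg0 m
  have hc : Commute (Compl.proj m (UHat.map f x)) (Compl.proj m (UHat.map g x)) :=
    (commute_UHat_map hfg x x).map _
  have hexp : IsNilpotent.exp (Compl.proj m (UHat.map d x)) =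
      IsNilpotent.exp (Compl.proj m (UHat.map f x + UHat.map g x)) := by
    have e1 := isExpOf_map d hx m
    have e2 := isExpOf_map f hx m
    have e3 := isExpOf_map g hx m
    rw [truncExp_eq_exp (k := k) (fun _ _ => rfl) ha] at e1
    rw [truncExp_eq_exp (k := k) (fun _ _ => rfl) hf] at e2
    rw [truncExp_eq_exp (k := k) (fun _ _ => rfl) hg] at e3
    rw [← e1, hu, map_mul, e2, e3, map_add, IsNilpotent.exp_add_of_commute hc ⟨m, hf⟩ ⟨m, hg⟩]
  refine exp_injective_of_commute ⟨m, ha⟩ ⟨m, hb⟩ ?_ hexp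
  have hcu : Commute (Compl.proj m (UHat.map f x + UHat.map g x))
      (Compl.proj m (UHat.map d u)) := by
    rw [hu, map_add, map_mul, isExpOf_map f hx m, isExpOf_map g hx m]
    have hself : ∀ {a b : UniversalEnvelopingAlgebra k L' ⧸ augIdeal k L' ^ m}, Commute a b →
        Commute a (truncExp k m b) := fun h =>
      Commute.sum_right _ _ _ fun i _ => (h.pow_right i).smul_right _
    exact ((hself (Commute.refl _)).mul_right (hself hc)).add_left
      ((hself hc.symm).mul_right (hself (Commute.refl _)))
  obtain ⟨P, hP⟩ := hpoly m
  have e : Compl.proj m (UHat.map d x) =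
      Polynomial.aeval (Compl.proj m (UHat.map d u) - 1) P := by
    rw [UHat.map, Compl.proj_map, Compl.proj_map, hP, map_aeval_rat, map_sub, map_one]
  rw [e]
  exact (commute_aeval (hcu.sub_right (Commute.one_right _)) P).symm

end CompletedLog

/-! ### Graded enveloping algebras -/

section Graded

variable {k : Type u} [CommRing k] {L : Type*} [LieRing L] [LieAlgebra k L] {X : Type*}

/-- Evaluation of polynomials at `1`. -/
def evalOne (k : Type u) [CommRing k] (A : Type*) [Ring A] [Algebra k A] :
    Polynomial A →ₐ[k] A where
  __ := Polynomial.eval₂RingHom' (RingHom.id A) 1 fun _ => Commute.one_right _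
  commutes' _ := Polynomial.eval₂_C _ _

theorem evalOne_C {A : Type*} [Ring A] [Algebra k A] (a : A) :
    evalOne k A (Polynomial.C a) = a := Polynomial.eval₂_C _ _

theorem evalOne_X {A : Type*} [Ring A] [Algebra k A] :
    evalOne k A Polynomial.X = 1 := Polynomial.eval₂_X _ _

theorem evalOne_eq_sum {A : Type*} [Ring A] [Algebra k A] (p : Polynomial A) {n : ℕ}
    (hn : p.natDegree < n) : evalOne k A p = ∑ j ∈ range n, p.coeff j := by
  change Polynomial.eval₂ _ _ _ = _
  rw [Polynomial.eval₂_eq_sum_range' _ hn]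
  simp

/-- The family `t` generates the Lie algebra, and the enveloping algebra is graded with all `t x`
in degree one. The grading is encoded by the algebra morphism `δ : U(L) → U(L)[X]` multiplying
an element of degree `d` by `X ^ d`. -/
structure IsGradedBy (t : X → L)
    (δ : UniversalEnvelopingAlgebra k L →ₐ[k] Polynomial (UniversalEnvelopingAlgebra k L)) :
    Prop where
  adjoin_eq_top : Algebra.adjoin k (Set.range fun x => UniversalEnvelopingAlgebra.ι k (t x)) = ⊤
  apply_gen : ∀ x, δ (UniversalEnvelopingAlgebra.ι k (t x)) =
    Polynomial.C (UniversalEnvelopingAlgebra.ι k (t x)) * Polynomial.X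

/-- The product in `U(L)` of a word in the generators. -/
def wordProd (k : Type u) [CommRing k] {L : Type*} [LieRing L] [LieAlgebra k L] (t : X → L)
    (w : List X) : UniversalEnvelopingAlgebra k L :=
  (w.map fun x => UniversalEnvelopingAlgebra.ι k (t x)).prod

theorem wordProd_cons (t : X → L) (x : X) (w : List X) : wordProd k t (x :: w) =
    UniversalEnvelopingAlgebra.ι k (t x) * wordProd k t w := by
  rw [wordProd, List.map_cons, List.prod_cons]; rfl

theorem wordProd_append (t : X → L) (v w : List X) :
    wordProd k t (v ++ w) = wordProd k t v * wordProd k t w := by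
  rw [wordProd, List.map_append, List.prod_append]; rfl

theorem wordProd_mem_pow (t : X → L) (w : List X) :
    wordProd k t w ∈ augIdeal k L ^ w.length := by
  induction w with
  | nil => simp [Submodule.pow_zero, Ideal.one_eq_top]
  | cons x w ih =>
    rw [wordProd_cons, List.length_cons, Ideal.IsTwoSided.pow_succ]
    exact Ideal.mul_mem_mul (ι_mem_augIdeal _) ih

namespace IsGradedBy

variable {t : X → L}
  {δ : UniversalEnvelopingAlgebra k L →ₐ[k] Polynomial (UniversalEnvelopingAlgebra k L)} (h : IsGradedBy t δ)

include h

theorem span_wordProd : Submodule.span k (Set.range (wordProd k t)) = ⊤ := by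
  rw [← Algebra.top_toSubmodule, ← h.adjoin_eq_top, Algebra.adjoin_eq_span]
  congr 1
  ext a
  constructor
  · rintro ⟨w, rfl⟩
    exact list_prod_mem fun a ha => by
      obtain ⟨x, -, rfl⟩ := List.mem_map.1 ha
      exact Submonoid.subset_closure ⟨x, rfl⟩
  · intro ha
    induction ha using Submonoid.closure_induction with
    | mem a ha => obtain ⟨x, rfl⟩ := ha; exact ⟨[x], by simp [wordProd]⟩
    | one => exact ⟨[], rfl⟩
    | mul a b _ _ iha ihb =>
      obtain ⟨v, rfl⟩ := iha
      obtain ⟨w, rfl⟩ := ihb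
      exact ⟨v ++ w, wordProd_append _ _ _⟩

theorem word_induction {p : UniversalEnvelopingAlgebra k L → Prop} (hw : ∀ w, p (wordProd k t w))
    (hadd : ∀ a b, p a → p b → p (a + b)) (h0 : p 0) (hsmul : ∀ (c : k) a, p a → p (c • a))
    (a : UniversalEnvelopingAlgebra k L) : p a := by
  have ha : a ∈ Submodule.span k (Set.range (wordProd k t)) := by
    rw [h.span_wordProd]; trivial
  induction ha using Submodule.span_induction with
  | mem a ha => obtain ⟨w, rfl⟩ := ha; exact hw w
  | zero => exact h0
  | add a b _ _ iha ihb => exact hadd a b iha ihb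
  | smul c a _ iha => exact hsmul c a iha

theorem apply_wordProd (w : List X) :
    δ (wordProd k t w) = Polynomial.C (wordProd k t w) * Polynomial.X ^ w.length := by
  induction w with
  | nil => simp [wordProd]
  | cons x w ih =>
    rw [wordProd_cons, map_mul, h.apply_gen, ih, List.length_cons, pow_succ', map_mul, mul_assoc,
      mul_assoc, ← mul_assoc Polynomial.X, Polynomial.X_mul, mul_assoc]

theorem coeff_wordProd (w : List X) (j : ℕ) :
    (δ (wordProd k t w)).coeff j = if j = w.length then wordProd k t w else 0 := by
  rw [h.apply_wordProd, Polynomial.coeff_C_mul_X_pow]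

theorem coeff_mem_pow (a : UniversalEnvelopingAlgebra k L) (j : ℕ) : (δ a).coeff j ∈ augIdeal k L ^ j := by
  induction a using h.word_induction with
  | hw w =>
    rw [h.coeff_wordProd]
    split_ifs with hj
    · rw [hj]; exact wordProd_mem_pow t w
    · exact zero_mem _
  | hadd a b ha hb => rw [map_add, Polynomial.coeff_add]; exact add_mem ha hb
  | h0 => simp
  | hsmul c a ha =>
    rw [map_smul, Polynomial.coeff_smul, Algebra.smul_def]
    exact Ideal.mul_mem_left _ _ ha

theorem evalOne_apply (a : UniversalEnvelopingAlgebra k L) : evalOne k _ (δ a) = a := by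
  induction a using h.word_induction with
  | hw w => rw [h.apply_wordProd, map_mul, map_pow, evalOne_C, evalOne_X, one_pow, mul_one]
  | hadd a b ha hb => rw [map_add, map_add, ha, hb]
  | h0 => rw [map_zero, map_zero]
  | hsmul c a ha => rw [map_smul, map_smul, ha]

theorem coeff_zero_apply (a : UniversalEnvelopingAlgebra k L) : (δ a).coeff 0 = algebraMap k _ (augU k L a) := by
  induction a using h.word_induction with
  | hw w =>
    rw [h.coeff_wordProd]
    cases w with
    | nil => simp [wordProd]
    | cons x w => rw [if_neg (by simp), wordProd_cons, map_mul, augU_ι, zero_mul, map_zero]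
  | hadd a b ha hb => rw [map_add, Polynomial.coeff_add, ha, hb, map_add, map_add]
  | h0 => simp
  | hsmul c a ha => rw [map_smul, Polynomial.coeff_smul, ha, map_smul, Algebra.algebraMap_eq_smul_one,
      Algebra.algebraMap_eq_smul_one, smul_assoc]

theorem coeff_eq_zero_of_mem_pow {a : UniversalEnvelopingAlgebra k L} {m : ℕ} (ha : a ∈ augIdeal k L ^ m) {j : ℕ} (hj : j < m) :
    (δ a).coeff j = 0 := by
  induction m generalizing a j with
  | zero => omega
  | succ m ih =>
    rw [Submodule.pow_succ] at ha
    induction ha using Submodule.mul_induction_on' with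
    | add a _ b _ ha hb => rw [map_add, Polynomial.coeff_add, ha, hb, add_zero]
    | mem_mul_mem a ha b hb =>
      rw [map_mul, Polynomial.coeff_mul]
      refine sum_eq_zero fun ⟨p, q⟩ hpq => ?_
      replace hpq := HasAntidiagonal.mem_antidiagonal.1 hpq
      change p + q = j at hpq
      change (δ a).coeff p * (δ b).coeff q = 0
      rcases Nat.lt_or_ge p m with hp | hp
      · rw [ih ha hp, zero_mul]
      · obtain rfl : q = 0 := by omega
        rw [h.coeff_zero_apply, show augU k L b = 0 from hb, map_zero, mul_zero]

end IsGradedBy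

end Graded

/-! ### Primitive elements of enveloping algebras -/

section Dynkin

variable {k : Type u} [CommRing k] {L : Type*} [LieRing L] [LieAlgebra k L] {X : Type*}

/-- The two-sided action of `L × L` on `U(L)[X]` in which the first factor acts by left
multiplication through the grading morphism and the second factor by the opposite of right
multiplication. -/
def twoSidedLie (δ : UniversalEnvelopingAlgebra k L →ₐ[k]
    Polynomial (UniversalEnvelopingAlgebra k L)) :
    L × L →ₗ⁅k⁆ Module.End k (Polynomial (UniversalEnvelopingAlgebra k L)) where
  toFun x := LinearMap.mulLeft k (δ (UniversalEnvelopingAlgebra.ι k x.1)) -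
    LinearMap.mulRight k (Polynomial.C (UniversalEnvelopingAlgebra.ι k x.2))
  map_add' x y := by
    ext1 z
    simp only [Prod.fst_add, Prod.snd_add, map_add, LinearMap.sub_apply, LinearMap.mulLeft_apply,
      LinearMap.mulRight_apply, LinearMap.add_apply, add_mul, mul_add]
    abel
  map_smul' c x := by
    ext1 z
    simp only [Prod.smul_fst, Prod.smul_snd, map_smul, LinearMap.sub_apply,
      LinearMap.mulLeft_apply, LinearMap.mulRight_apply, LinearMap.smul_apply, smul_mul_assoc,
      RingHom.id_apply, smul_sub, ← Polynomial.smul_C, mul_smul_comm]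
  map_lie' {x y} := by
    ext1 z
    simp only [LieAlgebra.Prod.bracket_apply, LieHom.map_lie, Ring.lie_def, map_sub, map_mul,
      LinearMap.sub_apply, LinearMap.mulLeft_apply, LinearMap.mulRight_apply, Module.End.mul_apply]
    noncomm_ring

/-- The two-sided action of `U(L × L)` on `U(L)[X]`. -/
def twoSided (δ : UniversalEnvelopingAlgebra k L →ₐ[k]
    Polynomial (UniversalEnvelopingAlgebra k L)) :
    UniversalEnvelopingAlgebra k (L × L) →ₐ[k]
      Module.End k (Polynomial (UniversalEnvelopingAlgebra k L)) :=
  UniversalEnvelopingAlgebra.lift k (twoSidedLie δ)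

/-- The derivative of a polynomial at `1`. -/
def derivOne (k : Type u) [CommRing k] (A : Type*) [Ring A] [Algebra k A] :
    Polynomial A →ₗ[k] A :=
  (evalOne k A).toLinearMap ∘ₗ (Polynomial.derivative.restrictScalars k)

/-- The Dynkin operator `a ⊗ b ↦ Y(a) S(b)` on `U(L × L) = U(L) ⊗ U(L)`, where `Y` is the derivation
multiplying by the degree and `S` the antipode. Composed with the coproduct, it maps a word to the
iterated bracket of its letters. -/
def dynkin (δ : UniversalEnvelopingAlgebra k L →ₐ[k]
    Polynomial (UniversalEnvelopingAlgebra k L)) :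
    UniversalEnvelopingAlgebra k (L × L) →ₗ[k] UniversalEnvelopingAlgebra k L :=
  derivOne k _ ∘ₗ LinearMap.applyₗ 1 ∘ₗ (twoSided δ).toLinearMap

/-- The diagonal morphism. -/
abbrev diagLie (k : Type u) [CommRing k] (L : Type*) [LieRing L] [LieAlgebra k L] :
    L →ₗ⁅k⁆ L × L := LieHom.prod LieHom.id LieHom.id

variable {δ : UniversalEnvelopingAlgebra k L →ₐ[k]
    Polynomial (UniversalEnvelopingAlgebra k L)}

theorem dynkin_apply (p : UniversalEnvelopingAlgebra k (L × L)) :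
    dynkin δ p = derivOne k _ (twoSided δ p 1) := rfl

theorem derivOne_X_sub_one_mul {A : Type*} [Ring A] [Algebra k A] (p : Polynomial A) :
    derivOne k A ((Polynomial.X - 1) * p) = evalOne k A p := by
  change evalOne k A (Polynomial.derivative _) = _
  rw [Polynomial.derivative_mul, Polynomial.derivative_sub, Polynomial.derivative_X,
    Polynomial.derivative_one, sub_zero, one_mul, map_add, map_mul, map_sub, evalOne_X, map_one,
    sub_self, zero_mul, add_zero]

theorem twoSided_ι (x : L × L) (z : Polynomial (UniversalEnvelopingAlgebra k L)) :
    twoSided δ (UniversalEnvelopingAlgebra.ι k x) z =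
      δ (UniversalEnvelopingAlgebra.ι k x.1) * z -
        z * Polynomial.C (UniversalEnvelopingAlgebra.ι k x.2) := by
  rw [twoSided, UniversalEnvelopingAlgebra.lift_ι_apply]; rfl

theorem twoSided_inl (a : UniversalEnvelopingAlgebra k L)
    (z : Polynomial (UniversalEnvelopingAlgebra k L)) :
    twoSided δ (mapU (LieHom.inl k L L) a) z = δ a * z := by
  induction a using envelopingAlgebra_induction generalizing z with
  | hι y => rw [mapU_ι, twoSided_ι]; simp
  | hc c => rw [AlgHom.commutes, AlgHom.commutes, AlgHom.commutes, Module.algebraMap_end_apply,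
      Algebra.smul_def]
  | hadd x y hx hy => rw [map_add, map_add, map_add, LinearMap.add_apply, hx, hy, add_mul]
  | hmul x y hx hy => rw [map_mul, map_mul, map_mul, Module.End.mul_apply, hy, hx, mul_assoc]

theorem twoSided_inr (a : UniversalEnvelopingAlgebra k L) (c : UniversalEnvelopingAlgebra k L) :
    ∃ d, twoSided δ (mapU (LieHom.inr k L L) a) (Polynomial.C c) = Polynomial.C d := by
  induction a using envelopingAlgebra_induction generalizing c with
  | hι y => exact ⟨-(c * UniversalEnvelopingAlgebra.ι k y), by rw [mapU_ι, twoSided_ι]; simp⟩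
  | hc r => exact ⟨r • c, by
      rw [AlgHom.commutes, AlgHom.commutes, Module.algebraMap_end_apply, Polynomial.smul_C]⟩
  | hadd x y hx hy =>
    obtain ⟨d, hd⟩ := hx c
    obtain ⟨e, he⟩ := hy c
    exact ⟨d + e, by rw [map_add, map_add, LinearMap.add_apply, hd, he, map_add]⟩
  | hmul x y hx hy =>
    obtain ⟨d, hd⟩ := hy c
    obtain ⟨e, he⟩ := hx d
    exact ⟨e, by rw [map_mul, map_mul, Module.End.mul_apply, hd, he]⟩

theorem twoSided_X_sub_one_mul (p : UniversalEnvelopingAlgebra k (L × L))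
    (z : Polynomial (UniversalEnvelopingAlgebra k L)) :
    twoSided δ p ((Polynomial.X - 1) * z) = (Polynomial.X - 1) * twoSided δ p z := by
  have hX : ∀ q : Polynomial (UniversalEnvelopingAlgebra k L),
      q * (Polynomial.X - 1) = (Polynomial.X - 1) * q := fun q => by
    rw [mul_sub, sub_mul, Polynomial.X_mul, mul_one, one_mul]
  induction p using envelopingAlgebra_induction generalizing z with
  | hι y => rw [twoSided_ι, twoSided_ι, mul_sub, ← mul_assoc, hX]; simp only [mul_assoc]
  | hc c => rw [AlgHom.commutes, Module.algebraMap_end_apply, Module.algebraMap_end_apply,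
      mul_smul_comm]
  | hadd x y hx hy =>
    rw [map_add, LinearMap.add_apply, LinearMap.add_apply, hx, hy, mul_add]
  | hmul x y hx hy =>
    rw [map_mul (twoSided δ), Module.End.mul_apply, Module.End.mul_apply, hy, hx]

theorem dynkin_inl (a : UniversalEnvelopingAlgebra k L) :
    dynkin δ (mapU (LieHom.inl k L L) a) = derivOne k _ (δ a) := by
  rw [dynkin_apply, twoSided_inl, mul_one]

theorem dynkin_inr (a : UniversalEnvelopingAlgebra k L) :
    dynkin δ (mapU (LieHom.inr k L L) a) = 0 := by
  obtain ⟨d, hd⟩ := twoSided_inr (δ := δ) a 1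
  rw [map_one] at hd
  rw [dynkin_apply, hd]
  change evalOne k _ (Polynomial.derivative _) = 0
  rw [Polynomial.derivative_C, map_zero]

namespace IsGradedBy

variable {t : X → L} (h : IsGradedBy t δ)

include h

/-- At `X = 1` the diagonal of `L × L` acts on `U(L)` by the adjoint action; hence words map Lie
elements to Lie elements, and raise the degree by their length. -/
theorem evalOne_diag_word (w : List X) (z : Polynomial (UniversalEnvelopingAlgebra k L)) {y : L}
    {d : ℕ} (hz : evalOne k _ z = UniversalEnvelopingAlgebra.ι k y)
    (hy : δ (UniversalEnvelopingAlgebra.ι k y) =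
      Polynomial.C (UniversalEnvelopingAlgebra.ι k y) * Polynomial.X ^ d) :
    ∃ y' : L, evalOne k _ (twoSided δ (mapU (diagLie k L) (wordProd k t w)) z) =
        UniversalEnvelopingAlgebra.ι k y' ∧
      δ (UniversalEnvelopingAlgebra.ι k y') =
        Polynomial.C (UniversalEnvelopingAlgebra.ι k y') * Polynomial.X ^ (w.length + d) := by
  induction w with
  | nil => exact ⟨y, by simp [wordProd, hz], by simpa using hy⟩
  | cons x w ih =>
    obtain ⟨y', h1, h2⟩ := ih
    refine ⟨⁅t x, y'⁆, ?_, ?_⟩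
    · rw [wordProd_cons, map_mul, map_mul, Module.End.mul_apply, mapU_ι, twoSided_ι, map_sub,
        map_mul, map_mul, h1, evalOne_C, LieHom.map_lie, Ring.lie_def]
      rw [show ((diagLie k L) (t x)).1 = t x from rfl, show ((diagLie k L) (t x)).2 = t x from rfl,
        h.evalOne_apply]
    · have hc : ∀ a b : UniversalEnvelopingAlgebra k L, ∀ i j : ℕ,
          Polynomial.C a * Polynomial.X ^ i * (Polynomial.C b * Polynomial.X ^ j) =
            Polynomial.C (a * b) * Polynomial.X ^ (i + j) := fun a b i j => by
        rw [mul_assoc, ← mul_assoc (Polynomial.X ^ i), Polynomial.X_pow_mul, mul_assoc, ← pow_add,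
          ← mul_assoc, map_mul]
      have hx := h.apply_gen x
      rw [← pow_one (Polynomial.X)] at hx
      rw [LieHom.map_lie, Ring.lie_def, map_sub, map_mul, map_mul, hx, h2, hc, hc, map_sub, sub_mul,
        List.length_cons, add_comm 1, add_right_comm]

/-- The Dynkin operator maps the coproduct of a word to a Lie element, homogeneous of degree the
length of the word. -/
theorem dynkin_word (w : List X) : ∃ y : L,
    dynkin δ (mapU (diagLie k L) (wordProd k t w)) = UniversalEnvelopingAlgebra.ι k y ∧
      δ (UniversalEnvelopingAlgebra.ι k y) =
        Polynomial.C (UniversalEnvelopingAlgebra.ι k y) * Polynomial.X ^ w.length := by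
  induction w using List.reverseRecOn with
  | nil =>
    refine ⟨0, ?_, by simp⟩
    rw [dynkin_apply]
    change evalOne k _ (Polynomial.derivative _) = _
    simp [wordProd]
  | append_singleton w x =>
    have hx := h.apply_gen x
    obtain ⟨y, h1, h2⟩ := h.evalOne_diag_word w (d := 1)
      (z := Polynomial.C (UniversalEnvelopingAlgebra.ι k (t x))) (evalOne_C _)
      (by rw [hx, pow_one])
    refine ⟨y, ?_, by rw [h2, List.length_append]; rfl⟩
    have e : δ (UniversalEnvelopingAlgebra.ι k (t x)) * 1 -
        1 * Polynomial.C (UniversalEnvelopingAlgebra.ι k (t x)) =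
        (Polynomial.X - 1) * Polynomial.C (UniversalEnvelopingAlgebra.ι k (t x)) := by
      rw [hx, mul_one, one_mul, sub_mul, Polynomial.X_mul, one_mul]
    have e1 : wordProd k t [x] = UniversalEnvelopingAlgebra.ι k (t x) := by simp [wordProd]
    rw [dynkin_apply, wordProd_append, map_mul, map_mul, Module.End.mul_apply, e1, mapU_ι,
      twoSided_ι]
    rw [show ((diagLie k L) (t x)).1 = t x from rfl, show ((diagLie k L) (t x)).2 = t x from rfl, e,
      twoSided_X_sub_one_mul, derivOne_X_sub_one_mul, h1]

theorem dynkin_coeff (a : UniversalEnvelopingAlgebra k L) (j : ℕ) :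
    (δ (dynkin δ (mapU (diagLie k L) a))).coeff j =
      dynkin δ (mapU (diagLie k L) ((δ a).coeff j)) := by
  induction a using h.word_induction with
  | hw w =>
    obtain ⟨y, h1, h2⟩ := h.dynkin_word w
    rw [h1, h2, Polynomial.coeff_C_mul_X_pow, h.coeff_wordProd]
    split_ifs with hj
    · rw [h1]
    · rw [map_zero, map_zero]
  | hadd a b ha hb => simp only [map_add, Polynomial.coeff_add, ha, hb]
  | h0 => simp
  | hsmul c a ha => simp only [map_smul, Polynomial.coeff_smul, ha]

theorem dynkin_mem (a : UniversalEnvelopingAlgebra k L) :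
    ∃ y : L, dynkin δ (mapU (diagLie k L) a) = UniversalEnvelopingAlgebra.ι k y := by
  induction a using h.word_induction with
  | hw w =>
    obtain ⟨y, h1, -⟩ := h.dynkin_word w
    exact ⟨y, h1⟩
  | hadd a b ha hb =>
    obtain ⟨y, hy⟩ := ha
    obtain ⟨z, hz⟩ := hb
    exact ⟨y + z, by rw [map_add, map_add, hy, hz, map_add]⟩
  | h0 => exact ⟨0, by simp⟩
  | hsmul c a ha =>
    obtain ⟨y, hy⟩ := ha
    exact ⟨c • y, by rw [map_smul, map_smul, hy, map_smul]⟩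

/-- The operator `derivOne` of `δ a` multiplies the component of `a` of degree `j` by `j`. -/
theorem coeff_derivOne (a : UniversalEnvelopingAlgebra k L) (j : ℕ) :
    (δ (derivOne k _ (δ a))).coeff j = (j : k) • (δ a).coeff j := by
  induction a using h.word_induction with
  | hw w =>
    have e : derivOne k _ (δ (wordProd k t w)) = (w.length : k) • wordProd k t w := by
      change evalOne k _ (Polynomial.derivative _) = _
      rw [h.apply_wordProd, Polynomial.derivative_C_mul_X_pow, map_mul, map_pow, evalOne_X,
        one_pow, mul_one, evalOne_C, ← nsmul_eq_mul', Nat.cast_smul_eq_nsmul]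
    rw [e, map_smul, Polynomial.coeff_smul, h.coeff_wordProd]
    split_ifs with hj
    · rw [hj]
    · rw [smul_zero, smul_zero]
  | hadd a b ha hb => simp only [map_add, Polynomial.coeff_add, ha, hb, smul_add]
  | h0 => simp
  | hsmul c a ha => simp only [map_smul, Polynomial.coeff_smul, ha, smul_comm (j : k) c]

end IsGradedBy

end Dynkin

section DynkinFiltration

variable {k : Type u} [CommRing k] {L : Type*} [LieRing L] [LieAlgebra k L] {X : Type*}
  {δ : UniversalEnvelopingAlgebra k L →ₐ[k] Polynomial (UniversalEnvelopingAlgebra k L)}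
  {t : X → L}

namespace IsGradedBy

theorem pow_antitone_aug {i j : ℕ} (h : i ≤ j) : augIdeal k L ^ j ≤ augIdeal k L ^ i :=
  Ideal.pow_le_pow_right h

variable (h : IsGradedBy t δ)

include h

theorem coeff_mem_of_mem {a : UniversalEnvelopingAlgebra k L} (ha : a ∈ augIdeal k L) (j : ℕ) :
    (δ a).coeff j ∈ augIdeal k L := by
  rcases Nat.eq_zero_or_pos j with rfl | hj
  · rw [h.coeff_zero_apply, show augU k L a = 0 from ha, map_zero]
    exact zero_mem _
  · have := pow_antitone_aug (show 1 ≤ j from hj) (h.coeff_mem_pow a j)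
    rwa [Submodule.pow_one] at this

/-- Modulo the next power of the augmentation ideal, `U(L × L)` acts through its augmentation. -/
theorem twoSided_sub_mem (p : UniversalEnvelopingAlgebra k (L × L)) {i : ℕ}
    {z : Polynomial (UniversalEnvelopingAlgebra k L)} (hz : ∀ j, z.coeff j ∈ augIdeal k L ^ i)
    (j : ℕ) : (twoSided δ p z - augU k (L × L) p • z).coeff j ∈ augIdeal k L ^ (i + 1) := by
  induction p using envelopingAlgebra_induction generalizing z j with
  | hι y =>
    rw [augU_ι, zero_smul, sub_zero, twoSided_ι, Polynomial.coeff_sub, Polynomial.coeff_mul_C,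
      Polynomial.coeff_mul]
    refine sub_mem (sum_mem fun ⟨a, b⟩ _ => ?_) ?_
    · rw [Ideal.IsTwoSided.pow_succ]
      exact Ideal.mul_mem_mul (h.coeff_mem_of_mem (ι_mem_augIdeal _) _) (hz _)
    · rw [Submodule.pow_succ]
      exact Ideal.mul_mem_mul (hz _) (ι_mem_augIdeal _)
  | hc c =>
    rw [AlgHom.commutes, AlgHom.commutes, Module.algebraMap_end_apply, Algebra.algebraMap_self_apply,
      sub_self, Polynomial.coeff_zero]
    exact zero_mem _
  | hadd x y hx hy =>
    have e : twoSided δ (x + y) z - augU k (L × L) (x + y) • z =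
        (twoSided δ x z - augU k (L × L) x • z) + (twoSided δ y z - augU k (L × L) y • z) := by
      rw [map_add, map_add, LinearMap.add_apply, add_smul]; abel
    rw [e, Polynomial.coeff_add]
    exact add_mem (hx hz j) (hy hz j)
  | hmul x y hx hy =>
    have e : twoSided δ (x * y) z - augU k (L × L) (x * y) • z =
        (twoSided δ x (twoSided δ y z) - augU k (L × L) x • twoSided δ y z) +
          augU k (L × L) x • (twoSided δ y z - augU k (L × L) y • z) := by
      rw [map_mul, map_mul, Module.End.mul_apply, mul_smul, smul_sub]; abel
    have hy' : ∀ j, (twoSided δ y z).coeff j ∈ augIdeal k L ^ i := fun j => by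
      have := pow_antitone_aug (Nat.le_succ i) (hy hz j)
      rw [Polynomial.coeff_sub, Polynomial.coeff_smul, Algebra.smul_def] at this
      simpa using add_mem this (Ideal.mul_mem_left _ (algebraMap k _ (augU k (L × L) y)) (hz j))
    rw [e, Polynomial.coeff_add, Polynomial.coeff_smul]
    refine add_mem (hx hy' j) ?_
    rw [Algebra.smul_def]
    exact Ideal.mul_mem_left _ _ (hy hz j)

theorem twoSided_mem {m : ℕ} {p : UniversalEnvelopingAlgebra k (L × L)}
    (hp : p ∈ augIdeal k (L × L) ^ m) {i : ℕ} {z : Polynomial (UniversalEnvelopingAlgebra k L)}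
    (hz : ∀ j, z.coeff j ∈ augIdeal k L ^ i) (j : ℕ) :
    (twoSided δ p z).coeff j ∈ augIdeal k L ^ (i + m) := by
  induction m generalizing i z j p with
  | zero =>
    have := pow_antitone_aug (Nat.le_succ i) (h.twoSided_sub_mem p hz j)
    rw [Polynomial.coeff_sub, Polynomial.coeff_smul, Algebra.smul_def] at this
    simpa using add_mem this (Ideal.mul_mem_left _ (algebraMap k _ (augU k (L × L) p)) (hz j))
  | succ m ih =>
    rw [Submodule.pow_succ] at hp
    induction hp using Submodule.mul_induction_on' with
    | add a _ b _ ha hb =>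
      rw [map_add, LinearMap.add_apply, Polynomial.coeff_add]
      exact add_mem ha hb
    | mem_mul_mem a ha b hb =>
      have hb' : augU k (L × L) b = 0 := hb
      have h1 := fun j => h.twoSided_sub_mem b hz j
      simp only [hb', zero_smul, sub_zero] at h1
      rw [map_mul, Module.End.mul_apply, show i + (m + 1) = (i + 1) + m by omega]
      exact ih ha h1 j

/-- The Dynkin operator is continuous for the topologies defined by the augmentation ideals. -/
theorem dynkin_mem_pow {m : ℕ} {p : UniversalEnvelopingAlgebra k (L × L)}
    (hp : p ∈ augIdeal k (L × L) ^ m) : dynkin δ p ∈ augIdeal k L ^ m := by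
  have h1 : ∀ j, (twoSided δ p 1).coeff j ∈ augIdeal k L ^ m := fun j => by
    have := h.twoSided_mem hp (i := 0) (z := 1) (fun j => by
      rw [Submodule.pow_zero, Ideal.one_eq_top]; trivial) j
    rwa [zero_add] at this
  rw [dynkin_apply]
  change evalOne k _ (Polynomial.derivative _) ∈ _
  rw [evalOne_eq_sum _ (Nat.lt_succ_self _)]
  refine sum_mem fun j _ => ?_
  rw [Polynomial.coeff_derivative, ← Nat.cast_succ, ← nsmul_eq_mul']
  exact nsmul_mem (h1 _) _

/-- Primitive elements are Lie elements, modulo powers of the augmentation ideal: the Dynkin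
operator maps `U(L)` to `L`, and multiplies a primitive element of degree `j` by `j`. -/
theorem exists_ι_of_primitive [Algebra ℚ k] {m : ℕ} {a : UniversalEnvelopingAlgebra k L}
    (ha : a ∈ augIdeal k L) (hprim : mapU (diagLie k L) a - mapU (LieHom.inl k L L) a -
      mapU (LieHom.inr k L L) a ∈ augIdeal k (L × L) ^ m) :
    ∃ y : L, a - UniversalEnvelopingAlgebra.ι k y ∈ augIdeal k L ^ m := by
  have h1 := h.dynkin_mem_pow hprim
  rw [map_sub, map_sub, dynkin_inl, dynkin_inr, sub_zero] at h1
  -- the component of `a` of degree `j`, multiplied by `j`, is a Lie element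
  have h2 : ∀ j < m, (j : k) • (δ a).coeff j =
      dynkin δ (mapU (diagLie k L) ((δ a).coeff j)) := fun j hj => by
    have := h.coeff_eq_zero_of_mem_pow h1 hj
    rw [map_sub, Polynomial.coeff_sub, h.dynkin_coeff, h.coeff_derivOne, sub_eq_zero] at this
    exact this.symm
  have h3 : ∀ j < m, ∃ y : L, (δ a).coeff j = UniversalEnvelopingAlgebra.ι k y := fun j hj => by
    rcases Nat.eq_zero_or_pos j with rfl | hj0
    · exact ⟨0, by rw [h.coeff_zero_apply, show augU k L a = 0 from ha, map_zero, map_zero]⟩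
    · obtain ⟨y, hy⟩ := h.dynkin_mem ((δ a).coeff j)
      refine ⟨algebraMap ℚ k ((j : ℚ)⁻¹) • y, ?_⟩
      have hj1 : algebraMap ℚ k ((j : ℚ)⁻¹) * (j : k) = 1 := by
        rw [← map_natCast (algebraMap ℚ k) j, ← map_mul, inv_mul_cancel₀, map_one]
        exact_mod_cast hj0.ne'
      rw [map_smul, ← hy, ← h2 j hj, smul_smul, hj1, one_smul]
  choose! y hy using h3
  refine ⟨∑ j ∈ range m, y j, ?_⟩
  set N := max m ((δ a).natDegree + 1)
  have e : a = ∑ j ∈ range N, (δ a).coeff j := by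
    rw [← evalOne_eq_sum (k := k) _ (show (δ a).natDegree < N by omega), h.evalOne_apply]
  have e2 : a - UniversalEnvelopingAlgebra.ι k (∑ j ∈ range m, y j) =
      ∑ j ∈ Ico m N, (δ a).coeff j := by
    rw [map_sum, ← sum_congr rfl fun j hj => hy j (mem_range.1 hj), sub_eq_iff_eq_add']
    exact e.trans (sum_range_add_sum_Ico _ (le_max_left _ _)).symm
  rw [e2]
  exact sum_mem fun j hj => pow_antitone_aug (mem_Ico.1 hj).1 (h.coeff_mem_pow a j)

/-- Group-like elements of the completed enveloping algebra belong to the group `exp`. -/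
theorem mem_expSubgroup [Algebra ℚ k] {u : (UHat k L)ˣ} (hu1 : Compl.proj 1 (u : UHat k L) = 1)
    (hu : UHat.map (diagLie k L) (u : UHat k L) =
      UHat.map (LieHom.inl k L L) u * UHat.map (LieHom.inr k L L) u) : u ∈ expSubgroup k L := by
  obtain ⟨x, hx, hx1, hpoly⟩ := exists_isExpOf hu1
  have hprim := map_add_of_map_mul hx hx1 hpoly (fun a b => by
    rw [LieHom.inl_apply, LieHom.inr_apply, LieAlgebra.Prod.bracket_apply]; simp) hu
  refine Subgroup.subset_closure ⟨x, fun m => ?_, hx⟩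
  obtain ⟨a, ha⟩ := Ideal.Quotient.mk_surjective (Compl.proj (m + 1) x)
  have ha1 := Compl.mk_eq_proj_of_le ha (show 1 ≤ m + 1 by omega)
  rw [hx1, Ideal.Quotient.eq_zero_iff_mem, Submodule.pow_one] at ha1
  have hm := congrArg (Compl.proj (m + 1)) hprim
  rw [map_add, UHat.map, UHat.map, UHat.map, Compl.proj_map, Compl.proj_map, Compl.proj_map, ← ha,
    levelMap_mk, levelMap_mk, levelMap_mk, ← map_add, Ideal.Quotient.mk_eq_mk_iff_sub_mem,
    ← sub_sub] at hm
  obtain ⟨y, hy⟩ := h.exists_ι_of_primitive ha1 hm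
  refine ⟨y, ?_⟩
  rw [← Compl.mk_eq_proj_of_le ha (Nat.le_succ m), Ideal.Quotient.mk_eq_mk_iff_sub_mem]
  exact pow_antitone_aug (Nat.le_succ m) hy

end IsGradedBy

end DynkinFiltration

/-! ### The associated graded algebra of an ideal -/

section AssocGraded

variable {k : Type u} [CommRing k] {A B : Type*} [Ring A] [Algebra k A] [Ring B] [Algebra k B]

variable (k) in
/-- The subalgebra `⊕ J ^ m X ^ m` of `A[X]`. -/
def powerSubalgebra (J : Ideal A) [J.IsTwoSided] : Subalgebra k (Polynomial A) where
  carrier := {p | ∀ m, p.coeff m ∈ J ^ m}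
  mul_mem' hp hq m := by
    rw [Polynomial.coeff_mul]
    refine sum_mem fun ⟨i, j⟩ hij => ?_
    rw [← HasAntidiagonal.mem_antidiagonal.1 hij, Ideal.IsTwoSided.pow_add]
    exact Ideal.mul_mem_mul (hp i) (hq j)
  add_mem' hp hq m := by
    rw [Polynomial.coeff_add]
    exact add_mem (hp m) (hq m)
  algebraMap_mem' c m := by
    rw [Polynomial.algebraMap_apply, Polynomial.coeff_C]
    split_ifs with h
    · rw [h, Submodule.pow_zero, Ideal.one_eq_top]; trivial
    · exact zero_mem _

variable (k) in
/-- The ideal `⊕ J ^ (m + 1) X ^ m` of `⊕ J ^ m X ^ m`. -/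
def powerIdeal (J : Ideal A) [J.IsTwoSided] : Ideal (powerSubalgebra k J) where
  carrier := {p | ∀ m, (p : Polynomial A).coeff m ∈ J ^ (m + 1)}
  add_mem' hp hq m := by
    rw [Subalgebra.coe_add, Polynomial.coeff_add]
    exact add_mem (hp m) (hq m)
  zero_mem' m := by simp
  smul_mem' p q hq m := by
    rw [smul_eq_mul, Subalgebra.coe_mul, Polynomial.coeff_mul]
    refine sum_mem fun ⟨i, j⟩ hij => ?_
    rw [← HasAntidiagonal.mem_antidiagonal.1 hij, add_assoc, Ideal.IsTwoSided.pow_add]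
    exact Ideal.mul_mem_mul (p.2 i) (hq j)

instance (J : Ideal A) [J.IsTwoSided] : (powerIdeal k J).IsTwoSided where
  mul_mem_of_left {p} q hp m := by
    rw [Subalgebra.coe_mul, Polynomial.coeff_mul]
    refine sum_mem fun ⟨i, j⟩ hij => ?_
    rw [← HasAntidiagonal.mem_antidiagonal.1 hij, add_right_comm, Ideal.IsTwoSided.pow_add]
    exact Ideal.mul_mem_mul (hp i) (q.2 j)

variable (k) in
/-- The associated graded algebra `⊕ J ^ m / J ^ (m + 1)`. -/
abbrev AssocGraded (J : Ideal A) [J.IsTwoSided] : Type _ := powerSubalgebra k J ⧸ powerIdeal k J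

variable (k) in
/-- The class in degree `m` of an element of `J ^ m`. -/
def grElt {J : Ideal A} [J.IsTwoSided] (m : ℕ) (a : A) (ha : a ∈ J ^ m) : AssocGraded k J :=
  Ideal.Quotient.mk (powerIdeal k J) ⟨Polynomial.monomial m a, fun j => by
    rw [Polynomial.coeff_monomial]
    split_ifs with h
    · rwa [← h]
    · exact zero_mem _⟩

variable {J : Ideal A} [J.IsTwoSided] {K : Ideal B} [K.IsTwoSided]

theorem grElt_eq_zero_iff {m : ℕ} {a : A} (ha : a ∈ J ^ m) :
    grElt k m a ha = 0 ↔ a ∈ J ^ (m + 1) := by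
  rw [grElt, Ideal.Quotient.eq_zero_iff_mem]
  refine ⟨fun h => by simpa using h m, fun h j => ?_⟩
  change (Polynomial.monomial m a).coeff j ∈ _
  rw [Polynomial.coeff_monomial]
  split_ifs with hj
  · rwa [← hj]
  · exact zero_mem _

theorem grElt_add {m : ℕ} {a b : A} (ha : a ∈ J ^ m) (hb : b ∈ J ^ m) :
    grElt k m (a + b) (add_mem ha hb) = grElt k m a ha + grElt k m b hb := by
  rw [grElt, grElt, grElt, ← map_add]
  exact congrArg _ (Subtype.ext (map_add _ _ _))

theorem grElt_sub {m : ℕ} {a b : A} (ha : a ∈ J ^ m) (hb : b ∈ J ^ m) :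
    grElt k m (a - b) (sub_mem ha hb) = grElt k m a ha - grElt k m b hb := by
  rw [grElt, grElt, grElt, ← map_sub]
  exact congrArg _ (Subtype.ext (map_sub _ _ _))

theorem grElt_smul {m : ℕ} (c : k) {a : A} (ha : a ∈ J ^ m) (hc : c • a ∈ J ^ m) :
    grElt k m (c • a) hc = c • grElt k m a ha := by
  change _ = Ideal.Quotient.mk _ (c • _)
  rw [grElt]
  exact congrArg _ (Subtype.ext (Polynomial.smul_monomial _ _ _).symm)

theorem grElt_mul {i j : ℕ} {a b : A} (ha : a ∈ J ^ i) (hb : b ∈ J ^ j)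
    (hab : a * b ∈ J ^ (i + j)) :
    grElt k (i + j) (a * b) hab = grElt k i a ha * grElt k j b hb := by
  rw [grElt, grElt, grElt, ← map_mul]
  exact congrArg _ (Subtype.ext (Polynomial.monomial_mul_monomial _ _ _ _).symm)

theorem grElt_eq_iff {m : ℕ} {a b : A} (ha : a ∈ J ^ m) (hb : b ∈ J ^ m) :
    grElt k m a ha = grElt k m b hb ↔ a - b ∈ J ^ (m + 1) := by
  rw [← sub_eq_zero, ← grElt_sub, grElt_eq_zero_iff]

/-- The morphism of associated graded algebras induced by `f : A → B` with `f J ⊆ K`. -/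
def AssocGraded.map (f : A →ₐ[k] B) (h : J ≤ K.comap (f : A →+* B)) :
    AssocGraded k J →ₐ[k] AssocGraded k K :=
  Ideal.Quotient.liftₐ (powerIdeal k J)
    ((Ideal.Quotient.mkₐ k (powerIdeal k K)).comp
      (((Polynomial.mapAlgHom f).comp (powerSubalgebra k J).val).codRestrict _ fun p m => by
        change ((p : Polynomial A).map (f : A →+* B)).coeff m ∈ _
        rw [Polynomial.coeff_map]
        exact pow_le_comap (f : A →+* B) h m (p.2 m)))
    fun p hp => by
      change Ideal.Quotient.mk _ _ = 0
      rw [Ideal.Quotient.eq_zero_iff_mem]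
      intro m
      change ((p : Polynomial A).map (f : A →+* B)).coeff m ∈ _
      rw [Polynomial.coeff_map]
      exact pow_le_comap (f : A →+* B) h (m + 1) (hp m)

theorem AssocGraded.map_grElt (f : A →ₐ[k] B) (h : J ≤ K.comap (f : A →+* B)) {m : ℕ} {a : A}
    (ha : a ∈ J ^ m) : AssocGraded.map f h (grElt k m a ha) =
      grElt k m (f a) (pow_le_comap (f : A →+* B) h m ha) :=
  congrArg (Ideal.Quotient.mk (powerIdeal k K)) (Subtype.ext (Polynomial.map_monomial _))

end AssocGraded

/-! ### The filtration of an adic completion -/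

namespace Compl

section

variable {k : Type u} [CommRing k] {A B : Type*} [Ring A] [Algebra k A] [Ring B] [Algebra k B]
  {J : Ideal A} [J.IsTwoSided] {K : Ideal B} [K.IsTwoSided]

variable (J) in
/-- The canonical map from a ring to its completion. -/
def of : A →+* Compl J where
  toFun a := Compl.mk (fun m => Ideal.Quotient.mk (J ^ m) a) fun _ => rfl
  map_one' := rfl
  map_mul' _ _ := rfl
  map_zero' := rfl
  map_add' _ _ := rfl

theorem proj_of (m : ℕ) (a : A) : proj m (of J a) = Ideal.Quotient.mk (J ^ m) a := rfl

theorem map_of (f : A →+* B) (h : J ≤ K.comap f) (a : A) : map f h (of J a) = of K (f a) := rfl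

instance : Algebra k (Compl J) where
  smul c x := of J (algebraMap k A c) * x
  algebraMap := (of J).comp (algebraMap k A)
  commutes' c x := Compl.ext fun m => by
    obtain ⟨a, ha⟩ := Ideal.Quotient.mk_surjective (proj m x)
    rw [map_mul, map_mul, ← ha, RingHom.comp_apply, proj_of, ← map_mul, ← map_mul,
      Algebra.commutes]
  smul_def' _ _ := rfl

theorem proj_smul (c : k) (x : Compl J) (m : ℕ) : proj m (c • x) = c • proj m x := by
  obtain ⟨a, ha⟩ := Ideal.Quotient.mk_surjective (proj m x)
  change proj m (of J (algebraMap k A c) * x) = _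
  rw [map_mul, ← ha, proj_of, ← map_mul, ← Algebra.smul_def]; rfl

theorem of_smul (c : k) (a : A) : of J (c • a) = c • of J a := by
  change _ = of J (algebraMap k A c) * of J a
  rw [← map_mul, Algebra.smul_def]

theorem map_smul (f : A →ₐ[k] B) (h : J ≤ K.comap (f : A →+* B)) (c : k) (x : Compl J) :
    map (f : A →+* B) h (c • x) = c • map (f : A →+* B) h x := by
  change map (f : A →+* B) h (of J (algebraMap k A c) * x) = of K (algebraMap k B c) * _
  rw [map_mul, map_of]
  congr 2
  exact f.commutes c

variable (J) in
/-- The kernel of the projection to `A / J ^ m`. -/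
abbrev fil (m : ℕ) : Ideal (Compl J) := RingHom.ker (proj (J := J) m)

theorem mem_fil {m : ℕ} {x : Compl J} : x ∈ fil J m ↔ proj m x = 0 := Iff.rfl

theorem of_mem_fil {m : ℕ} {a : A} : of J a ∈ fil J m ↔ a ∈ J ^ m := by
  rw [mem_fil, proj_of, Ideal.Quotient.eq_zero_iff_mem]

theorem mem_fil_zero (x : Compl J) : x ∈ fil J 0 := by
  obtain ⟨a, ha⟩ := Ideal.Quotient.mk_surjective (proj 0 x)
  rw [mem_fil, ← ha, Ideal.Quotient.eq_zero_iff_mem, Submodule.pow_zero, Ideal.one_eq_top]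
  trivial

theorem exists_sub_of_mem_fil (x : Compl J) (m : ℕ) : ∃ a, x - of J a ∈ fil J m := by
  obtain ⟨a, ha⟩ := Ideal.Quotient.mk_surjective (proj m x)
  exact ⟨a, by rw [mem_fil, map_sub, proj_of, ha, sub_self]⟩

theorem fil_antitone {i j : ℕ} (h : i ≤ j) : fil J j ≤ fil J i := fun x hx => by
  obtain ⟨a, ha⟩ := Ideal.Quotient.mk_surjective (proj j x)
  rw [mem_fil, ← mk_eq_proj_of_le ha h, Ideal.Quotient.eq_zero_iff_mem]
  rw [mem_fil.1 hx, Ideal.Quotient.eq_zero_iff_mem] at ha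
  exact Ideal.pow_le_pow_right h ha

theorem mul_mem_fil {i j : ℕ} {x y : Compl J} (hx : x ∈ fil J i) (hy : y ∈ fil J j) :
    x * y ∈ fil J (i + j) := by
  obtain ⟨a, ha⟩ := exists_sub_of_mem_fil x (i + j)
  obtain ⟨b, hb⟩ := exists_sub_of_mem_fil y (i + j)
  have ha' : a ∈ J ^ i := of_mem_fil.1 (by
    simpa using sub_mem hx (fil_antitone (Nat.le_add_right i j) ha))
  have hb' : b ∈ J ^ j := of_mem_fil.1 (by
    simpa using sub_mem hy (fil_antitone (Nat.le_add_left j i) hb))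
  have e : x * y = (x - of J a) * y + of J a * (y - of J b) + of J (a * b) := by
    rw [map_mul]; noncomm_ring
  rw [e]
  refine add_mem (add_mem (Ideal.mul_mem_right _ _ ha) (Ideal.mul_mem_left _ _ hb))
    (of_mem_fil.2 ?_)
  rw [Ideal.IsTwoSided.pow_add]
  exact Ideal.mul_mem_mul ha' hb'

theorem map_mem_fil (f : A →+* B) (h : J ≤ K.comap f) {m : ℕ} {x : Compl J} (hx : x ∈ fil J m) :
    map f h x ∈ fil K m := by
  rw [mem_fil, proj_map, mem_fil.1 hx, map_zero]

theorem smul_mem_fil (c : k) {m : ℕ} {x : Compl J} (hx : x ∈ fil J m) : c • x ∈ fil J m := by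
  rw [Algebra.smul_def]
  exact Ideal.mul_mem_left _ _ hx

theorem eq_of_sub_mem_fil {x y : Compl J} (h : ∀ m, x - y ∈ fil J m) : x = y :=
  Compl.ext fun m => sub_eq_zero.1 (by rw [← map_sub]; exact h m)

end

end Compl

/-! ### Expansions of a group relative to a finite quotient -/

section RelIdeal

variable {k : Type u} [CommRing k] {G S : Type} [Group G] [Group S] {π : G →* S}

variable (k π) in
/-- The kernel of `k[G] → k[S]`. -/
abbrev relIdeal : Ideal (MonoidAlgebra k G) := RingHom.ker (groupAlg k π)

theorem groupAlg_of (g : G) : groupAlg k π (MonoidAlgebra.of k G g) = MonoidAlgebra.of k S (π g) :=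
  MonoidAlgebra.mapDomain_single

theorem of_sub_of_mem {g h : G} (e : π g = π h) :
    MonoidAlgebra.of k G g - MonoidAlgebra.of k G h ∈ relIdeal k π := by
  rw [RingHom.mem_ker, map_sub, groupAlg_of, groupAlg_of, e, sub_self]

theorem of_sub_one_mem {g : G} (hg : π g = 1) : MonoidAlgebra.of k G g - 1 ∈ relIdeal k π := by
  rw [← map_one (MonoidAlgebra.of k G)]
  exact of_sub_of_mem (by rw [hg, map_one])

theorem mem_span_of_mem_relIdeal {a : MonoidAlgebra k G} (ha : a ∈ relIdeal k π) :
    a ∈ Submodule.span k {b : MonoidAlgebra k G | ∃ g γ, π g = 1 ∧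
      b = (MonoidAlgebra.of k G g - 1) * MonoidAlgebra.of k G γ} := by
  set τ : S → G := Function.invFun π
  -- subtracting the representatives of the cosets of `ker π` does not change `a`
  have key : ∀ a : MonoidAlgebra k G, a - MonoidAlgebra.mapDomain τ (groupAlg k π a) ∈
      Submodule.span k {b : MonoidAlgebra k G | ∃ g γ, π g = 1 ∧
        b = (MonoidAlgebra.of k G g - 1) * MonoidAlgebra.of k G γ} := by
    intro a
    induction a using MonoidAlgebra.induction_linear with
    | zero => simp
    | add x y hx hy =>
      rw [map_add, MonoidAlgebra.mapDomain_add, add_sub_add_comm]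
      exact add_mem hx hy
    | single g r =>
      have hτ : π (τ (π g)) = π g := Function.invFun_eq ⟨g, rfl⟩
      have e : (MonoidAlgebra.single g r : MonoidAlgebra k G) -
          MonoidAlgebra.mapDomain τ (groupAlg k π (MonoidAlgebra.single g r)) =
          r • ((MonoidAlgebra.of k G (g * (τ (π g))⁻¹) - 1) *
            MonoidAlgebra.of k G (τ (π g))) := by
        rw [sub_mul, ← map_mul, inv_mul_cancel_right, one_mul, smul_sub]
        simp [MonoidAlgebra.of_apply, MonoidAlgebra.mapDomain_single]
      rw [e]
      exact Submodule.smul_mem _ _ (Submodule.subset_span ⟨_, _, by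
        rw [map_mul, map_inv, hτ, mul_inv_cancel], rfl⟩)
  have := key a
  rwa [RingHom.mem_ker.1 ha, MonoidAlgebra.mapDomain_zero, sub_zero] at this

end RelIdeal

theorem UHat.map_smul {k : Type u} [CommRing k] {L L' : Type*} [LieRing L] [LieAlgebra k L]
    [LieRing L'] [LieAlgebra k L'] (f : L →ₗ⁅k⁆ L') (c : k) (x : UHat k L) :
    UHat.map f (c • x) = c • UHat.map f x :=
  Compl.map_smul (mapU f) (augIdeal_le_comap f) c x

/-- A multiplicative expansion of `G` relative to `π : G → S`, with values in the completed
enveloping algebra of `L`: a cocycle `u` on `G` (so that `γ ↦ u γ ⋅ π γ` is multiplicative in the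
crossed product with `S`), together with elements `loop x` of `ker π`, whose images have leading
terms `μ ⋅ gen x`, such that

* the elements `gen x` generate `L`, in the graded sense;
* the elements `loop x - 1` span `J / J ^ 2` as a right module over `k[S]`, `J` being the kernel of
  `k[G] → k[S]`;
* the relations of `L` hold between the classes of `loop x - 1` in the associated graded algebra of
  `J`. -/
structure Expansion (k : Type u) [CommRing k] (L : Type*) [LieRing L] [LieAlgebra k L]
    {G S : Type} [Group G] [Group S] (π : G →* S) (X : Type) where
  act : S → (L →ₗ⁅k⁆ L)
  act_one : act 1 = LieHom.id
  u : G → UHat k L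
  u_one : u 1 = 1
  u_mul : ∀ g h, u (g * h) = u g * UHat.map (act (π g)) (u h)
  u_sub_one_mem : ∀ g, u g - 1 ∈ Compl.fil (augIdeal k L) 1
  surjective : Function.Surjective π
  loop : X → G
  map_loop : ∀ x, π (loop x) = 1
  gen : X → L
  μ : k
  isUnit_μ : IsUnit μ
  u_loop : ∀ x, u (loop x) - 1 - μ • Compl.of (augIdeal k L)
    (UniversalEnvelopingAlgebra.ι k (gen x)) ∈ Compl.fil (augIdeal k L) 2
  δ : UniversalEnvelopingAlgebra k L →ₐ[k] Polynomial (UniversalEnvelopingAlgebra k L)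
  graded : IsGradedBy gen δ
  mem_span : ∀ g, π g = 1 →
    ∃ v ∈ Submodule.span k (Set.range fun x => MonoidAlgebra.of k G (loop x) - 1),
      MonoidAlgebra.of k G g - 1 - v ∈ relIdeal k π ^ 2
  θ : L →ₗ⁅k⁆ AssocGraded k (relIdeal k π)
  θ_gen : ∀ x, θ (gen x) = grElt k 1 (MonoidAlgebra.of k G (loop x) - 1)
    (by rw [Submodule.pow_one]; exact of_sub_one_mem (map_loop x))

/-- An element of the `m`-th power `I ^ m` of the augmentation ideal is congruent to its component
of degree `m` modulo `I ^ (m + 1)`. -/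
theorem IsGradedBy.sub_coeff_mem {k : Type u} [CommRing k] {L : Type*} [LieRing L]
    [LieAlgebra k L] {X : Type*} {t : X → L}
    {δ : UniversalEnvelopingAlgebra k L →ₐ[k] Polynomial (UniversalEnvelopingAlgebra k L)}
    (h : IsGradedBy t δ) {m : ℕ} {a : UniversalEnvelopingAlgebra k L}
    (ha : a ∈ augIdeal k L ^ m) : a - (δ a).coeff m ∈ augIdeal k L ^ (m + 1) := by
  set N := max (m + 1) ((δ a).natDegree + 1)
  have e : a = ∑ j ∈ range N, (δ a).coeff j := by
    rw [← evalOne_eq_sum (k := k) _ (show (δ a).natDegree < N by omega), h.evalOne_apply]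
  have e2 : a - (δ a).coeff m = ∑ j ∈ (range N).erase m, (δ a).coeff j := by
    rw [sub_eq_iff_eq_add, sum_erase_add _ _ (mem_range.2 (by omega))]
    exact e
  rw [e2]
  refine sum_mem fun j hj => ?_
  rcases lt_or_gt_of_ne (mem_erase.1 hj).1 with hjm | hjm
  · rw [h.coeff_eq_zero_of_mem_pow ha hjm]; exact zero_mem _
  · exact IsGradedBy.pow_antitone_aug hjm (h.coeff_mem_pow a j)

namespace Expansion

variable {k : Type u} [CommRing k] {L : Type*} [LieRing L] [LieAlgebra k L]
  {G S : Type} [Group G] [Group S] {π : G →* S} {X : Type} [DecidableEq S]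
  (E : Expansion k L π X)

/-- The linear extension of `γ ↦ u γ ⋅ π γ`, with values in the crossed product. -/
def eval : MonoidAlgebra k G →ₗ[k] S → UHat k L :=
  Finsupp.linearCombination k (fun γ => Pi.single (π γ) (E.u γ)) ∘ₗ
    (MonoidAlgebra.coeffLinearEquiv k).toLinearMap

theorem eval_of (g : G) : E.eval (MonoidAlgebra.of k G g) = Pi.single (π g) (E.u g) :=
  (Finsupp.linearCombination_single k 1 g).trans (one_smul k _)

theorem eval_apply (a : MonoidAlgebra k G) : E.eval a =
    a.coeff.sum fun γ c => c • (Pi.single (π γ) (E.u γ) : S → UHat k L) := rfl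

theorem eval_of_mul (g : G) (b : MonoidAlgebra k G) (r : S) :
    E.eval (MonoidAlgebra.of k G g * b) r =
      E.u g * UHat.map (E.act (π g)) (E.eval b ((π g)⁻¹ * r)) := by
  induction b using MonoidAlgebra.induction_on with
  | of γ =>
    rw [← map_mul, eval_of, eval_of, map_mul, E.u_mul]
    by_cases h : r = π g * π γ
    · rw [h, inv_mul_cancel_left, Pi.single_eq_same, Pi.single_eq_same]
    · rw [Pi.single_eq_of_ne h, Pi.single_eq_of_ne (by rwa [Ne, inv_mul_eq_iff_eq_mul]), map_zero,
        mul_zero]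
  | add x y hx hy => rw [mul_add, map_add, map_add, Pi.add_apply, Pi.add_apply, hx, hy, map_add,
      mul_add]
  | smul c x hx => rw [mul_smul_comm, LinearMap.map_smul, LinearMap.map_smul, Pi.smul_apply,
      Pi.smul_apply, hx, UHat.map_smul, mul_smul_comm]

theorem eval_mul_of (b : MonoidAlgebra k G) (γ : G) (r : S) :
    E.eval (b * MonoidAlgebra.of k G γ) r =
      E.eval b (r * (π γ)⁻¹) * UHat.map (E.act (r * (π γ)⁻¹)) (E.u γ) := by
  induction b using MonoidAlgebra.induction_on with
  | of g =>
    rw [eval_of_mul, eval_of, eval_of]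
    by_cases h : r = π g * π γ
    · rw [h, inv_mul_cancel_left, mul_inv_cancel_right, Pi.single_eq_same, Pi.single_eq_same]
    · rw [Pi.single_eq_of_ne (by rwa [Ne, inv_mul_eq_iff_eq_mul]), map_zero, mul_zero,
        Pi.single_eq_of_ne (by rwa [Ne, mul_inv_eq_iff_eq_mul]), zero_mul]
  | add x y hx hy => rw [add_mul, map_add, map_add, Pi.add_apply, Pi.add_apply, hx, hy, add_mul]
  | smul c x hx => rw [smul_mul_assoc, LinearMap.map_smul, LinearMap.map_smul, Pi.smul_apply,
      Pi.smul_apply, hx, smul_mul_assoc]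

theorem eval_mul [Fintype S] (a b : MonoidAlgebra k G) (r : S) :
    E.eval (a * b) r = ∑ s, E.eval a s * UHat.map (E.act s) (E.eval b (s⁻¹ * r)) := by
  induction a using MonoidAlgebra.induction_on with
  | of g =>
    rw [eval_of_mul, eval_of, sum_eq_single (π g), Pi.single_eq_same]
    · intro s _ hs
      rw [Pi.single_eq_of_ne hs, zero_mul]
    · simp
  | add x y hx hy => simp only [add_mul, map_add, Pi.add_apply, hx, hy, sum_add_distrib]
  | smul c x hx => simp only [smul_mul_assoc, LinearMap.map_smul, Pi.smul_apply, hx, smul_sum]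

theorem eval_sub_one_mul {g : G} (hg : π g = 1) (b : MonoidAlgebra k G) (r : S) :
    E.eval ((MonoidAlgebra.of k G g - 1) * b) r = (E.u g - 1) * E.eval b r := by
  rw [sub_mul, one_mul, map_sub, Pi.sub_apply, eval_of_mul, hg, E.act_one, UHat.map_id, inv_one,
    one_mul, sub_mul, one_mul]; rfl

theorem eval_mem_of_mem {a : MonoidAlgebra k G} (ha : a ∈ relIdeal k π) (s : S) :
    E.eval a s ∈ Compl.fil (augIdeal k L) 1 := by
  replace ha := mem_span_of_mem_relIdeal ha
  induction ha using Submodule.span_induction with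
  | mem x hx =>
    obtain ⟨g, γ, hg, rfl⟩ := hx
    rw [E.eval_sub_one_mul hg]
    exact Ideal.mul_mem_right _ _ (E.u_sub_one_mem g)
  | zero => rw [map_zero]; exact zero_mem _
  | add x y _ _ hx hy => rw [map_add]; exact add_mem hx hy
  | smul c x _ hx => rw [LinearMap.map_smul]; exact Compl.smul_mem_fil c hx

theorem eval_mem [Fintype S] {m : ℕ} {a : MonoidAlgebra k G} (ha : a ∈ relIdeal k π ^ m) (s : S) :
    E.eval a s ∈ Compl.fil (augIdeal k L) m := by
  induction m generalizing a s with
  | zero => exact Compl.mem_fil_zero _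
  | succ m ih =>
    rw [Submodule.pow_succ] at ha
    induction ha using Submodule.mul_induction_on' with
    | mem_mul_mem a ha b hb =>
      rw [eval_mul]
      exact sum_mem fun t _ => Compl.mul_mem_fil (ih ha t)
        (Compl.map_mem_fil _ _ (E.eval_mem_of_mem hb _))
    | add a _ b _ ha hb => rw [map_add]; exact add_mem ha hb

/-! ### Leading terms of expansions -/

/-- `z ∈ U(L)` is homogeneous of degree `m`, and is the leading term of `b ∈ J ^ m`, up to the
factor `μ ^ m`, both for `eval` and in the associated graded algebra of `J`. -/
structure IsLead (m : ℕ) (b : MonoidAlgebra k G) (z : UniversalEnvelopingAlgebra k L) : Prop where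
  mem : b ∈ relIdeal k π ^ m
  homog : E.δ z = Polynomial.C z * Polynomial.X ^ m
  gr : grElt k m b mem = UniversalEnvelopingAlgebra.lift k E.θ z
  eval_sub : ∀ r, E.eval b r - (Pi.single 1 (E.μ ^ m • Compl.of (augIdeal k L) z) : S → UHat k L) r ∈
    Compl.fil (augIdeal k L) (m + 1)

variable {E} {m : ℕ}

theorem IsLead.add {b b' : MonoidAlgebra k G} {z z' : UniversalEnvelopingAlgebra k L}
    (h : E.IsLead m b z) (h' : E.IsLead m b' z') : E.IsLead m (b + b') (z + z') where
  mem := add_mem h.mem h'.mem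
  homog := by rw [map_add, h.homog, h'.homog, map_add, add_mul]
  gr := by rw [grElt_add h.mem h'.mem, h.gr, h'.gr, map_add]
  eval_sub r := by
    rw [map_add, map_add, smul_add, Pi.single_add, Pi.add_apply, Pi.add_apply, add_sub_add_comm]
    exact add_mem (h.eval_sub r) (h'.eval_sub r)

theorem IsLead.smul {b : MonoidAlgebra k G} {z : UniversalEnvelopingAlgebra k L}
    (h : E.IsLead m b z) (c : k) : E.IsLead m (c • b) (c • z) where
  mem := by rw [Algebra.smul_def]; exact Ideal.mul_mem_left _ _ h.mem
  homog := by rw [map_smul, h.homog, ← Polynomial.smul_C, smul_mul_assoc]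
  gr := by rw [grElt_smul c h.mem, h.gr, map_smul]
  eval_sub r := by
    have e : (Pi.single 1 (E.μ ^ m • Compl.of (augIdeal k L) (c • z)) : S → UHat k L) r =
        c • (Pi.single 1 (E.μ ^ m • Compl.of (augIdeal k L) z) : S → UHat k L) r := by
      rw [Compl.of_smul, smul_comm]
      by_cases hr : r = 1
      · rw [hr, Pi.single_eq_same, Pi.single_eq_same]
      · rw [Pi.single_eq_of_ne hr, Pi.single_eq_of_ne hr, smul_zero]
    rw [LinearMap.map_smul, e, Pi.smul_apply, ← smul_sub]
    exact Compl.smul_mem_fil c (h.eval_sub r)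

theorem IsLead.zero : E.IsLead m 0 0 where
  mem := zero_mem _
  homog := by simp
  gr := by rw [map_zero, grElt_eq_zero_iff]; exact zero_mem _
  eval_sub r := by simp

variable (E) in
theorem isLead_one : E.IsLead 0 1 1 where
  mem := by rw [Submodule.pow_zero, Ideal.one_eq_top]; trivial
  homog := by simp
  gr := by
    rw [map_one, ← sub_eq_zero]
    change Ideal.Quotient.mk _ _ - Ideal.Quotient.mk _ 1 = 0
    rw [sub_eq_zero]
    exact congrArg _ (Subtype.ext Polynomial.monomial_zero_one)
  eval_sub r := by
    rw [← map_one (MonoidAlgebra.of k G), eval_of, map_one, E.u_one, map_one, pow_zero, one_smul,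
      sub_self]
    exact zero_mem _

/-- Multiplication by `loop x - 1` multiplies the leading term by the generator attached to `x`. -/
theorem IsLead.mul_loop [Fintype S] {b : MonoidAlgebra k G} {z : UniversalEnvelopingAlgebra k L}
    (h : E.IsLead m b z) (x : X) :
    E.IsLead (m + 1) (b * (MonoidAlgebra.of k G (E.loop x) - 1))
      (z * UniversalEnvelopingAlgebra.ι k (E.gen x)) where
  mem := by
    rw [Submodule.pow_succ]
    exact Ideal.mul_mem_mul h.mem (of_sub_one_mem (E.map_loop x))
  homog := by
    rw [map_mul, E.graded.apply_gen, h.homog, mul_assoc, ← mul_assoc (Polynomial.X ^ m),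
      Polynomial.X_pow_mul, mul_assoc, ← pow_succ, ← mul_assoc, map_mul]
  gr := by
    rw [map_mul, UniversalEnvelopingAlgebra.lift_ι_apply, E.θ_gen, ← h.gr, ← grElt_mul]
  eval_sub r := by
    have e0 : E.eval (b * (MonoidAlgebra.of k G (E.loop x) - 1)) r =
        E.eval b r * UHat.map (E.act r) (E.u (E.loop x) - 1) := by
      rw [mul_sub, mul_one, map_sub, Pi.sub_apply, eval_mul_of, E.map_loop, inv_one, mul_one,
        map_sub, map_one, mul_sub, mul_one]
    rw [e0]
    by_cases hr : r = 1
    · have hz : E.μ ^ m • Compl.of (augIdeal k L) z ∈ Compl.fil (augIdeal k L) m := by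
        have h1 := sub_mem (E.eval_mem h.mem r) (Compl.fil_antitone (Nat.le_succ m) (h.eval_sub r))
        rwa [sub_sub_cancel, hr, Pi.single_eq_same] at h1
      have h2 := h.eval_sub r
      rw [hr, Pi.single_eq_same] at h2
      have e2 : ∀ a a' b b' : UHat k L, a * b - a' * b' = (a - a') * b + a' * (b - b') := by
        intros; noncomm_ring
      rw [hr, E.act_one, UHat.map_id, RingHom.id_apply, Pi.single_eq_same, map_mul, pow_succ,
        ← smul_mul_smul_comm, e2]
      have h3 : _ ∈ Compl.fil (augIdeal k L) (m + 2) := Compl.mul_mem_fil hz (E.u_loop x)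
      exact add_mem (Compl.mul_mem_fil h2 (E.u_sub_one_mem _)) h3
    · have h2 := h.eval_sub r
      rw [Pi.single_eq_of_ne hr, sub_zero] at h2 ⊢
      exact Compl.mul_mem_fil h2 (Compl.map_mem_fil _ _ (E.u_sub_one_mem _))

theorem IsLead.eval_mul_of [Fintype S] {b : MonoidAlgebra k G}
    {z : UniversalEnvelopingAlgebra k L} (h : E.IsLead m b z) (γ : G) (r : S) :
    E.eval (b * MonoidAlgebra.of k G γ) r -
        (Pi.single (π γ) (E.μ ^ m • Compl.of (augIdeal k L) z) : S → UHat k L) r ∈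
      Compl.fil (augIdeal k L) (m + 1) := by
  have h1 := h.eval_sub (r * (π γ)⁻¹)
  have h2 : E.eval b (r * (π γ)⁻¹) * UHat.map (E.act (r * (π γ)⁻¹)) (E.u γ - 1) ∈
      Compl.fil (augIdeal k L) (m + 1) := Compl.mul_mem_fil (E.eval_mem h.mem (r * (π γ)⁻¹))
    (Compl.map_mem_fil (mapURing (E.act (r * (π γ)⁻¹))) (augIdeal_le_comap _) (E.u_sub_one_mem γ))
  rw [map_sub, map_one, mul_sub, mul_one] at h2
  have e : (Pi.single (π γ) (E.μ ^ m • Compl.of (augIdeal k L) z) : S → UHat k L) r =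
      (Pi.single 1 (E.μ ^ m • Compl.of (augIdeal k L) z) : S → UHat k L) (r * (π γ)⁻¹) := by
    by_cases hr : r = π γ
    · rw [hr, mul_inv_cancel, Pi.single_eq_same, Pi.single_eq_same]
    · rw [Pi.single_eq_of_ne hr, Pi.single_eq_of_ne (by rwa [Ne, mul_inv_eq_one])]
  rw [e, E.eval_mul_of]
  have := add_mem h2 h1
  rwa [sub_add_sub_cancel] at this

theorem exists_isLead_wordProd [Fintype S] (w : List X) :
    ∃ b, E.IsLead w.length b (wordProd k E.gen w) := by
  induction w using List.reverseRecOn with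
  | nil => exact ⟨1, E.isLead_one⟩
  | append_singleton w x ih =>
    obtain ⟨b, hb⟩ := ih
    refine ⟨b * (MonoidAlgebra.of k G (E.loop x) - 1), ?_⟩
    have e1 : wordProd k E.gen [x] = UniversalEnvelopingAlgebra.ι k (E.gen x) := by
      simp [wordProd]
    rw [wordProd_append, List.length_append, e1]
    exact hb.mul_loop x

theorem exists_isLead_coeff [Fintype S] (y : UniversalEnvelopingAlgebra k L) (m : ℕ) :
    ∃ b, E.IsLead m b ((E.δ y).coeff m) := by
  induction y using E.graded.word_induction with
  | hw w =>
    rw [E.graded.coeff_wordProd]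
    split_ifs with h
    · rw [h]; exact E.exists_isLead_wordProd w
    · exact ⟨0, IsLead.zero⟩
  | hadd a b ha hb =>
    obtain ⟨a', ha⟩ := ha
    obtain ⟨b', hb⟩ := hb
    exact ⟨a' + b', by rw [map_add, Polynomial.coeff_add]; exact ha.add hb⟩
  | h0 => exact ⟨0, by rw [map_zero, Polynomial.coeff_zero]; exact IsLead.zero⟩
  | hsmul c a ha =>
    obtain ⟨a', ha⟩ := ha
    exact ⟨c • a', by rw [map_smul, Polynomial.coeff_smul]; exact ha.smul c⟩

variable (E) in
/-- `a` is, modulo `J ^ (m + 1)`, a combination of representatives of the elements of `S`, whose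
coefficients have leading terms of degree `m`. -/
def HasLead [Fintype S] (m : ℕ) (a : MonoidAlgebra k G) : Prop :=
  ∃ (b : S → MonoidAlgebra k G) (z : S → UniversalEnvelopingAlgebra k L),
    (∀ s, E.IsLead m (b s) (z s)) ∧
      a - ∑ s, b s * MonoidAlgebra.of k G (Function.surjInv E.surjective s) ∈ relIdeal k π ^ (m + 1)

variable [Fintype S]

theorem HasLead.add {a a' : MonoidAlgebra k G} (h : E.HasLead m a) (h' : E.HasLead m a') :
    E.HasLead m (a + a') := by
  obtain ⟨b, z, hb, ha⟩ := h
  obtain ⟨b', z', hb', ha'⟩ := h'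
  refine ⟨b + b', z + z', fun s => (hb s).add (hb' s), ?_⟩
  simp only [Pi.add_apply, add_mul, sum_add_distrib, add_sub_add_comm]
  exact add_mem ha ha'

theorem HasLead.smul {a : MonoidAlgebra k G} (h : E.HasLead m a) (c : k) :
    E.HasLead m (c • a) := by
  obtain ⟨b, z, hb, ha⟩ := h
  refine ⟨c • b, c • z, fun s => (hb s).smul c, ?_⟩
  simp only [Pi.smul_apply, smul_mul_assoc, ← smul_sum, ← smul_sub]
  rw [Algebra.smul_def]
  exact Ideal.mul_mem_left _ _ ha

variable (E) in
theorem hasLead_of_mem {a : MonoidAlgebra k G} (h : a ∈ relIdeal k π ^ (m + 1)) :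
    E.HasLead m a :=
  ⟨0, 0, fun _ => IsLead.zero, by simpa using h⟩

theorem HasLead.sum {ι : Type*} (s : Finset ι) {a : ι → MonoidAlgebra k G}
    (h : ∀ i ∈ s, E.HasLead m (a i)) : E.HasLead m (∑ i ∈ s, a i) :=
  Finset.sum_induction _ _ (fun _ _ => HasLead.add) (E.hasLead_of_mem (zero_mem _)) h

theorem IsLead.hasLead_mul_of {b : MonoidAlgebra k G} {z : UniversalEnvelopingAlgebra k L}
    (h : E.IsLead m b z) (γ : G) : E.HasLead m (b * MonoidAlgebra.of k G γ) := by
  refine ⟨Pi.single (π γ) b, Pi.single (π γ) z, fun s => ?_, ?_⟩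
  · by_cases hs : s = π γ
    · rw [hs, Pi.single_eq_same, Pi.single_eq_same]; exact h
    · rw [Pi.single_eq_of_ne hs, Pi.single_eq_of_ne hs]; exact IsLead.zero
  · rw [sum_eq_single (π γ) (fun s _ hs => by rw [Pi.single_eq_of_ne hs, zero_mul]) (by simp),
      Pi.single_eq_same, ← mul_sub, Submodule.pow_succ]
    exact Ideal.mul_mem_mul h.mem (of_sub_of_mem (Function.surjInv_eq E.surjective _).symm)

theorem IsLead.hasLead_mul_sub_one_mul {b : MonoidAlgebra k G}
    {z : UniversalEnvelopingAlgebra k L} (h : E.IsLead m b z) {g : G} (hg : π g = 1) (γ : G) :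
    E.HasLead (m + 1) (b * ((MonoidAlgebra.of k G g - 1) * MonoidAlgebra.of k G γ)) := by
  obtain ⟨v, hv, hgv⟩ := E.mem_span g hg
  have e : b * ((MonoidAlgebra.of k G g - 1) * MonoidAlgebra.of k G γ) =
      b * v * MonoidAlgebra.of k G γ +
        b * (MonoidAlgebra.of k G g - 1 - v) * MonoidAlgebra.of k G γ := by noncomm_ring
  rw [e]
  refine HasLead.add ?_ (E.hasLead_of_mem (Ideal.mul_mem_right _ _ ?_))
  · clear e hgv
    induction hv using Submodule.span_induction with
    | mem x hx =>
      obtain ⟨x, rfl⟩ := hx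
      exact (h.mul_loop x).hasLead_mul_of γ
    | zero => rw [mul_zero, zero_mul]; exact E.hasLead_of_mem (zero_mem _)
    | add x y _ _ hx hy => rw [mul_add, add_mul]; exact hx.add hy
    | smul c x _ hx => rw [mul_smul_comm, smul_mul_assoc]; exact hx.smul c
  · rw [add_assoc, Ideal.IsTwoSided.pow_add]
    exact Ideal.mul_mem_mul h.mem hgv

theorem IsLead.hasLead_mul_of_mul {b : MonoidAlgebra k G} {z : UniversalEnvelopingAlgebra k L}
    (h : E.IsLead m b z) (τ : G) {j : MonoidAlgebra k G} (hj : j ∈ relIdeal k π) :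
    E.HasLead (m + 1) (b * MonoidAlgebra.of k G τ * j) := by
  replace hj := mem_span_of_mem_relIdeal hj
  induction hj using Submodule.span_induction with
  | mem x hx =>
    obtain ⟨g, γ, hg, rfl⟩ := hx
    have e : b * MonoidAlgebra.of k G τ * ((MonoidAlgebra.of k G g - 1) * MonoidAlgebra.of k G γ) =
        b * ((MonoidAlgebra.of k G (τ * g * τ⁻¹) - 1) * MonoidAlgebra.of k G (τ * γ)) := by
      rw [sub_mul, sub_mul, ← map_mul, ← map_mul, one_mul, one_mul, mul_assoc, mul_sub, ← map_mul,
        ← map_mul, show τ * g * τ⁻¹ * (τ * γ) = τ * (g * γ) by group]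
    rw [e]
    exact h.hasLead_mul_sub_one_mul (by rw [map_mul, map_mul, hg, mul_one, map_inv,
      mul_inv_cancel]) _
  | zero => rw [mul_zero]; exact E.hasLead_of_mem (zero_mem _)
  | add x y _ _ hx hy => rw [mul_add]; exact hx.add hy
  | smul c x _ hx => rw [mul_smul_comm]; exact hx.smul c

variable (E) in
/-- Every element of `J ^ m` has leading terms of degree `m`. The induction on `m` uses that `J` is
spanned by the products `(g - 1) γ` with `π g = 1`, and that `g - 1` is, modulo `J ^ 2`, a
combination of the elements `loop x - 1`. -/
theorem hasLead {a : MonoidAlgebra k G} (ha : a ∈ relIdeal k π ^ m) : E.HasLead m a := by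
  induction m generalizing a with
  | zero =>
    induction a using MonoidAlgebra.induction_on with
    | of γ =>
      rw [← one_mul (MonoidAlgebra.of k G γ)]
      exact E.isLead_one.hasLead_mul_of γ
    | add x y hx hy =>
      have h0 : ∀ a, a ∈ relIdeal k π ^ 0 := fun a => by
        rw [Submodule.pow_zero, Ideal.one_eq_top]; trivial
      exact (hx (h0 _)).add (hy (h0 _))
    | smul c x hx =>
      exact (hx (by rw [Submodule.pow_zero, Ideal.one_eq_top]; trivial)).smul c
  | succ m ih =>
    rw [Submodule.pow_succ] at ha
    induction ha using Submodule.mul_induction_on' with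
    | mem_mul_mem a ha j hj =>
      obtain ⟨b, z, hb, hab⟩ := ih ha
      have e : a * j = (a - ∑ s, b s * MonoidAlgebra.of k G (Function.surjInv E.surjective s)) * j +
          ∑ s, b s * MonoidAlgebra.of k G (Function.surjInv E.surjective s) * j := by
        rw [sub_mul, sum_mul]; abel
      rw [e]
      refine (E.hasLead_of_mem ?_).add
        (HasLead.sum _ fun s _ => (hb s).hasLead_mul_of_mul _ hj)
      rw [Submodule.pow_succ]
      exact Ideal.mul_mem_mul hab hj
    | add a _ b _ ha hb => exact ha.add hb

variable (E)

/-- The expansion induces an injection of `k[G] / J ^ m`. If `a ∈ J ^ m` and `eval a` vanishes to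
order `m + 1`, then the leading terms of `a` vanish in `U(L)`; applying `θ`, so do their classes in
the associated graded algebra of `J`, and `a ∈ J ^ (m + 1)`. -/
theorem mem_pow_of_eval_mem {a : MonoidAlgebra k G}
    (ha : ∀ s, E.eval a s ∈ Compl.fil (augIdeal k L) m) : a ∈ relIdeal k π ^ m := by
  induction m with
  | zero => rw [Submodule.pow_zero, Ideal.one_eq_top]; trivial
  | succ m ih =>
    obtain ⟨b, z, hb, hab⟩ := E.hasLead (ih fun s => Compl.fil_antitone (Nat.le_succ m) (ha s))
    set τ := Function.surjInv E.surjective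
    have hτ : ∀ s, π (τ s) = s := Function.surjInv_eq E.surjective
    have hz : ∀ r, z r = 0 := fun r => by
      have h1 : ∑ s, E.eval (b s * MonoidAlgebra.of k G (τ s)) r ∈
          Compl.fil (augIdeal k L) (m + 1) := by
        have := sub_mem (ha r) (E.eval_mem hab r)
        rwa [← Pi.sub_apply, ← map_sub, sub_sub_cancel, map_sum, Finset.sum_apply] at this
      have h2 := sub_mem h1 (sum_mem (t := univ) fun s _ => (hb s).eval_mul_of (τ s) r)
      rw [← sum_sub_distrib] at h2
      simp only [sub_sub_cancel, hτ] at h2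
      rw [sum_eq_single r (fun s _ hs => Pi.single_eq_of_ne hs.symm _) (by simp),
        Pi.single_eq_same] at h2
      have h3 := Compl.smul_mem_fil ((E.isUnit_μ.pow m).unit⁻¹ : kˣ).val h2
      rw [smul_smul, IsUnit.val_inv_mul, one_smul, Compl.of_mem_fil] at h3
      have h4 := E.graded.coeff_eq_zero_of_mem_pow h3 (Nat.lt_succ_self m)
      rwa [(hb r).homog, Polynomial.coeff_C_mul_X_pow, if_pos rfl] at h4
    have hb' : ∀ s, b s ∈ relIdeal k π ^ (m + 1) := fun s => by
      rw [← grElt_eq_zero_iff (k := k) (hb s).mem, (hb s).gr, hz, map_zero]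
    have := add_mem hab (sum_mem (t := univ) fun s _ =>
      Ideal.mul_mem_right (MonoidAlgebra.of k G (τ s)) _ (hb' s))
    rwa [sub_add_cancel] at this

theorem eval_mem_iff {a : MonoidAlgebra k G} :
    (∀ s, E.eval a s ∈ Compl.fil (augIdeal k L) m) ↔ a ∈ relIdeal k π ^ m :=
  ⟨E.mem_pow_of_eval_mem, fun h => E.eval_mem h⟩

/-- The expansion has dense image: as `μ` is invertible, a homogeneous element of degree `m` is, up
to higher terms, the image of a combination of products of `m` elements `loop x - 1`, and one
proceeds by successive approximation. -/
theorem exists_eval_sub_mem (h : S → UHat k L) (m : ℕ) :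
    ∃ a, ∀ s, E.eval a s - h s ∈ Compl.fil (augIdeal k L) m := by
  induction m with
  | zero => exact ⟨0, fun s => Compl.mem_fil_zero _⟩
  | succ m ih =>
    obtain ⟨a, ha⟩ := ih
    choose y hy using fun s => Compl.exists_sub_of_mem_fil (h s - E.eval a s) (m + 1)
    have hy' : ∀ s, y s ∈ augIdeal k L ^ m := fun s => by
      rw [← Compl.of_mem_fil]
      have := sub_mem (neg_mem (ha s)) (Compl.fil_antitone (Nat.le_succ m) (hy s))
      rwa [neg_sub, sub_sub_cancel] at this
    choose b hb using fun s => E.exists_isLead_coeff (y s) m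
    set τ := Function.surjInv E.surjective
    have hτ : ∀ s, π (τ s) = s := Function.surjInv_eq E.surjective
    set c : k := ((E.isUnit_μ.pow m).unit⁻¹ : kˣ).val with hc
    refine ⟨a + ∑ s, c • (b s * MonoidAlgebra.of k G (τ s)), fun r => ?_⟩
    have h1 := sum_mem (t := univ) fun s _ =>
      Compl.smul_mem_fil c ((hb s).eval_mul_of (τ s) r)
    simp only [smul_sub, hτ] at h1
    rw [sum_sub_distrib, sum_eq_single r (f := fun s => c • (Pi.single s _ : S → UHat k L) r)
      (fun s _ hs => by rw [Pi.single_eq_of_ne hs.symm, smul_zero]) (by simp),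
      Pi.single_eq_same, smul_smul, hc, IsUnit.val_inv_mul, one_smul, ← hc] at h1
    have h2 := Compl.of_mem_fil.2 (E.graded.sub_coeff_mem (hy' r))
    rw [map_sub] at h2
    have e : E.eval (a + ∑ s, c • (b s * MonoidAlgebra.of k G (τ s))) r =
        E.eval a r + ∑ s, c • E.eval (b s * MonoidAlgebra.of k G (τ s)) r := by
      rw [map_add, map_sum, Pi.add_apply, Finset.sum_apply]
      simp only [LinearMap.map_smul, Pi.smul_apply]
    have := sub_mem (sub_mem h1 h2) (hy r)
    rw [e]
    convert this using 1
    abel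

end Expansion

/-! ### The square of an expansion -/

section Square

variable {k : Type u} [CommRing k]

theorem commute_polynomial_map {A A' B : Type*} [Ring A] [Ring A'] [Ring B] {f : A →+* B}
    {g : A' →+* B} (h : ∀ a b, Commute (f a) (g b)) (p : Polynomial A) (q : Polynomial A') :
    Commute (p.map f) (q.map g) := by
  induction p using Polynomial.induction_on' with
  | add p p' hp hp' => rw [Polynomial.map_add]; exact hp.add_left hp'
  | monomial i a =>
    induction q using Polynomial.induction_on' with
    | add q q' hq hq' => rw [Polynomial.map_add]; exact hq.add_right hq'
    | monomial j b =>
      rw [Polynomial.map_monomial, Polynomial.map_monomial, Commute, SemiconjBy,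
        Polynomial.monomial_mul_monomial, Polynomial.monomial_mul_monomial, (h a b).eq, add_comm]

theorem AssocGraded.commute_map {A A' B : Type*} [Ring A] [Ring A'] [Ring B] [Algebra k A]
    [Algebra k A'] [Algebra k B] {J : Ideal A} {J' : Ideal A'} {K : Ideal B} [J.IsTwoSided]
    [J'.IsTwoSided] [K.IsTwoSided] {f : A →ₐ[k] B} {g : A' →ₐ[k] B}
    (hf : J ≤ K.comap (f : A →+* B)) (hg : J' ≤ K.comap (g : A' →+* B))
    (h : ∀ a b, Commute (f a) (g b)) (p : AssocGraded k J) (q : AssocGraded k J') :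
    Commute (AssocGraded.map f hf p) (AssocGraded.map g hg q) := by
  obtain ⟨p, rfl⟩ := Ideal.Quotient.mk_surjective p
  obtain ⟨q, rfl⟩ := Ideal.Quotient.mk_surjective q
  change Ideal.Quotient.mk _ _ * Ideal.Quotient.mk _ _ =
    Ideal.Quotient.mk _ _ * Ideal.Quotient.mk _ _
  rw [← map_mul, ← map_mul]
  exact congrArg _ (Subtype.ext (commute_polynomial_map h p q).eq)

/-- The morphism `L × L' → B` given by two morphisms with commuting images. -/
def lieCoprod {L L' B : Type*} [LieRing L] [LieAlgebra k L] [LieRing L'] [LieAlgebra k L']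
    [Ring B] [Algebra k B] (f : L →ₗ⁅k⁆ B) (g : L' →ₗ⁅k⁆ B) (h : ∀ x y, Commute (f x) (g y)) :
    L × L' →ₗ⁅k⁆ B where
  __ := LinearMap.coprod (f : L →ₗ[k] B) (g : L' →ₗ[k] B)
  map_lie' {x y} := by
    change f ⁅x.1, y.1⁆ + g ⁅x.2, y.2⁆ = ⁅f x.1 + g x.2, f y.1 + g y.2⁆
    rw [LieHom.map_lie, LieHom.map_lie, lie_add, add_lie, add_lie, (h x.1 y.2).lie_eq,
      (h y.1 x.2).symm.lie_eq]
    abel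

theorem lieCoprod_inl {L L' B : Type*} [LieRing L] [LieAlgebra k L] [LieRing L']
    [LieAlgebra k L'] [Ring B] [Algebra k B] (f : L →ₗ⁅k⁆ B) (g : L' →ₗ⁅k⁆ B)
    (h : ∀ x y, Commute (f x) (g y)) (x : L) : lieCoprod f g h (LieHom.inl k L L' x) = f x := by
  change f x + g 0 = f x
  rw [map_zero, add_zero]

theorem lieCoprod_inr {L L' B : Type*} [LieRing L] [LieAlgebra k L] [LieRing L']
    [LieAlgebra k L'] [Ring B] [Algebra k B] (f : L →ₗ⁅k⁆ B) (g : L' →ₗ⁅k⁆ B)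
    (h : ∀ x y, Commute (f x) (g y)) (y : L') : lieCoprod f g h (LieHom.inr k L L' y) = g y := by
  change f 0 + g y = g y
  rw [map_zero, zero_add]

variable {L : Type*} [LieRing L] [LieAlgebra k L]

theorem lie_inl_inr (a b : L) : ⁅LieHom.inl k L L a, LieHom.inr k L L b⁆ = 0 := by
  rw [LieHom.inl_apply, LieHom.inr_apply, LieAlgebra.Prod.bracket_apply]; simp

/-- The morphism `y ↦ f (δ y)` from `L` to `U(L')[X]`. -/
def gradeLie {L' : Type*} [LieRing L'] [LieAlgebra k L'] (δ : UniversalEnvelopingAlgebra k L →ₐ[k]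
    Polynomial (UniversalEnvelopingAlgebra k L)) (f : L →ₗ⁅k⁆ L') :
    L →ₗ⁅k⁆ Polynomial (UniversalEnvelopingAlgebra k L') where
  toFun y := Polynomial.mapAlgHom (mapU f) (δ (UniversalEnvelopingAlgebra.ι k y))
  map_add' x y := by rw [map_add, map_add, map_add]
  map_smul' c x := by rw [map_smul, map_smul, map_smul, RingHom.id_apply]
  map_lie' {x y} := by
    rw [LieHom.map_lie, Ring.lie_def, map_sub, map_mul, map_mul, map_sub, map_mul, map_mul,
      Ring.lie_def]

theorem commute_gradeLie (δ : UniversalEnvelopingAlgebra k L →ₐ[k]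
    Polynomial (UniversalEnvelopingAlgebra k L)) (x y : L) :
    Commute (gradeLie δ (LieHom.inl k L L) x) (gradeLie δ (LieHom.inr k L L) y) :=
  commute_polynomial_map (f := (mapU (LieHom.inl k L L)).toRingHom)
    (g := (mapU (LieHom.inr k L L)).toRingHom) (commute_mapU lie_inl_inr) _ _

/-- The grading morphism of `U(L × L)`. -/
def squareδ (δ : UniversalEnvelopingAlgebra k L →ₐ[k]
    Polynomial (UniversalEnvelopingAlgebra k L)) :
    UniversalEnvelopingAlgebra k (L × L) →ₐ[k]
      Polynomial (UniversalEnvelopingAlgebra k (L × L)) :=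
  UniversalEnvelopingAlgebra.lift k
    (lieCoprod (gradeLie δ (LieHom.inl k L L)) (gradeLie δ (LieHom.inr k L L)) (commute_gradeLie δ))

theorem IsGradedBy.square {X : Type*} {t : X → L}
    {δ : UniversalEnvelopingAlgebra k L →ₐ[k] Polynomial (UniversalEnvelopingAlgebra k L)}
    (h : IsGradedBy t δ) : IsGradedBy
      (Sum.elim (fun x => LieHom.inl k L L (t x)) fun x => LieHom.inr k L L (t x))
      (squareδ δ) where
  adjoin_eq_top := by
    set B := Algebra.adjoin k (Set.range fun x : X ⊕ X => UniversalEnvelopingAlgebra.ι k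
      (Sum.elim (fun x => LieHom.inl k L L (t x)) (fun x => LieHom.inr k L L (t x)) x)) with hB
    have key : ∀ f : L →ₗ⁅k⁆ L × L, (∀ x, UniversalEnvelopingAlgebra.ι k (f (t x)) ∈ B) →
        ∀ a, mapU f a ∈ B := by
      intro f hf a
      have ha : a ∈ Algebra.adjoin k (Set.range fun x => UniversalEnvelopingAlgebra.ι k (t x)) := by
        rw [h.adjoin_eq_top]; trivial
      induction ha using Algebra.adjoin_induction with
      | mem a ha => obtain ⟨x, rfl⟩ := ha; rw [mapU_ι]; exact hf x
      | algebraMap c => rw [AlgHom.commutes]; exact B.algebraMap_mem c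
      | add a b _ _ ha hb => rw [map_add]; exact add_mem ha hb
      | mul a b _ _ ha hb => rw [map_mul]; exact mul_mem ha hb
    rw [eq_top_iff, ← adjoin_range_ι (L × L), Algebra.adjoin_le_iff]
    rintro _ ⟨⟨x, y⟩, rfl⟩
    have e : ((x, y) : L × L) = LieHom.inl k L L x + LieHom.inr k L L y := by
      rw [LieHom.inl_apply, LieHom.inr_apply]; simp
    rw [e, map_add, ← mapU_ι, ← mapU_ι]
    exact add_mem (key _ (fun x => Algebra.subset_adjoin ⟨Sum.inl x, rfl⟩) _)
      (key _ (fun x => Algebra.subset_adjoin ⟨Sum.inr x, rfl⟩) _)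
  apply_gen := by
    have hmap : ∀ (f : L →ₗ⁅k⁆ L × L) (x : X), gradeLie δ f (t x) =
        Polynomial.C (UniversalEnvelopingAlgebra.ι k (f (t x))) * Polynomial.X := by
      intro f x
      change Polynomial.map (mapU f).toRingHom (δ (UniversalEnvelopingAlgebra.ι k (t x))) = _
      rw [h.apply_gen, Polynomial.map_mul, Polynomial.map_C, Polynomial.map_X, ← mapU_ι]; rfl
    rintro (x | x)
    · rw [squareδ, UniversalEnvelopingAlgebra.lift_ι_apply, Sum.elim_inl, lieCoprod_inl]
      exact hmap _ x
    · rw [squareδ, UniversalEnvelopingAlgebra.lift_ι_apply, Sum.elim_inr, lieCoprod_inr]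
      exact hmap _ x

end Square

namespace Expansion

variable {k : Type u} [CommRing k] {L : Type*} [LieRing L] [LieAlgebra k L]
  {G S : Type} [Group G] [Group S] {π : G →* S} {X : Type}

theorem map_prodMap_inl (f g : L →ₗ⁅k⁆ L) (x : UHat k L) :
    UHat.map (LieHom.prodMap f g) (UHat.map (LieHom.inl k L L) x) =
      UHat.map (LieHom.inl k L L) (UHat.map f x) := by
  rw [← RingHom.comp_apply, ← RingHom.comp_apply, ← UHat.map_comp, ← UHat.map_comp]
  congr 2
  ext y <;> simp

theorem map_prodMap_inr (f g : L →ₗ⁅k⁆ L) (x : UHat k L) :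
    UHat.map (LieHom.prodMap f g) (UHat.map (LieHom.inr k L L) x) =
      UHat.map (LieHom.inr k L L) (UHat.map g x) := by
  rw [← RingHom.comp_apply, ← RingHom.comp_apply, ← UHat.map_comp, ← UHat.map_comp]
  congr 2
  ext y <;> simp

theorem relIdeal_le_inl : relIdeal k π ≤ (relIdeal k (π.prodMap π)).comap
    (MonoidAlgebra.mapDomainAlgHom k k (MonoidHom.inl G G) : _ →+* MonoidAlgebra k (G × G)) :=
  ker_groupAlg_le _ (MonoidHom.inl S S) (by ext <;> simp)

theorem relIdeal_le_inr : relIdeal k π ≤ (relIdeal k (π.prodMap π)).comap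
    (MonoidAlgebra.mapDomainAlgHom k k (MonoidHom.inr G G) : _ →+* MonoidAlgebra k (G × G)) :=
  ker_groupAlg_le _ (MonoidHom.inr S S) (by ext <;> simp)

theorem mapDomainAlgHom_of {H : Type} [Group H] (f : G →* H) (g : G) :
    MonoidAlgebra.mapDomainAlgHom k k f (MonoidAlgebra.of k G g) = MonoidAlgebra.of k H (f g) :=
  MonoidAlgebra.mapDomain_single

theorem commute_mapDomain_inl_inr (a b : MonoidAlgebra k G) :
    Commute (MonoidAlgebra.mapDomainAlgHom k k (MonoidHom.inl G G) a)
      (MonoidAlgebra.mapDomainAlgHom k k (MonoidHom.inr G G) b) :=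
  commute_inl_inr k a b

variable (E : Expansion k L π X)

/-- The images of the elements `loop x` in the two factors of `G × G`. -/
def squareLoop : X ⊕ X → G × G :=
  Sum.elim (fun x => MonoidHom.inl G G (E.loop x)) fun x => MonoidHom.inr G G (E.loop x)

theorem mem_span_square (f : G →* G × G) (hf : relIdeal k π ≤ (relIdeal k (π.prodMap π)).comap
      (MonoidAlgebra.mapDomainAlgHom k k f : _ →+* MonoidAlgebra k (G × G)))
    (hl : ∀ x, ∃ y, f (E.loop x) = E.squareLoop y) (g : G) (hg : π g = 1) :
    ∃ v ∈ Submodule.span k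
        (Set.range fun x => MonoidAlgebra.of k (G × G) (E.squareLoop x) - 1),
      MonoidAlgebra.of k (G × G) (f g) - 1 - v ∈ relIdeal k (π.prodMap π) ^ 2 := by
  obtain ⟨v, hv, h⟩ := E.mem_span g hg
  refine ⟨MonoidAlgebra.mapDomainAlgHom k k f v, ?_, ?_⟩
  · clear h
    induction hv using Submodule.span_induction with
    | mem a ha =>
      obtain ⟨x, rfl⟩ := ha
      obtain ⟨y, hy⟩ := hl x
      refine Submodule.subset_span ⟨y, ?_⟩
      change _ = MonoidAlgebra.mapDomainAlgHom k k f (MonoidAlgebra.of k G (E.loop x) - 1)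
      rw [map_sub, map_one, mapDomainAlgHom_of, hy]
    | zero => rw [map_zero]; exact zero_mem _
    | add a b _ _ ha hb => rw [map_add]; exact add_mem ha hb
    | smul c a _ ha => rw [map_smul]; exact Submodule.smul_mem _ _ ha
  · have := pow_le_comap _ hf 2 h
    rw [Ideal.mem_comap] at this
    change MonoidAlgebra.mapDomainAlgHom k k f _ ∈ _ at this
    rwa [map_sub, map_sub, map_one, mapDomainAlgHom_of] at this

theorem map_squareLoop (x : X ⊕ X) : π.prodMap π (E.squareLoop x) = 1 := by
  rcases x with x | x
  · exact Prod.ext (E.map_loop x) (map_one π)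
  · exact Prod.ext (map_one π) (E.map_loop x)

/-- The morphism from `L × L` to the associated graded algebra of `k[G × G]`. -/
def squareθ : L × L →ₗ⁅k⁆ AssocGraded k (relIdeal k (π.prodMap π)) :=
  lieCoprod
    (((AssocGraded.map _ (relIdeal_le_inl (k := k) (π := π))).toLieHom).comp E.θ)
    (((AssocGraded.map _ (relIdeal_le_inr (k := k) (π := π))).toLieHom).comp E.θ)
    fun _ _ => AssocGraded.commute_map relIdeal_le_inl relIdeal_le_inr commute_mapDomain_inl_inr _ _

theorem map_θ_gen (f : G →* G × G) (hf : relIdeal k π ≤ (relIdeal k (π.prodMap π)).comap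
      (MonoidAlgebra.mapDomainAlgHom k k f : _ →+* MonoidAlgebra k (G × G))) (x : X) {g : G × G}
    (hg : f (E.loop x) = g)
    (h : MonoidAlgebra.of k (G × G) g - 1 ∈ relIdeal k (π.prodMap π) ^ 1) :
    AssocGraded.map _ hf (E.θ (E.gen x)) = grElt k 1 (MonoidAlgebra.of k (G × G) g - 1) h := by
  subst hg
  rw [E.θ_gen, AssocGraded.map_grElt]
  congr 1
  rw [map_sub, map_one, mapDomainAlgHom_of]

theorem squareθ_gen (x : X ⊕ X) : E.squareθ
      (Sum.elim (fun x => LieHom.inl k L L (E.gen x)) (fun x => LieHom.inr k L L (E.gen x)) x) =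
    grElt k 1 (MonoidAlgebra.of k (G × G) (E.squareLoop x) - 1)
      (by rw [Submodule.pow_one]; exact of_sub_one_mem (E.map_squareLoop x)) := by
  rcases x with x | x
  · exact (lieCoprod_inl _ _ _ _).trans (E.map_θ_gen _ relIdeal_le_inl x rfl _)
  · exact (lieCoprod_inr _ _ _ _).trans (E.map_θ_gen _ relIdeal_le_inr x rfl _)

/-- The expansion of `G × G` with values in `U(L × L)`, which makes it possible to compare the
coproducts of `k[G]` and of `U(L)`. -/
def square : Expansion k (L × L) (π.prodMap π) (X ⊕ X) where
  act s := LieHom.prodMap (E.act s.1) (E.act s.2)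
  act_one := by
    rw [Prod.fst_one, Prod.snd_one, E.act_one]
    ext y <;> simp
  u g := UHat.map (LieHom.inl k L L) (E.u g.1) * UHat.map (LieHom.inr k L L) (E.u g.2)
  u_one := by rw [Prod.fst_one, Prod.snd_one, E.u_one, map_one, map_one, mul_one]
  u_mul g h := by
    change UHat.map _ (E.u (g.1 * h.1)) * UHat.map _ (E.u (g.2 * h.2)) =
      _ * UHat.map (LieHom.prodMap (E.act (π g.1)) (E.act (π g.2))) _
    rw [E.u_mul, E.u_mul, map_mul, map_mul, map_mul, map_prodMap_inl, map_prodMap_inr, mul_assoc,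
      mul_assoc]
    congr 1
    rw [← mul_assoc, ← mul_assoc, (commute_UHat_map lie_inl_inr _ _).eq]
  u_sub_one_mem g := by
    have h1 := Compl.map_mem_fil (mapURing (LieHom.inl k L L)) (augIdeal_le_comap _)
      (E.u_sub_one_mem g.1)
    have h2 := Compl.map_mem_fil (mapURing (LieHom.inr k L L)) (augIdeal_le_comap _)
      (E.u_sub_one_mem g.2)
    rw [map_sub, map_one] at h1 h2
    have e : ∀ x y : UHat k (L × L), x * y - 1 = (x - 1) * y + (y - 1) := by
      intros; noncomm_ring
    rw [e]
    exact add_mem (Ideal.mul_mem_right _ _ h1) h2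
  surjective := E.surjective.prodMap E.surjective
  loop := E.squareLoop
  map_loop := E.map_squareLoop
  gen := Sum.elim (fun x => LieHom.inl k L L (E.gen x)) fun x => LieHom.inr k L L (E.gen x)
  μ := E.μ
  isUnit_μ := E.isUnit_μ
  u_loop x := by
    have key : ∀ (f : L →ₗ⁅k⁆ L × L) (x : X), UHat.map f (E.u (E.loop x)) - 1 -
        E.μ • Compl.of (augIdeal k (L × L)) (UniversalEnvelopingAlgebra.ι k (f (E.gen x))) ∈
          Compl.fil (augIdeal k (L × L)) 2 := fun f x => by
      have h1 := Compl.map_mem_fil (mapURing f) (augIdeal_le_comap f) (E.u_loop x)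
      change UHat.map f _ ∈ _ at h1
      rw [map_sub, map_sub, map_one, UHat.map_smul, UHat.map, Compl.map_of] at h1
      rw [← mapU_ι]
      exact h1
    rcases x with x | x
    · have := key (LieHom.inl k L L) x
      change UHat.map _ (E.u (E.loop x)) * UHat.map _ (E.u 1) - 1 - _ ∈ _
      rwa [E.u_one, map_one, mul_one]
    · have := key (LieHom.inr k L L) x
      change UHat.map _ (E.u 1) * UHat.map _ (E.u (E.loop x)) - 1 - _ ∈ _
      rwa [E.u_one, map_one, one_mul]
  δ := squareδ E.δ
  graded := E.graded.square
  mem_span := by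
    rintro ⟨g, h⟩ hgh
    have hg : π g = 1 := congrArg Prod.fst hgh
    have hh : π h = 1 := congrArg Prod.snd hgh
    obtain ⟨v, hv, h1⟩ := E.mem_span_square (MonoidHom.inl G G) relIdeal_le_inl
      (fun x => ⟨Sum.inl x, rfl⟩) g hg
    obtain ⟨w, hw, h2⟩ := E.mem_span_square (MonoidHom.inr G G) relIdeal_le_inr
      (fun x => ⟨Sum.inr x, rfl⟩) h hh
    refine ⟨v + w, add_mem hv hw, ?_⟩
    have e : MonoidAlgebra.of k (G × G) (g, h) =
        MonoidAlgebra.of k (G × G) (MonoidHom.inl G G g) *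
          MonoidAlgebra.of k (G × G) (MonoidHom.inr G G h) := by
      rw [← map_mul]; simp
    have e2 : ∀ a b v w : MonoidAlgebra k (G × G), a * b - 1 - (v + w) =
        (a - 1) * (b - 1) + (a - 1 - v) + (b - 1 - w) := by
      intros; noncomm_ring
    rw [e, e2]
    refine add_mem (add_mem ?_ h1) h2
    rw [show 2 = 1 + 1 from rfl, Submodule.pow_succ, Submodule.pow_one]
    exact Ideal.mul_mem_mul (of_sub_one_mem (Prod.ext hg (map_one π)))
      (of_sub_one_mem (Prod.ext (map_one π) hh))
  θ := E.squareθ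
  θ_gen := E.squareθ_gen

end Expansion

/-! ### The isomorphism of completions given by an expansion -/

namespace Compl

variable {A : Type*} [Ring A] {J : Ideal A} [J.IsTwoSided]

/-- A representative of the projection of an element of the completion to `A / J ^ m`. -/
def rep (x : Compl J) (m : ℕ) : A := (Ideal.Quotient.mk_surjective (proj m x)).choose

theorem mk_rep (x : Compl J) (m : ℕ) : Ideal.Quotient.mk (J ^ m) (x.rep m) = proj m x :=
  (Ideal.Quotient.mk_surjective (proj m x)).choose_spec

theorem sub_mem_of_mk_eq {x : Compl J} {i j : ℕ} (h : i ≤ j) {a b : A}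
    (ha : Ideal.Quotient.mk (J ^ i) a = proj i x) (hb : Ideal.Quotient.mk (J ^ j) b = proj j x) :
    b - a ∈ J ^ i := by
  rw [← Ideal.Quotient.mk_eq_mk_iff_sub_mem, ha]
  exact mk_eq_proj_of_le hb h

theorem pow_mem_fil {x : Compl J} (hx : x ∈ fil J 1) (m : ℕ) : x ^ m ∈ fil J m := by
  induction m with
  | zero => exact mem_fil_zero _
  | succ m ih => rw [pow_succ]; exact mul_mem_fil ih hx

theorem isUnit_of_sub_one_mem {x : Compl J} (hx : x - 1 ∈ fil J 1) : IsUnit x := by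
  have hz : 1 - x ∈ fil J 1 := by rw [← neg_sub]; exact neg_mem hx
  -- the inverse is given by the geometric series
  let y : Compl J := mk (fun m => proj m (∑ j ∈ range m, (1 - x) ^ j)) fun m => by
    rw [factor_proj, sum_range_succ, map_add, mem_fil.1 (pow_mem_fil hz m), add_zero]
  have hy : ∀ m, proj m y = proj m (∑ j ∈ range m, (1 - x) ^ j) := fun m => rfl
  have h1 : x * y = 1 := ext fun m => by
    have := mul_neg_geom_sum (1 - x) m
    rw [sub_sub_cancel] at this
    rw [map_mul, hy, ← map_mul, this, map_sub, mem_fil.1 (pow_mem_fil hz m), sub_zero]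
  have h2 : y * x = 1 := ext fun m => by
    have := geom_sum_mul_neg (1 - x) m
    rw [sub_sub_cancel] at this
    rw [map_mul, hy, ← map_mul, this, map_sub, mem_fil.1 (pow_mem_fil hz m), sub_zero]
  exact ⟨⟨x, y, h1, h2⟩, rfl⟩

end Compl

theorem UHat.map_zero_eq_one {k : Type u} [CommRing k] {L L' : Type*} [LieRing L] [LieAlgebra k L]
    [LieRing L'] [LieAlgebra k L'] {x : UHat k L} (hx : x - 1 ∈ Compl.fil (augIdeal k L) 1) :
    UHat.map (0 : L →ₗ⁅k⁆ L') x = 1 := by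
  have hU : ∀ a : UniversalEnvelopingAlgebra k L, a ∈ augIdeal k L →
      mapU (0 : L →ₗ⁅k⁆ L') a = 0 := by
    intro a ha
    have e : mapU (0 : L →ₗ⁅k⁆ L') a = algebraMap k _ (augU k L a) := by
      clear ha
      induction a using envelopingAlgebra_induction with
      | hι y => rw [mapU_ι, augU_ι, map_zero, LieHom.zero_apply, map_zero]
      | hc c => rw [AlgHom.commutes, AlgHom.commutes]; rfl
      | hadd a b ha hb => rw [map_add, ha, hb, map_add, map_add]
      | hmul a b ha hb => rw [map_mul, ha, hb, map_mul, map_mul]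
    rw [e, show augU k L a = 0 from ha, map_zero]
  rw [← sub_eq_zero, ← map_one (UHat.map (0 : L →ₗ⁅k⁆ L')), ← map_sub]
  refine Compl.ext fun m => ?_
  have ha := Compl.mk_rep (x - 1) (m + 1)
  have ha1 := Compl.mk_eq_proj_of_le ha (show 1 ≤ m + 1 by omega)
  rw [Compl.mem_fil.1 hx, Ideal.Quotient.eq_zero_iff_mem, Submodule.pow_one] at ha1
  rw [UHat.map, Compl.proj_map, ← Compl.mk_eq_proj_of_le ha (Nat.le_succ m), levelMap_mk, map_zero]
  exact (congrArg _ (hU _ ha1)).trans (map_zero _)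

namespace Expansion

section Functoriality

variable {k : Type u} [CommRing k] {L L' : Type*} [LieRing L] [LieAlgebra k L] [LieRing L']
  [LieAlgebra k L'] {G S G' S' : Type} [Group G] [Group S] [Group G'] [Group S'] {π : G →* S}
  {π' : G' →* S'} {X X' : Type} [DecidableEq S] [DecidableEq S'] [Fintype S] [Fintype S']
  (E : Expansion k L π X) (E' : Expansion k L' π' X')

/-- The extension of `eval` to the completion of `k[G]`. -/
def evalHat (x : GroupAlgCompl k π) (s : S) : UHat k L :=
  Compl.mk (fun m => Compl.proj m (E.eval (x.rep m) s)) fun m => by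
    have h := E.eval_mem (Compl.sub_mem_of_mk_eq (Nat.le_succ m) (x.mk_rep m) (x.mk_rep (m + 1))) s
    rw [Compl.factor_proj, ← sub_eq_zero, ← map_sub, ← Pi.sub_apply, ← map_sub]
    exact h

variable {E} in
theorem eval_sub_evalHat {x : GroupAlgCompl k π} {m : ℕ} {a : MonoidAlgebra k G}
    (ha : Ideal.Quotient.mk (relIdeal k π ^ m) a = Compl.proj m x) (s : S) :
    E.eval a s - E.evalHat x s ∈ Compl.fil (augIdeal k L) m := by
  have h := E.eval_mem (Compl.sub_mem_of_mk_eq le_rfl (x.mk_rep m) ha) s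
  rw [map_sub, Pi.sub_apply] at h
  have h2 : E.eval (x.rep m) s - E.evalHat x s ∈ Compl.fil (augIdeal k L) m := by
    rw [Compl.mem_fil, map_sub]
    exact sub_self _
  have := add_mem h h2
  rwa [sub_add_sub_cancel] at this

variable {E} in
theorem evalHat_eq {x : GroupAlgCompl k π} {s : S} {y : UHat k L}
    (h : ∀ m a, Ideal.Quotient.mk (relIdeal k π ^ m) a = Compl.proj m x →
      E.eval a s - y ∈ Compl.fil (augIdeal k L) m) : E.evalHat x s = y :=
  Compl.eq_of_sub_mem_fil fun m => by
    have := sub_mem (h m _ (x.mk_rep m)) (eval_sub_evalHat (E := E) (x.mk_rep m) s)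
    rwa [sub_sub_sub_cancel_left] at this

theorem evalHat_one : E.evalHat 1 = Pi.single 1 1 := by
  funext s
  refine evalHat_eq fun m a ha => ?_
  have h1 : a - 1 ∈ relIdeal k π ^ m := by
    rw [← Ideal.Quotient.mk_eq_mk_iff_sub_mem, ha, map_one, map_one]
  have h2 := E.eval_mem h1 s
  rwa [map_sub, ← map_one (MonoidAlgebra.of k G), eval_of, map_one, E.u_one] at h2

theorem evalHat_mul (x y : GroupAlgCompl k π) (r : S) :
    E.evalHat (x * y) r =
      ∑ s, E.evalHat x s * UHat.map (E.act s) (E.evalHat y (s⁻¹ * r)) := by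
  refine Compl.eq_of_sub_mem_fil fun m => ?_
  have hab : Ideal.Quotient.mk (relIdeal k π ^ m) (x.rep m * y.rep m) = Compl.proj m (x * y) := by
    rw [map_mul, map_mul, x.mk_rep, y.mk_rep]
  have h1 := eval_sub_evalHat (E := E) hab r
  have h2 : ∑ s, (E.eval (x.rep m) s * UHat.map (E.act s) (E.eval (y.rep m) (s⁻¹ * r)) -
      E.evalHat x s * UHat.map (E.act s) (E.evalHat y (s⁻¹ * r))) ∈
        Compl.fil (augIdeal k L) m := by
    refine sum_mem fun s _ => ?_
    have e : ∀ a a' b b' : UHat k L, a * b - a' * b' = (a - a') * b + a' * (b - b') := by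
      intros; noncomm_ring
    rw [e, ← map_sub]
    exact add_mem (Ideal.mul_mem_right _ _ (eval_sub_evalHat (x.mk_rep m) s))
      (Ideal.mul_mem_left _ _ (Compl.map_mem_fil _ _ (eval_sub_evalHat (y.mk_rep m) _)))
  rw [sum_sub_distrib, ← E.eval_mul] at h2
  have := sub_mem h2 h1
  rwa [sub_sub_sub_cancel_left] at this

theorem evalHat_injective : Function.Injective E.evalHat := by
  intro x y hxy
  refine Compl.ext fun m => ?_
  rw [← x.mk_rep, ← y.mk_rep, Ideal.Quotient.mk_eq_mk_iff_sub_mem]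
  refine E.mem_pow_of_eval_mem fun s => ?_
  have h1 := eval_sub_evalHat (E := E) (x.mk_rep m) s
  have h2 := eval_sub_evalHat (E := E) (y.mk_rep m) s
  rw [← hxy] at h2
  have := sub_mem h1 h2
  rwa [sub_sub_sub_cancel_right, ← Pi.sub_apply, ← map_sub] at this

theorem evalHat_surjective : Function.Surjective E.evalHat := by
  intro h
  choose a ha using E.exists_eval_sub_mem h
  have hsub : ∀ i j, i ≤ j → a j - a i ∈ relIdeal k π ^ i := fun i j hij => by
    refine E.mem_pow_of_eval_mem fun s => ?_
    have := sub_mem (Compl.fil_antitone hij (ha j s)) (ha i s)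
    rwa [sub_sub_sub_cancel_right, ← Pi.sub_apply, ← map_sub] at this
  refine ⟨Compl.mk (fun m => Ideal.Quotient.mk _ (a m)) fun m => ?_, ?_⟩
  · rw [Ideal.Quotient.factorPowSucc, Ideal.Quotient.factor_mk,
      Ideal.Quotient.mk_eq_mk_iff_sub_mem]
    exact hsub m _ (Nat.le_succ m)
  · funext s
    refine evalHat_eq fun m b hb => ?_
    rw [Compl.proj_mk, Ideal.Quotient.mk_eq_mk_iff_sub_mem] at hb
    have := add_mem (E.eval_mem hb s) (ha m s)
    rwa [map_sub, Pi.sub_apply, sub_add_sub_cancel] at this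

variable {f : G →* G'} {σ : S →* S'} (h : π'.comp f = σ.comp π) {φ : L →ₗ⁅k⁆ L'}
  (hu : ∀ γ, E'.u (f γ) = UHat.map φ (E.u γ)) (hσ : Function.Injective σ)

include h hu hσ

omit [Fintype S] [Fintype S'] in
theorem eval_groupAlg (a : MonoidAlgebra k G) (s : S) :
    E'.eval (groupAlg k f a) (σ s) = UHat.map φ (E.eval a s) := by
  induction a using MonoidAlgebra.induction_on with
  | of γ =>
    rw [groupAlg_of, eval_of, eval_of, show π' (f γ) = σ (π γ) from DFunLike.congr_fun h γ, hu]
    by_cases hs : s = π γ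
    · rw [hs, Pi.single_eq_same, Pi.single_eq_same]
    · rw [Pi.single_eq_of_ne hs, Pi.single_eq_of_ne (hσ.ne hs), map_zero]
  | add a b ha hb => simp only [map_add, Pi.add_apply, ha, hb]
  | smul c a ha =>
    have e : groupAlg k f (c • a) = c • groupAlg k f a :=
      map_smul (MonoidAlgebra.mapDomainAlgHom k k f) c a
    rw [e, LinearMap.map_smul, LinearMap.map_smul, Pi.smul_apply, Pi.smul_apply, ha,
      UHat.map_smul]

omit hσ hu [DecidableEq S] [Fintype S] [Fintype S'] in
theorem eval_groupAlg_of_notMem (a : MonoidAlgebra k G) {p : S'} (hp : ∀ s, p ≠ σ s) :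
    E'.eval (groupAlg k f a) p = 0 := by
  induction a using MonoidAlgebra.induction_on with
  | of γ =>
    rw [groupAlg_of, eval_of, show π' (f γ) = σ (π γ) from DFunLike.congr_fun h γ,
      Pi.single_eq_of_ne (hp _)]
  | add a b ha hb => simp only [map_add, Pi.add_apply, ha, hb, add_zero]
  | smul c a ha =>
    have e : groupAlg k f (c • a) = c • groupAlg k f a :=
      map_smul (MonoidAlgebra.mapDomainAlgHom k k f) c a
    rw [e, LinearMap.map_smul, Pi.smul_apply, ha, smul_zero]

theorem evalHat_map (x : GroupAlgCompl k π) (s : S) :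
    E'.evalHat (Compl.map (groupAlg k f) (ker_groupAlg_le f σ h) x) (σ s) =
      UHat.map φ (E.evalHat x s) := by
  refine Compl.eq_of_sub_mem_fil fun m => ?_
  have h1 := eval_sub_evalHat (E := E') (x := Compl.map (groupAlg k f) (ker_groupAlg_le f σ h) x)
    (m := m) (a := groupAlg k f (x.rep m)) (by
      rw [Compl.proj_map, ← x.mk_rep, levelMap_mk]) (σ s)
  have h2 := Compl.map_mem_fil (mapURing φ) (augIdeal_le_comap φ)
    (eval_sub_evalHat (E := E) (x.mk_rep m) s)
  change UHat.map φ _ ∈ _ at h2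
  rw [map_sub, ← E.eval_groupAlg E' h hu hσ] at h2
  have := sub_mem h2 h1
  rwa [sub_sub_sub_cancel_left] at this

omit hσ hu [DecidableEq S] [Fintype S] in
theorem evalHat_map_of_notMem (x : GroupAlgCompl k π) {p : S'} (hp : ∀ s, p ≠ σ s) :
    E'.evalHat (Compl.map (groupAlg k f) (ker_groupAlg_le f σ h) x) p = 0 := by
  refine Compl.eq_of_sub_mem_fil fun m => ?_
  have h1 := eval_sub_evalHat (E := E') (x := Compl.map (groupAlg k f) (ker_groupAlg_le f σ h) x)
    (m := m) (a := groupAlg k f (x.rep m)) (by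
      rw [Compl.proj_map, ← x.mk_rep, levelMap_mk]) p
  rw [eval_groupAlg_of_notMem E' h _ hp] at h1
  simpa using neg_mem h1

end Functoriality

end Expansion

namespace Expansion

variable {k : Type u} [CommRing k] {L : Type u} [LieRing L] [LieAlgebra k L] {G S : Type}
  [Group G] [Group S] {π : G →* S} {X : Type} [DecidableEq S] [Fintype S]
  (E : Expansion k L π X)

theorem square_evalHat_inl (x : GroupAlgCompl k π) (s t : S) :
    E.square.evalHat (inlHat k π x) (s, t) =
      if t = 1 then UHat.map (LieHom.inl k L L) (E.evalHat x s) else 0 := by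
  have h : (π.prodMap π).comp (MonoidHom.inl G G) = (MonoidHom.inl S S).comp π := by ext <;> simp
  split_ifs with ht
  · rw [ht]
    refine E.evalHat_map E.square h (φ := LieHom.inl k L L) (fun γ => ?_)
      (fun a b hab => congrArg Prod.fst hab) x s
    change UHat.map _ (E.u γ) * UHat.map _ (E.u 1) = _
    rw [E.u_one, map_one, mul_one]
  · exact evalHat_map_of_notMem E.square h x fun s' hs' => ht (congrArg Prod.snd hs')

theorem square_evalHat_inr (x : GroupAlgCompl k π) (s t : S) :
    E.square.evalHat (inrHat k π x) (s, t) =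
      if s = 1 then UHat.map (LieHom.inr k L L) (E.evalHat x t) else 0 := by
  have h : (π.prodMap π).comp (MonoidHom.inr G G) = (MonoidHom.inr S S).comp π := by ext <;> simp
  split_ifs with hs
  · rw [hs]
    refine E.evalHat_map E.square h (φ := LieHom.inr k L L) (fun γ => ?_)
      (fun a b hab => congrArg Prod.snd hab) x t
    change UHat.map _ (E.u 1) * UHat.map _ (E.u γ) = _
    rw [E.u_one, map_one, one_mul]
  · exact evalHat_map_of_notMem E.square h x fun s' hs' => hs (congrArg Prod.fst hs')

theorem square_evalHat_mul (x y : GroupAlgCompl k π) (s t : S) :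
    E.square.evalHat (inlHat k π x * inrHat k π y) (s, t) =
      UHat.map (LieHom.inl k L L) (E.evalHat x s) *
        UHat.map (LieHom.inr k L L) (E.evalHat y t) := by
  rw [evalHat_mul, sum_eq_single (s, 1)]
  · change _ * UHat.map (LieHom.prodMap (E.act s) (E.act 1)) (E.square.evalHat _ (s⁻¹ * s, 1⁻¹ * t))
      = _
    rw [square_evalHat_inl, if_pos rfl, square_evalHat_inr, if_pos (inv_mul_cancel s), inv_one,
      one_mul, map_prodMap_inr, E.act_one, UHat.map_id]; rfl
  · rintro ⟨s', t'⟩ - hne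
    rw [square_evalHat_inl]
    split_ifs with ht'
    · change _ * UHat.map _ (E.square.evalHat _ (s'⁻¹ * s, t'⁻¹ * t)) = 0
      rw [square_evalHat_inr, if_neg, map_zero, mul_zero]
      intro hs'
      rw [inv_mul_eq_one] at hs'
      exact hne (by rw [hs', ht'])
    · rw [zero_mul]
  · simp

/-- An expansion with values in group-like elements. -/
def IsGroupLike : Prop :=
  ∀ γ, UHat.map (diagLie k L) (E.u γ) =
    UHat.map (LieHom.inl k L L) (E.u γ) * UHat.map (LieHom.inr k L L) (E.u γ)

variable {E} (hE : E.IsGroupLike)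

include hE

theorem square_evalHat_comul (x : GroupAlgCompl k π) (s t : S) :
    E.square.evalHat (comulHat k π x) (s, t) =
      if s = t then UHat.map (diagLie k L) (E.evalHat x s) else 0 := by
  have h : (π.prodMap π).comp ((MonoidHom.id G).prod (MonoidHom.id G)) =
      ((MonoidHom.id S).prod (MonoidHom.id S)).comp π := rfl
  split_ifs with hs
  · rw [← hs]
    exact E.evalHat_map E.square h (φ := diagLie k L) (fun γ => (hE γ).symm)
      (fun a b hab => congrArg Prod.fst hab) x s
  · exact evalHat_map_of_notMem E.square h x fun s' hs' =>
      hs ((congrArg Prod.fst hs').trans (congrArg Prod.snd hs').symm)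

/-- Group-like elements of the completion of `k[G]`, in terms of their values under an expansion. -/
theorem comulHat_eq_iff (x : GroupAlgCompl k π) :
    comulHat k π x = inlHat k π x * inrHat k π x ↔
      ∀ s t, (if s = t then UHat.map (diagLie k L) (E.evalHat x s) else 0) =
        UHat.map (LieHom.inl k L L) (E.evalHat x s) *
          UHat.map (LieHom.inr k L L) (E.evalHat x t) := by
  rw [← E.square.evalHat_injective.eq_iff, funext_iff, Prod.forall]
  refine forall_congr' fun s => forall_congr' fun t => ?_
  rw [square_evalHat_comul hE, square_evalHat_mul]

omit hE

variable (E) in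
theorem aug_eq_iff (x : GroupAlgCompl k π) (s : S) :
    Compl.aug (groupAlg k π) x = MonoidAlgebra.of k S s ↔
      ∀ t, E.evalHat x t - (Pi.single s 1 : S → UHat k L) t ∈ Compl.fil (augIdeal k L) 1 := by
  obtain ⟨γ, rfl⟩ := E.surjective s
  have h1 : Compl.aug (groupAlg k π) x = groupAlg k π (x.rep 1) := by
    rw [Compl.aug, RingHom.comp_apply, ← x.mk_rep]
    exact Ideal.Quotient.lift_mk _ _ _
  have h2 : ∀ t, (Pi.single (π γ) (E.u γ) : S → UHat k L) t - (Pi.single (π γ) 1 : S → UHat k L) t ∈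
      Compl.fil (augIdeal k L) 1 := fun t => by
    by_cases ht : t = π γ
    · rw [ht, Pi.single_eq_same, Pi.single_eq_same]; exact E.u_sub_one_mem γ
    · rw [Pi.single_eq_of_ne ht, Pi.single_eq_of_ne ht, sub_zero]; exact zero_mem _
  have h3 : ∀ t, E.eval (x.rep 1 - MonoidAlgebra.of k G γ) t - (E.evalHat x t -
      (Pi.single (π γ) 1 : S → UHat k L) t) ∈ Compl.fil (augIdeal k L) 1 := fun t => by
    have := sub_mem (eval_sub_evalHat (E := E) (x.mk_rep 1) t) (h2 t)
    rw [map_sub, Pi.sub_apply, eval_of]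
    convert this using 1
    abel
  have h4 := E.eval_mem_iff (m := 1) (a := x.rep 1 - MonoidAlgebra.of k G γ)
  rw [Submodule.pow_one, RingHom.mem_ker, map_sub (groupAlg k π), groupAlg_of, sub_eq_zero] at h4
  rw [h1, ← h4]
  refine forall_congr' fun t => ⟨fun h => ?_, fun h => ?_⟩
  · have := sub_mem h (h3 t)
    rwa [sub_sub_cancel] at this
  · have := add_mem (h3 t) h
    rwa [sub_add_cancel] at this

section Iso

variable [Algebra ℚ k]

include hE

variable {x : GroupAlgCompl k π} {s : S}
  (hx : comulHat k π x = inlHat k π x * inrHat k π x)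
  (hs : Compl.aug (groupAlg k π) x = MonoidAlgebra.of k S s)

include hx hs

omit [Algebra ℚ k] in
/-- A group-like element over `s ∈ S` has only one nonzero component, that of index `s`. -/
theorem evalHat_eq_single : E.evalHat x = Pi.single s (E.evalHat x s) := by
  have h1 := (E.aug_eq_iff x s).1 hs s
  rw [Pi.single_eq_same] at h1
  funext t
  by_cases ht : t = s
  · rw [ht, Pi.single_eq_same]
  · rw [Pi.single_eq_of_ne ht]
    have h2 := congrArg (UHat.map (LieHom.snd k L L)) ((comulHat_eq_iff hE x).1 hx s t)
    have e1 : (LieHom.snd k L L).comp (LieHom.inl k L L) = 0 := by ext; simp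
    have e2 : (LieHom.snd k L L).comp (LieHom.inr k L L) = LieHom.id := by ext; simp
    rw [if_neg (Ne.symm ht), map_zero, map_mul, ← RingHom.comp_apply, ← RingHom.comp_apply,
      ← UHat.map_comp, ← UHat.map_comp, e1, e2, UHat.map_id, UHat.map_zero_eq_one h1, one_mul] at h2
    exact h2.symm

/-- The component of index `s` of a group-like element over `s` is group-like, hence belongs to the
group `exp`. -/
theorem exists_toUnits_eq : ∃ v : ExpGroup k L, (ExpGroup.toUnits v : UHat k L) = E.evalHat x s := by
  have h1 := (E.aug_eq_iff x s).1 hs s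
  rw [Pi.single_eq_same] at h1
  obtain ⟨w, hw⟩ := Compl.isUnit_of_sub_one_mem h1
  have h2 := (comulHat_eq_iff hE x).1 hx s s
  rw [if_pos rfl] at h2
  refine ⟨⟨w, E.graded.mem_expSubgroup ?_ ?_⟩, hw⟩
  · rw [hw, ← sub_eq_zero, ← map_one (Compl.proj (J := augIdeal k L) 1), ← map_sub]
    exact h1
  · rw [hw]; exact h2

end Iso

end Expansion

theorem ExpGroup.toUnits_sub_one_mem {k : Type u} [CommRing k] [Algebra ℚ k] {L : Type*}
    [LieRing L] [LieAlgebra k L] (v : ExpGroup k L) :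
    (ExpGroup.toUnits v : UHat k L) - 1 ∈ Compl.fil (augIdeal k L) 1 := by
  induction v using ExpGroup.induction with
  | hexp u x hx hu =>
    rw [Compl.mem_fil, map_sub, hu 1, truncExp, sum_range_one]
    simp
  | h1 => rw [map_one, Units.val_one, sub_self]; exact zero_mem _
  | hmul u v hu hv =>
    have e : ∀ a b : UHat k L, a * b - 1 = (a - 1) * b + (b - 1) := by
      intros; noncomm_ring
    rw [map_mul, Units.val_mul, e]
    exact add_mem (Ideal.mul_mem_right _ _ hu) hv
  | hinv u hu =>
    have e : ((ExpGroup.toUnits u⁻¹ : (UHat k L)ˣ) : UHat k L) - 1 =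
        -((ExpGroup.toUnits u⁻¹ : (UHat k L)ˣ) * ((ExpGroup.toUnits u : UHat k L) - 1)) := by
      rw [mul_sub, map_inv, Units.inv_mul, mul_one, neg_sub]
    rw [e]
    exact neg_mem (Ideal.mul_mem_left _ _ hu)

theorem ExpGroup.map_diag {k : Type u} [CommRing k] [Algebra ℚ k] {L : Type*}
    [LieRing L] [LieAlgebra k L] (v : ExpGroup k L) :
    UHat.map (diagLie k L) (ExpGroup.toUnits v : UHat k L) =
      UHat.map (LieHom.inl k L L) (ExpGroup.toUnits v : UHat k L) *
        UHat.map (LieHom.inr k L L) (ExpGroup.toUnits v : UHat k L) := by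
  have h := expMap_eq_mul (e := diagLie k L) (f := LieHom.inl k L L) (g := LieHom.inr k L L)
    (fun a => by rw [LieHom.inl_apply, LieHom.inr_apply]; simp) lie_inl_inr v
  exact congrArg (fun w => (ExpGroup.toUnits w : UHat k (L × L))) h

namespace Expansion

variable {k : Type u} [CommRing k] [Algebra ℚ k] {L : Type u} [LieRing L] [LieAlgebra k L]
  {G S : Type} [Group G] [Group S] {π : G →* S} {X : Type} [DecidableEq S] [Fintype S]
  {E : Expansion k L π X}

omit [Algebra ℚ k] in
theorem evalHat_mul_of_single {x y : GroupAlgCompl k π} {s t : S} {v w : UHat k L}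
    (hx : E.evalHat x = Pi.single s v) (hy : E.evalHat y = Pi.single t w) :
    E.evalHat (x * y) = Pi.single (s * t) (v * UHat.map (E.act s) w) := by
  funext r
  rw [evalHat_mul, hx, hy, sum_eq_single s (fun s' _ hs' => by
    rw [Pi.single_eq_of_ne hs', zero_mul]) (by simp), Pi.single_eq_same]
  by_cases hr : r = s * t
  · rw [hr, inv_mul_cancel_left, Pi.single_eq_same, Pi.single_eq_same]
  · rw [Pi.single_eq_of_ne hr, Pi.single_eq_of_ne (by rwa [Ne, inv_mul_eq_iff_eq_mul]), map_zero,
      mul_zero]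

variable (hE : E.IsGroupLike) {φ : S →* MulAut (ExpGroup k L)}
  (hφ : ∀ s v, φ s v = expMap (E.act s) v)

variable (φ) in
/-- The element of `exp ⋊ S` attached to a point of the relative completion. -/
def toExp (g : RelCompletion k π) : ExpGroup k L ⋊[φ] S :=
  ⟨(exists_toUnits_eq hE g.2.1 g.2.2).choose, g.1.2⟩

theorem evalHat_eq_toExp (g : RelCompletion k π) : E.evalHat (g.1.1 : GroupAlgCompl k π) =
    Pi.single (toExp hE φ g).right (ExpGroup.toUnits (toExp hE φ g).left : UHat k L) := by
  have h := evalHat_eq_single hE g.2.1 g.2.2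
  rw [← (exists_toUnits_eq hE g.2.1 g.2.2).choose_spec] at h
  exact h

omit [DecidableEq S] [Fintype S] in
include hφ in
theorem map_act_toUnits (s : S) (v : ExpGroup k L) :
    UHat.map (E.act s) (ExpGroup.toUnits v : UHat k L) = ExpGroup.toUnits (φ s v) := by
  rw [hφ, expMap_val]

include hφ in
theorem toExp_mul (g h : RelCompletion k π) :
    toExp hE φ (g * h) = toExp hE φ g * toExp hE φ h := by
  have e1 := evalHat_eq_toExp hE (φ := φ) (g * h)
  have e2 := evalHat_mul_of_single (evalHat_eq_toExp hE (φ := φ) g) (evalHat_eq_toExp hE (φ := φ) h)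
  have e3 : E.evalHat ((g * h).1.1 : GroupAlgCompl k π) =
    E.evalHat ((g.1.1 : GroupAlgCompl k π) * (h.1.1 : GroupAlgCompl k π)) := rfl
  have hr : (toExp hE φ (g * h)).right = (toExp hE φ g).right * (toExp hE φ h).right := rfl
  rw [e3, e2, hr, map_act_toUnits hφ] at e1
  have e4 := congrFun e1 ((toExp hE φ g).right * (toExp hE φ h).right)
  rw [Pi.single_eq_same, Pi.single_eq_same] at e4
  refine SemidirectProduct.ext (ExpGroup.ext ?_) hr
  rw [← e4, SemidirectProduct.mul_left, map_mul, Units.val_mul]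

theorem toExp_injective : Function.Injective (toExp (π := π) hE φ) := by
  intro g h hgh
  refine Subtype.ext (Prod.ext (Units.ext (E.evalHat_injective ?_))
    (congrArg SemidirectProduct.right hgh))
  rw [evalHat_eq_toExp hE (φ := φ), evalHat_eq_toExp hE (φ := φ), hgh]

include hφ in
theorem toExp_surjective : Function.Surjective (toExp (π := π) hE φ) := by
  rintro ⟨v, s⟩
  obtain ⟨x, hx⟩ := E.evalHat_surjective (Pi.single s (ExpGroup.toUnits v : UHat k L))
  obtain ⟨y, hy⟩ := E.evalHat_surjective (Pi.single s⁻¹ (ExpGroup.toUnits (φ s⁻¹ v⁻¹) : UHat k L))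
  have hxy : x * y = 1 := E.evalHat_injective (by
    rw [evalHat_mul_of_single hx hy, evalHat_one, map_act_toUnits hφ, ← MulAut.mul_apply, ← map_mul,
      mul_inv_cancel, map_one, MulAut.one_apply, ← Units.val_mul, ← map_mul, mul_inv_cancel,
      map_one, Units.val_one])
  have hyx : y * x = 1 := E.evalHat_injective (by
    rw [evalHat_mul_of_single hy hx, evalHat_one, map_act_toUnits hφ, ← Units.val_mul, ← map_mul,
      ← map_mul, inv_mul_cancel, inv_mul_cancel, map_one, map_one, Units.val_one])
  have hg : ((⟨x, y, hxy, hyx⟩, s) : (GroupAlgCompl k π)ˣ × S) ∈ RelCompletion k π := by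
    refine ⟨(comulHat_eq_iff hE x).2 fun a b => ?_, (E.aug_eq_iff x s).2 fun t => ?_⟩
    · rw [hx]
      by_cases ha : a = s
      · by_cases hb : b = s
        · rw [ha, hb, if_pos rfl, Pi.single_eq_same]
          exact ExpGroup.map_diag v
        · rw [Pi.single_eq_of_ne hb, map_zero, mul_zero, if_neg (fun h => hb (h.symm.trans ha))]
      · rw [Pi.single_eq_of_ne ha, map_zero, map_zero, zero_mul, ite_self]
    · rw [hx]
      by_cases ht : t = s
      · rw [ht, Pi.single_eq_same, Pi.single_eq_same]
        exact ExpGroup.toUnits_sub_one_mem v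
      · rw [Pi.single_eq_of_ne ht, Pi.single_eq_of_ne ht, sub_zero]
        exact zero_mem _
  refine ⟨⟨_, hg⟩, SemidirectProduct.ext (ExpGroup.ext ?_) rfl⟩
  have h1 := evalHat_eq_toExp hE (φ := φ) ⟨_, hg⟩
  have h2 := congrFun (h1.symm.trans hx) s
  rw [show (toExp hE φ ⟨_, hg⟩).right = s from rfl, Pi.single_eq_same, Pi.single_eq_same] at h2
  exact h2

include hE hφ in
/-- A group-like expansion induces an isomorphism of the relative completion of `G` with the
semidirect product of `S` with the group `exp`. -/
theorem existsUnique_isInducedBy {f : G →* ExpGroup k L ⋊[φ] S} (hr : ∀ γ, (f γ).right = π γ)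
    (hl : ∀ γ, (ExpGroup.toUnits (f γ).left : UHat k L) = E.u γ) :
    ∃! F : RelCompletion k π ≃* ExpGroup k L ⋊[φ] S, IsInducedBy π f F := by
  have hf : ∀ (m : ℕ) (a : MonoidAlgebra k G), (a.coeff.sum fun γ c => c • crossCoord m (f γ)) =
      fun s => Compl.proj m (E.eval a s) := by
    intro m a
    funext s
    rw [E.eval_apply, Finsupp.sum, Finsupp.sum, Finset.sum_apply, Finset.sum_apply, map_sum]
    refine sum_congr rfl fun γ _ => ?_
    rw [Pi.smul_apply, Pi.smul_apply, Compl.proj_smul, crossCoord, hr, hl]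
    by_cases hs : s = π γ
    · rw [hs, Pi.single_eq_same, Pi.single_eq_same]
    · rw [Pi.single_eq_of_ne hs, Pi.single_eq_of_ne hs, map_zero]
  refine ⟨MulEquiv.ofBijective (MonoidHom.mk' (toExp hE φ) (toExp_mul hE hφ))
    ⟨toExp_injective hE, toExp_surjective hE hφ⟩, ⟨fun g => rfl, fun g m a ha => ?_⟩, ?_⟩
  · rw [hf]
    funext s
    have h1 := eval_sub_evalHat (E := E) ha s
    rw [Compl.mem_fil, map_sub, sub_eq_zero] at h1
    rw [h1, evalHat_eq_toExp hE (φ := φ)]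
    change (Pi.single (toExp hE φ g).right _ : S → _) s = _
    by_cases hs : s = (toExp hE φ g).right
    · rw [hs, Pi.single_eq_same, Pi.single_eq_same]; rfl
    · rw [Pi.single_eq_of_ne hs, Pi.single_eq_of_ne hs, map_zero]
  · rintro F ⟨hF1, hF2⟩
    refine MulEquiv.ext fun g => ?_
    change F g = toExp hE φ g
    have hr' : (F g).right = (toExp hE φ g).right := hF1 g
    refine SemidirectProduct.ext (ExpGroup.ext (Compl.ext fun m => ?_)) hr'
    have ha := (g.1.1 : GroupAlgCompl k π).mk_rep m
    have h2 := congrFun ((hF2 g m _ ha).trans (hf m _)) (F g).right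
    beta_reduce at h2
    have h1 := eval_sub_evalHat (E := E) ha (F g).right
    rw [Compl.mem_fil, map_sub, sub_eq_zero] at h1
    rw [h1, evalHat_eq_toExp hE (φ := φ), crossCoord, Pi.single_eq_same, hr',
      Pi.single_eq_same] at h2
    exact h2

end Expansion

/-! ### The Coxeter presentation of the symmetric group -/

section Coxeter

variable {Q : Type*} [Group Q] {s : ℕ → Q} {N : ℕ}
  (hb : ∀ i, i + 1 < N → s i * s (i + 1) * s i = s (i + 1) * s i * s (i + 1))
  (hc : ∀ i j, i + 1 < j → j < N → s i * s j = s j * s i)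

include hc in
theorem descFrom_comm {m i j : ℕ} (hm : m < N) (h : i + j < m) :
    descFrom s m j * s i = s i * descFrom s m j := by
  induction j with
  | zero => simp [descFrom]
  | succ j ih =>
    rw [descFrom, mul_assoc, ← hc i (m - j) (by omega) (by omega), ← mul_assoc, ih (by omega),
      mul_assoc]

include hb hc in
theorem descFrom_shift {m i j : ℕ} (hm : m < N) (hi : i < m) (h : m < i + j) (hj : j ≤ m + 1) :
    descFrom s m j * s (i + 1) = s i * descFrom s m j := by
  induction j with
  | zero => omega
  | succ j ih =>
    rcases Nat.lt_or_ge m (i + j) with h' | h'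
    · rw [descFrom, mul_assoc, hc (m - j) (i + 1) (by omega) (by omega), ← mul_assoc,
        ih h' (by omega), mul_assoc]
    · obtain ⟨j, rfl⟩ : ∃ j', j = j' + 1 := ⟨j - 1, by omega⟩
      have e1 : m - (j + 1) = i := by omega
      have e2 : m - j = i + 1 := by omega
      rw [descFrom, descFrom, e1, e2, mul_assoc, mul_assoc, ← mul_assoc (s (i + 1)),
        ← hb i (by omega), mul_assoc, ← mul_assoc _ (s i), descFrom_comm hc hm (by omega), mul_assoc,
        mul_assoc]

variable (hsq : ∀ i < N, s i * s i = 1)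

include hb hc hsq in
/-- Every element of the subgroup generated by `s_0, …, s_m` is the product of an element of the
subgroup generated by `s_0, …, s_{m-1}` and of one of the `m + 2` words `s_m s_{m-1} ⋯ s_l`. -/
theorem exists_eq_mul_descFrom {m : ℕ} (hm : m < N) {q : Q}
    (hq : q ∈ Subgroup.closure (s '' Set.Iio (m + 1))) :
    ∃ h ∈ Subgroup.closure (s '' Set.Iio m), ∃ j ≤ m + 1, q = h * descFrom s m j := by
  have step : ∀ q i, i < m + 1 →
      (∃ h ∈ Subgroup.closure (s '' Set.Iio m), ∃ j ≤ m + 1, q = h * descFrom s m j) →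
      ∃ h ∈ Subgroup.closure (s '' Set.Iio m), ∃ j ≤ m + 1, q * s i = h * descFrom s m j := by
    rintro q i hi ⟨h, hh, j, hj, rfl⟩
    have hs : ∀ i < m, s i ∈ Subgroup.closure (s '' Set.Iio m) := fun i hi =>
      Subgroup.subset_closure ⟨i, hi, rfl⟩
    rcases lt_trichotomy (i + j) m with h1 | h1 | h1
    · exact ⟨h * s i, mul_mem hh (hs i (by omega)), j, hj, by
        rw [mul_assoc, descFrom_comm hc hm h1, mul_assoc]⟩
    · refine ⟨h, hh, j + 1, by omega, ?_⟩
      rw [descFrom, show m - j = i by omega, mul_assoc]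
    · rcases Nat.lt_or_ge (m + 1) (i + j) with h2 | h2
      · obtain ⟨i, rfl⟩ : ∃ i', i = i' + 1 := ⟨i - 1, by omega⟩
        exact ⟨h * s i, mul_mem hh (hs i (by omega)), j, hj, by
          rw [mul_assoc, descFrom_shift hb hc hm (by omega) (by omega) hj, mul_assoc]⟩
      · obtain ⟨j, rfl⟩ : ∃ j', j = j' + 1 := ⟨j - 1, by omega⟩
        refine ⟨h, hh, j, by omega, ?_⟩
        rw [descFrom, show m - j = i by omega, mul_assoc, mul_assoc, hsq i (by omega), mul_one]
  induction hq using Subgroup.closure_induction_right with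
  | one => exact ⟨1, one_mem _, 0, by omega, by simp [descFrom]⟩
  | mul_right x _ y hy ih =>
    obtain ⟨i, hi, rfl⟩ := hy
    exact step x i hi ih
  | mul_inv_cancel x _ y hy ih =>
    obtain ⟨i, hi, rfl⟩ := hy
    rw [inv_eq_of_mul_eq_one_right (hsq i (by have : i < m + 1 := hi; omega))]
    exact step x i hi ih

variable {n : ℕ} (p : Q →* Equiv.Perm (Fin n))
  (hmove : ∀ i < N, ∀ x : Fin n, (x : ℕ) = i → (p (s i) x : ℕ) = i + 1)
  (hfix : ∀ i < N, ∀ x : Fin n, i + 1 < (x : ℕ) → p (s i) x = x)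

include hmove in
theorem perm_descFrom {m j : ℕ} (hm : m < N) (hj : j ≤ m + 1) {x : Fin n}
    (hx : (x : ℕ) + j = m + 1) : (p (descFrom s m j) x : ℕ) = m + 1 := by
  induction j generalizing x with
  | zero => rw [descFrom, map_one, Equiv.Perm.one_apply]; exact hx
  | succ j ih =>
    rw [descFrom, map_mul, Equiv.Perm.mul_apply]
    refine ih (by omega) ?_
    rw [hmove (m - j) (by omega) x (by omega)]
    omega

include hfix in
theorem perm_closure {m : ℕ} (hm : m ≤ N) {h : Q} (hh : h ∈ Subgroup.closure (s '' Set.Iio m))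
    {x : Fin n} (hx : m < (x : ℕ)) : p h x = x := by
  induction hh using Subgroup.closure_induction with
  | mem y hy =>
    obtain ⟨i, hi, rfl⟩ := hy
    have hi : i < m := hi
    exact hfix i (by omega) x (by omega)
  | one => rw [map_one, Equiv.Perm.one_apply]
  | mul a b _ _ ha hb => rw [map_mul, Equiv.Perm.mul_apply, hb, ha]
  | inv a _ ha => rw [map_inv, Equiv.Perm.inv_eq_iff_eq, ha]

include hb hc hsq hmove hfix in
/-- By the normal form `h * descFrom s m j`, an element of the subgroup generated by `s_0, …, s_m`
whose permutation fixes the position `m + 1` belongs to the subgroup generated by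
`s_0, …, s_{m-1}`. -/
theorem mem_closure_of_perm_fix {m : ℕ} (hm : m < N) {q : Q}
    (hq : q ∈ Subgroup.closure (s '' Set.Iio (m + 1))) (hn : m + 1 < n)
    (hfq : p q ⟨m + 1, hn⟩ = ⟨m + 1, hn⟩) : q ∈ Subgroup.closure (s '' Set.Iio m) := by
  obtain ⟨h, hh, j, hj, rfl⟩ := exists_eq_mul_descFrom hb hc hsq hm hq
  -- the position `m + 1 - j` is mapped to `m + 1`
  let x : Fin n := ⟨m + 1 - j, by omega⟩
  have h1 : p (descFrom s m j) x = ⟨m + 1, hn⟩ := Fin.ext (perm_descFrom p hmove hm hj (by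
    change m + 1 - j + j = _; omega))
  have h2 := perm_closure p hfix hm.le hh (x := ⟨m + 1, hn⟩) (Nat.lt_succ_self m)
  have h3 : x = ⟨m + 1, hn⟩ := (p (h * descFrom s m j)).injective (by
    rw [hfq, map_mul, Equiv.Perm.mul_apply, h1, h2])
  obtain rfl : j = 0 := by
    have : m + 1 - j = m + 1 := congrArg Fin.val h3
    omega
  rwa [descFrom, mul_one]

include hb hc hsq hmove hfix in
/-- A group generated by involutions satisfying the braid relations and mapped to the simple
transpositions is isomorphic to its image in the symmetric group. -/
theorem eq_one_of_perm_eq_one (hN : N < n) {m : ℕ} (hm : m ≤ N) {q : Q}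
    (hq : q ∈ Subgroup.closure (s '' Set.Iio m)) (hp : p q = 1) : q = 1 := by
  induction m with
  | zero => simpa using hq
  | succ m ih => exact ih (by omega) (mem_closure_of_perm_fix hb hc hsq p hmove hfix (by omega) hq
      (by omega) (by rw [hp, Equiv.Perm.one_apply]))

end Coxeter

/-! ### Symbols of the elements of the kernel -/

section Symbol

variable {k : Type u} [CommRing k] {G S : Type} [Group G] [Group S] {π : G →* S}

theorem of_sub_one_mem_pow_one {g : G} (hg : π g = 1) :
    MonoidAlgebra.of k G g - 1 ∈ relIdeal k π ^ 1 := by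
  rw [Submodule.pow_one]; exact of_sub_one_mem hg

open Classical in
variable (k π) in
/-- The class of `g - 1` in degree one of the associated graded algebra, for `g ∈ ker π`; it is
`0` by convention for the other elements of `G`. -/
def symb (g : G) : AssocGraded k (relIdeal k π) :=
  if hg : π g = 1 then grElt k 1 (MonoidAlgebra.of k G g - 1) (of_sub_one_mem_pow_one hg) else 0

variable {g h : G}

theorem symb_of_mem (hg : π g = 1) : symb k π g =
    grElt k 1 (MonoidAlgebra.of k G g - 1) (of_sub_one_mem_pow_one hg) := dif_pos hg

theorem symb_one : symb k π 1 = 0 := by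
  rw [symb_of_mem (map_one π), grElt_eq_zero_iff, map_one, sub_self]
  exact zero_mem _

theorem symb_mul (hg : π g = 1) (hh : π h = 1) :
    symb k π (g * h) = symb k π g + symb k π h := by
  rw [symb_of_mem hg, symb_of_mem hh, symb_of_mem (by rw [map_mul, hg, hh, one_mul]), ← grElt_add,
    grElt_eq_iff]
  have e : MonoidAlgebra.of k G (g * h) - 1 -
      (MonoidAlgebra.of k G g - 1 + (MonoidAlgebra.of k G h - 1)) =
      (MonoidAlgebra.of k G g - 1) * (MonoidAlgebra.of k G h - 1) := by
    rw [map_mul]; noncomm_ring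
  rw [e, Ideal.IsTwoSided.pow_add]
  exact Ideal.mul_mem_mul (of_sub_one_mem_pow_one hg) (of_sub_one_mem_pow_one hh)

theorem symb_inv (hg : π g = 1) : symb k π g⁻¹ = -symb k π g := by
  rw [eq_neg_iff_add_eq_zero, ← symb_mul (by rw [map_inv, hg, inv_one]) hg, inv_mul_cancel,
    symb_one]

theorem symb_conj (hg : π g = 1) (hh : π h = 1) : symb k π (g * h * g⁻¹) = symb k π h := by
  rw [symb_mul (by rw [map_mul, hg, hh, one_mul]) (by rw [map_inv, hg, inv_one]), symb_mul hg hh,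
    symb_inv hg]
  abel

theorem symb_lie (hg : π g = 1) (hh : π h = 1) (e : Commute g h) :
    ⁅symb k π g, symb k π h⁆ = 0 := by
  have hm : ∀ {a b : G} (ha : π a = 1) (hb : π b = 1), (MonoidAlgebra.of k G a - 1) *
      (MonoidAlgebra.of k G b - 1) ∈ relIdeal k π ^ (1 + 1) := fun ha hb => by
    rw [Ideal.IsTwoSided.pow_add]
    exact Ideal.mul_mem_mul (of_sub_one_mem_pow_one ha) (of_sub_one_mem_pow_one hb)
  rw [Ring.lie_def, symb_of_mem hg, symb_of_mem hh, ← grElt_mul _ _ (hm hg hh),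
    ← grElt_mul _ _ (hm hh hg), ← grElt_sub, grElt_eq_zero_iff]
  have e' : MonoidAlgebra.of k G g * MonoidAlgebra.of k G h =
      MonoidAlgebra.of k G h * MonoidAlgebra.of k G g := by rw [← map_mul, ← map_mul, e.eq]
  have e2 : ∀ a b : MonoidAlgebra k G, a * b = b * a →
      (a - 1) * (b - 1) - (b - 1) * (a - 1) = 0 := fun a b hab => by
    rw [sub_mul, sub_mul, mul_sub, mul_sub, hab]
    noncomm_ring
  rw [e2 _ _ e']
  exact zero_mem _

theorem exists_sub_mem_of_symb_mem_span {X : Type} {loop : X → G} (hl : ∀ x, π (loop x) = 1)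
    (hg : π g = 1) (h : symb k π g ∈ Submodule.span k (Set.range fun x => symb k π (loop x))) :
    ∃ v ∈ Submodule.span k (Set.range fun x => MonoidAlgebra.of k G (loop x) - 1),
      MonoidAlgebra.of k G g - 1 - v ∈ relIdeal k π ^ 2 := by
  have key : ∀ y ∈ Submodule.span k (Set.range fun x => symb k π (loop x)),
      ∃ v, ∃ hv : v ∈ relIdeal k π ^ 1,
        v ∈ Submodule.span k (Set.range fun x => MonoidAlgebra.of k G (loop x) - 1) ∧
          y = grElt k 1 v hv := by
    intro y hy
    induction hy using Submodule.span_induction with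
    | mem y hy =>
      obtain ⟨x, rfl⟩ := hy
      exact ⟨_, of_sub_one_mem_pow_one (hl x), Submodule.subset_span ⟨x, rfl⟩,
        symb_of_mem (hl x)⟩
    | zero => exact ⟨0, zero_mem _, zero_mem _, ((grElt_eq_zero_iff _).2 (zero_mem _)).symm⟩
    | add y z _ _ hy hz =>
      obtain ⟨v, hv, hv', rfl⟩ := hy
      obtain ⟨w, hw, hw', rfl⟩ := hz
      exact ⟨v + w, add_mem hv hw, add_mem hv' hw', (grElt_add hv hw).symm⟩
    | smul c y _ hy =>
      obtain ⟨v, hv, hv', rfl⟩ := hy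
      have hc : c • v ∈ relIdeal k π ^ 1 := by
        rw [Algebra.smul_def]; exact Ideal.mul_mem_left _ _ hv
      exact ⟨c • v, hc, Submodule.smul_mem _ _ hv', (grElt_smul c hv hc).symm⟩
  obtain ⟨v, hv, hv', e⟩ := key _ h
  rw [symb_of_mem hg, grElt_eq_iff] at e
  exact ⟨v, hv', e⟩

end Symbol

/-! ### Generators of the mapping class group and of its pure part -/

section GammaGenerators

variable {n : ℕ}

variable (n) in
/-- The image of the `i`-th Artin generator in `Γ_{0,n}`, continued by `1`. -/
def gammaGen (i : ℕ) : Gamma n := braidToGamma n (sigmaNat n i)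

theorem braidToGamma_surjective : Function.Surjective (braidToGamma n) :=
  QuotientGroup.mk'_surjective _

theorem gammaGen_braid (i : ℕ) (h : i + 1 < n - 1) :
    gammaGen n i * gammaGen n (i + 1) * gammaGen n i =
      gammaGen n (i + 1) * gammaGen n i * gammaGen n (i + 1) := by
  simp only [gammaGen, ← map_mul, sigmaNat_braid i h]

theorem gammaGen_far (i j : ℕ) (h : i + 1 < j) (hj : j < n - 1) :
    gammaGen n i * gammaGen n j = gammaGen n j * gammaGen n i := by
  simp only [gammaGen, ← map_mul, sigmaNat_far i j h hj]

theorem gammaPerm_gammaGen {i : ℕ} (h : i < n - 1) :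
    gammaPerm n (gammaGen n i) = adjSwap ⟨i, h⟩ := by
  rw [gammaGen, sigmaNat_of_lt h]
  exact braidPerm_sigma n _

theorem gammaPerm_gammaGen_left {i : ℕ} (h : i < n - 1) {x : Fin n} (hx : (x : ℕ) = i) :
    (gammaPerm n (gammaGen n i) x : ℕ) = i + 1 := by
  have e : x = strand ⟨i, h⟩ := Fin.ext hx
  rw [gammaPerm_gammaGen h, e, adjSwap, Equiv.swap_apply_left]
  rfl

theorem gammaPerm_gammaGen_right {i : ℕ} (h : i < n - 1) {x : Fin n} (hx : (x : ℕ) = i + 1) :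
    (gammaPerm n (gammaGen n i) x : ℕ) = i := by
  have e : x = strandSucc ⟨i, h⟩ := Fin.ext hx
  rw [gammaPerm_gammaGen h, e, adjSwap, Equiv.swap_apply_right]
  rfl

theorem gammaPerm_gammaGen_of_ne {i : ℕ} (h : i < n - 1) {x : Fin n} (hx : (x : ℕ) ≠ i)
    (hx' : (x : ℕ) ≠ i + 1) : gammaPerm n (gammaGen n i) x = x := by
  rw [gammaPerm_gammaGen h]
  exact Equiv.swap_apply_of_ne_of_ne (fun e => hx (congrArg Fin.val e))
    (fun e => hx' (congrArg Fin.val e))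

theorem gammaPerm_gammaGen_sq {i : ℕ} (h : i < n - 1) :
    gammaPerm n (gammaGen n i * gammaGen n i) = 1 := by
  rw [map_mul, gammaPerm_gammaGen h, adjSwap, Equiv.swap_mul_self]

theorem closure_gammaGen : Subgroup.closure (gammaGen n '' Set.Iio (n - 1)) = ⊤ := by
  have h : gammaGen n '' Set.Iio (n - 1) = braidToGamma n '' Set.range sigma := by
    ext γ
    constructor
    · rintro ⟨i, hi, rfl⟩
      exact ⟨_, ⟨⟨i, hi⟩, rfl⟩, by rw [gammaGen, sigmaNat_of_lt hi]⟩
    · rintro ⟨_, ⟨i, rfl⟩, rfl⟩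
      exact ⟨i, i.2, by rw [gammaGen, sigmaNat_of_lt i.2]⟩
  rw [h, ← MonoidHom.map_closure]
  erw [PresentedGroup.closure_range_of]
  exact Subgroup.map_top_of_surjective _ braidToGamma_surjective

theorem gammaPerm_surjective : Function.Surjective (gammaPerm n) := by
  rw [← MonoidHom.range_eq_top, eq_top_iff]
  rcases n with _ | n
  · intro g _
    exact ⟨1, Subsingleton.elim _ _⟩
  · rw [← Subgroup.closure_eq_top_of_mclosure_eq_top (Equiv.Perm.mclosure_swap_castSucc_succ n),
      Subgroup.closure_le]
    rintro _ ⟨i, rfl⟩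
    exact ⟨gammaGen (n + 1) i, gammaPerm_gammaGen i.2⟩

/-- The Coxeter relations hold in the quotient by the squares of the generators, which is thus
isomorphic to the symmetric group. -/
theorem ker_gammaPerm_le : (gammaPerm n).ker ≤
    Subgroup.normalClosure {γ | ∃ i < n - 1, γ = gammaGen n i * gammaGen n i} := by
  set N := Subgroup.normalClosure {γ | ∃ i < n - 1, γ = gammaGen n i * gammaGen n i} with hN
  intro g hg
  have hle : N ≤ (gammaPerm n).ker := by
    apply Subgroup.normalClosure_le_normal
    rintro _ ⟨i, hi, rfl⟩
    exact gammaPerm_gammaGen_sq hi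
  rcases Nat.eq_zero_or_pos n with rfl | hn
  · have h : Subgroup.closure (gammaGen 0 '' Set.Iio (0 - 1)) = ⊤ := closure_gammaGen
    have hg : g ∈ Subgroup.closure (gammaGen 0 '' Set.Iio (0 - 1)) := h ▸ Subgroup.mem_top g
    have : g = 1 := by simpa using hg
    rw [this]; exact one_mem _
  rw [← QuotientGroup.eq_one_iff]
  refine eq_one_of_perm_eq_one (s := fun i => QuotientGroup.mk' N (gammaGen n i)) (N := n - 1)
    (fun i h => ?_) (fun i j h hj => ?_) (fun i hi => ?_) (QuotientGroup.lift N (gammaPerm n) hle)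
    (fun i hi x hx => gammaPerm_gammaGen_left hi hx)
    (fun i hi x hx => gammaPerm_gammaGen_of_ne hi (by omega) (by omega)) (by omega) le_rfl ?_ hg
  · simp only [← map_mul, gammaGen_braid i h]
  · simp only [← map_mul, gammaGen_far i j h hj]
  · rw [← map_mul]
    exact (QuotientGroup.eq_one_iff _).2 (Subgroup.subset_normalClosure ⟨i, hi, rfl⟩)
  · have h : (fun i => QuotientGroup.mk' N (gammaGen n i)) '' Set.Iio (n - 1) =
        QuotientGroup.mk' N '' (gammaGen n '' Set.Iio (n - 1)) := by rw [Set.image_image]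
    rw [h, ← MonoidHom.map_closure, closure_gammaGen]
    exact ⟨g, Subgroup.mem_top g, rfl⟩

theorem exists_gammaPerm_eq {r : ℕ} (f x : Fin r → Fin n) (hf : Function.Injective f)
    (hx : Function.Injective x) : ∃ γ, ∀ i, gammaPerm n γ (x i) = f i := by
  obtain ⟨p, hp⟩ := (MulAction.isMultiplyPretransitive_iff (G := Equiv.Perm (Fin n))
    (α := Fin n) (n := r)).1 (Equiv.Perm.isMultiplyPretransitive _ _) ⟨x, hx⟩ ⟨f, hf⟩
  obtain ⟨γ, rfl⟩ := gammaPerm_surjective p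
  exact ⟨γ, fun i => DFunLike.congr_fun hp i⟩

end GammaGenerators

/-! ### Full twists of two adjacent strands and their symbols -/

section Twists

variable {n : ℕ}

/-- The conjugate by `γ` of the full twist of the strands in positions `m` and `m + 1`. -/
def twist (γ : Gamma n) (m : ℕ) : Gamma n := γ * (gammaGen n m * gammaGen n m) * γ⁻¹

/-- The permutation of `γ` maps `m` and `m + 1` to `i` and `j`. -/
def Carries (γ : Gamma n) (m : ℕ) (i j : Fin n) : Prop :=
  ∃ a b : Fin n, (a : ℕ) = m ∧ (b : ℕ) = m + 1 ∧ gammaPerm n γ a = i ∧ gammaPerm n γ b = j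

variable {γ γ' : Gamma n} {m : ℕ} {i j l : Fin n}

theorem Carries.lt (h : Carries γ m i j) : m < n - 1 := by
  obtain ⟨a, b, ha, hb, -⟩ := h
  omega

theorem gammaPerm_twist (h : m < n - 1) : gammaPerm n (twist γ m) = 1 := by
  rw [twist, map_mul, map_mul, gammaPerm_gammaGen_sq h, mul_one, map_inv, mul_inv_cancel]

theorem Carries.swap (h : Carries γ m i j) : Carries (γ * gammaGen n m) m j i := by
  have hm := h.lt
  obtain ⟨a, b, ha, hb, rfl, rfl⟩ := h
  refine ⟨a, b, ha, hb, ?_, ?_⟩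
  · rw [map_mul, Equiv.Perm.mul_apply]
    congr 1
    exact Fin.ext (by rw [gammaPerm_gammaGen_left hm ha, hb])
  · rw [map_mul, Equiv.Perm.mul_apply]
    congr 1
    exact Fin.ext (by rw [gammaPerm_gammaGen_right hm hb, ha])

theorem twist_mul_gammaGen (γ : Gamma n) (m : ℕ) : twist (γ * gammaGen n m) m = twist γ m := by
  rw [twist, twist]; group

/-- `s_m` is conjugate to `s_{m+1}`, by the braid relation. -/
theorem twist_succ (h : m + 1 < n - 1) :
    twist (γ * (gammaGen n m * gammaGen n (m + 1))⁻¹) (m + 1) = twist γ m := by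
  have e : gammaGen n (m + 1) = (gammaGen n m * gammaGen n (m + 1)) * gammaGen n m *
      (gammaGen n m * gammaGen n (m + 1))⁻¹ := by
    rw [gammaGen_braid m h, eq_mul_inv_iff_mul_eq, mul_assoc]
  rw [twist]
  conv_lhs => enter [1, 2]; rw [e]
  rw [twist]
  group

theorem Carries.succ (h : Carries γ m i j) (hm : m + 1 < n - 1) :
    Carries (γ * (gammaGen n m * gammaGen n (m + 1))⁻¹) (m + 1) i j := by
  have hm' := h.lt
  obtain ⟨a, b, ha, hb, rfl, rfl⟩ := h
  let c : Fin n := ⟨m + 2, by omega⟩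
  have ea : gammaPerm n (gammaGen n m * gammaGen n (m + 1)) a = b := by
    rw [map_mul, Equiv.Perm.mul_apply, gammaPerm_gammaGen_of_ne hm (by omega) (by omega)]
    exact Fin.ext (by rw [gammaPerm_gammaGen_left hm' ha, hb])
  have eb : gammaPerm n (gammaGen n m * gammaGen n (m + 1)) b = c := by
    have e : gammaPerm n (gammaGen n (m + 1)) b = c :=
      Fin.ext (by rw [gammaPerm_gammaGen_left hm hb])
    rw [map_mul, Equiv.Perm.mul_apply, e]
    exact gammaPerm_gammaGen_of_ne hm' (by change m + 2 ≠ m; omega) (by change m + 2 ≠ m + 1; omega)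
  refine ⟨b, c, hb, rfl, ?_, ?_⟩
  · rw [map_mul, map_inv, Equiv.Perm.mul_apply, Equiv.Perm.inv_eq_iff_eq.2 ea.symm]
  · rw [map_mul, map_inv, Equiv.Perm.mul_apply, Equiv.Perm.inv_eq_iff_eq.2 eb.symm]

/-- An element fixing the last two positions is the product of an element of `ker π` and of an
element commuting with the last generator. -/
theorem exists_eq_mul_of_fix (hm : m + 2 = n) {δ : Gamma n}
    (hδ : ∀ x : Fin n, m ≤ (x : ℕ) → gammaPerm n δ x = x) :
    ∃ κ η, gammaPerm n κ = 1 ∧ Commute η (gammaGen n m) ∧ δ = κ * η := by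
  obtain ⟨η, hη, e⟩ : ∃ η ∈ Subgroup.closure (gammaGen n '' Set.Iio (m - 1)),
      gammaPerm n η = gammaPerm n δ := by
    set s : ℕ → Equiv.Perm (Fin n) := fun i => gammaPerm n (gammaGen n i) with hs
    have hcl : ∀ r, Subgroup.closure (s '' Set.Iio r) =
        (Subgroup.closure (gammaGen n '' Set.Iio r)).map (gammaPerm n) := fun r => by
      rw [MonoidHom.map_closure, Set.image_image]
    suffices h : gammaPerm n δ ∈ Subgroup.closure (s '' Set.Iio (m - 1)) by
      rw [hcl] at h
      exact h
    have step : ∀ r, r < n - 1 → m ≤ r + 1 → gammaPerm n δ ∈ Subgroup.closure (s '' Set.Iio (r + 1)) →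
        gammaPerm n δ ∈ Subgroup.closure (s '' Set.Iio r) := fun r hr hr' hq =>
      mem_closure_of_perm_fix (s := s) (N := n - 1)
        (fun i h => by simp only [hs, ← map_mul, gammaGen_braid i h])
        (fun i j h hj => by simp only [hs, ← map_mul, gammaGen_far i j h hj])
        (fun i hi => by rw [hs, ← map_mul, gammaPerm_gammaGen_sq hi]) (MonoidHom.id _)
        (fun i hi x hx => gammaPerm_gammaGen_left hi hx)
        (fun i hi x hx => gammaPerm_gammaGen_of_ne hi (by omega) (by omega)) hr hq (by omega)
        (hδ _ (by change m ≤ r + 1; omega))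
    have h0 : gammaPerm n δ ∈ Subgroup.closure (s '' Set.Iio (m + 1)) := by
      rw [hcl, show m + 1 = n - 1 by omega, closure_gammaGen]
      exact ⟨δ, Subgroup.mem_top _, rfl⟩
    have h1 := step m (by omega) (by omega) h0
    rcases m with _ | m
    · exact h1
    · exact step m (by omega) (by omega) h1
  refine ⟨δ * η⁻¹, η, by rw [map_mul, map_inv, e, mul_inv_cancel], ?_,
    (inv_mul_cancel_right _ _).symm⟩
  clear e
  induction hη using Subgroup.closure_induction with
  | mem y hy =>
    obtain ⟨i, hi, rfl⟩ := hy
    have hi : i < m - 1 := hi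
    exact gammaGen_far i m (by omega) (by omega)
  | one => exact Commute.one_left _
  | mul a b _ _ ha hb => exact ha.mul_left hb
  | inv a _ ha => exact ha.inv_left

end Twists

/-! ### The relations of `p_n` between the symbols of the twists -/

section TwistSymbols

variable {k : Type u} [CommRing k] {n : ℕ} {γ γ' : Gamma n} {m : ℕ} {i j l : Fin n}

open Classical in
/-- The pure element attached to a pair of strands: the twist of the last two positions, conjugated
by any element carrying them to `i` and `j`. It is `1` by convention if `i = j`. -/
def pureLoop (i j : Fin n) : Gamma n :=
  if h : ∃ γ, Carries γ (n - 2) i j then twist h.choose (n - 2) else 1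

theorem gammaPerm_pureLoop (i j : Fin n) : gammaPerm n (pureLoop i j) = 1 := by
  rw [pureLoop]
  split_ifs with h
  · exact gammaPerm_twist h.choose_spec.lt
  · exact map_one _

/-- Two elements carrying the last two positions to the same pair differ by an element of `ker π`,
which does not change symbols, and by one commuting with the last generator. -/
theorem symb_twist_of_last (hm : m + 2 = n) (h : Carries γ m i j) (h' : Carries γ' m i j) :
    symb k (gammaPerm n) (twist γ m) = symb k (gammaPerm n) (twist γ' m) := by
  have hlt := h.lt
  obtain ⟨a, b, ha, hb, rfl, rfl⟩ := h
  obtain ⟨a', b', ha', hb', e1, e2⟩ := h'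
  obtain rfl : a = a' := Fin.ext (by omega)
  obtain rfl : b = b' := Fin.ext (by omega)
  obtain ⟨κ, η, hκ, hη, e⟩ := exists_eq_mul_of_fix hm (δ := γ'⁻¹ * γ) fun x hx => by
    rw [map_mul, map_inv, Equiv.Perm.mul_apply, Equiv.Perm.inv_eq_iff_eq]
    rcases (show (x : ℕ) = a ∨ (x : ℕ) = b by omega) with hx | hx
    · rw [Fin.ext hx, e1]
    · rw [Fin.ext hx, e2]
  have e3 : twist γ m = γ' * κ * γ'⁻¹ * twist γ' m * (γ' * κ * γ'⁻¹)⁻¹ := by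
    have hc : η * (gammaGen n m * gammaGen n m) * η⁻¹ = gammaGen n m * gammaGen n m := by
      rw [(hη.mul_right hη).eq, mul_inv_cancel_right]
    rw [inv_mul_eq_iff_eq_mul] at e
    rw [twist, twist, e]
    calc γ' * (κ * η) * (gammaGen n m * gammaGen n m) * (γ' * (κ * η))⁻¹
        = γ' * κ * (η * (gammaGen n m * gammaGen n m) * η⁻¹) * κ⁻¹ * γ'⁻¹ := by group
      _ = _ := by rw [hc]; group
  rw [e3, symb_conj (by rw [map_mul, map_mul, hκ, mul_one, map_inv, mul_inv_cancel])
    (gammaPerm_twist hlt)]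

/-- The symbol of the twist of two adjacent positions only depends on their images: the adjacent
positions can be moved to the last two. -/
theorem Carries.symb_twist (h : Carries γ m i j) :
    symb k (gammaPerm n) (twist γ m) = symb k (gammaPerm n) (pureLoop i j) := by
  obtain ⟨r, hr⟩ : ∃ r, m + 2 + r = n := ⟨n - (m + 2), by have := h.lt; omega⟩
  induction r generalizing m γ with
  | zero =>
    obtain rfl : m = n - 2 := by omega
    have hex : ∃ γ, Carries γ (n - 2) i j := ⟨γ, h⟩
    rw [pureLoop, dif_pos hex]
    exact symb_twist_of_last hr h hex.choose_spec
  | succ r ih =>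
    have hm : m + 1 < n - 1 := by omega
    rw [← twist_succ hm]
    exact ih (h.succ hm) (by omega)

variable (k) in
/-- The symbol of the pure element attached to `i` and `j`. -/
def pureSymb (i j : Fin n) : AssocGraded k (relIdeal k (gammaPerm n)) :=
  symb k (gammaPerm n) (pureLoop i j)

theorem pureSymb_self (i : Fin n) : pureSymb k i i = 0 := by
  have h : ¬∃ γ, Carries γ (n - 2) i i := by
    rintro ⟨γ, a, b, ha, hb, e1, e2⟩
    have := congrArg Fin.val ((gammaPerm n γ).injective (e1.trans e2.symm))
    omega
  rw [pureSymb, pureLoop, dif_neg h, symb_one]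

theorem exists_carries (h : i ≠ j) : ∃ γ : Gamma n, Carries γ (n - 2) i j := by
  have hn : 2 ≤ n := by
    have := i.2; have := j.2; have : (i : ℕ) ≠ j := fun e => h (Fin.ext e)
    omega
  obtain ⟨γ, hγ⟩ := exists_gammaPerm_eq ![i, j] ![⟨n - 2, by omega⟩, ⟨n - 2 + 1, by omega⟩]
    (by simpa [Function.Injective, Fin.forall_fin_two, h] using h.symm)
    (by simp [Function.Injective, Fin.forall_fin_two])
  exact ⟨γ, _, _, rfl, rfl, hγ 0, hγ 1⟩

theorem pureSymb_comm (i j : Fin n) : pureSymb k j i = pureSymb k i j := by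
  by_cases h : i = j
  · rw [h]
  obtain ⟨γ, hγ⟩ := exists_carries h
  rw [pureSymb, pureSymb, ← hγ.symb_twist, ← hγ.swap.symb_twist, twist_mul_gammaGen]

/-- With `i, j, l` in positions `0, 1, 2`, the full twist of the first two strands commutes with the
turn of the third strand around them, whose symbol is the sum of the other two. -/
theorem pureSymb_triangle (hij : i ≠ j) (hil : i ≠ l) (hjl : j ≠ l) :
    ⁅pureSymb k i j, pureSymb k i l + pureSymb k j l⁆ = 0 := by
  have hn : 3 ≤ n := by
    have := i.2; have := j.2; have := l.2
    have : (i : ℕ) ≠ j := fun e => hij (Fin.ext e)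
    have : (i : ℕ) ≠ l := fun e => hil (Fin.ext e)
    have : (j : ℕ) ≠ l := fun e => hjl (Fin.ext e)
    omega
  obtain ⟨γ, hγ⟩ := exists_gammaPerm_eq ![i, j, l] (Fin.castLE hn)
    (by
      intro a b
      fin_cases a <;> fin_cases b <;> simp [hij, hil, hjl, hij.symm, hil.symm, hjl.symm])
    (Fin.castLE_injective hn)
  have h0 : Carries γ 0 i j := ⟨_, _, rfl, rfl, hγ 0, hγ 1⟩
  have h1 : Carries γ 1 j l := ⟨_, _, rfl, rfl, hγ 1, hγ 2⟩
  have h2 : Carries (γ * gammaGen n 1) 0 i l := by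
    refine ⟨Fin.castLE hn 0, Fin.castLE hn 1, rfl, rfl, ?_, ?_⟩
    · rw [map_mul, Equiv.Perm.mul_apply, gammaPerm_gammaGen_of_ne (by omega) (by simp) (by simp)]
      exact hγ 0
    · have e : gammaPerm n (gammaGen n 1) (Fin.castLE hn 1) = Fin.castLE hn 2 :=
        Fin.ext (gammaPerm_gammaGen_left (by omega) rfl)
      rw [map_mul, Equiv.Perm.mul_apply, e]
      exact hγ 2
  set a := gammaGen n 0
  set b := gammaGen n 1
  have hb : a * b * a = b * a * b := gammaGen_braid 0 (by omega)
  -- the two strands in positions `0` and `1` commute with the strand circling around them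
  have hc : Commute a (b * (a * a) * b) := by
    calc a * (b * (a * a) * b) = (a * b * a) * (a * b) := by group
      _ = b * a * (b * a * b) := by rw [hb]; group
      _ = b * (a * a) * b * a := by rw [← hb]; group
  have e : twist (γ * b) 0 * twist γ 1 = γ * (b * (a * a) * b) * γ⁻¹ := by
    rw [twist, twist]
    change γ * b * (a * a) * (γ * b)⁻¹ * (γ * (b * b) * γ⁻¹) = _
    group
  rw [pureSymb, pureSymb, pureSymb, ← h0.symb_twist, ← h1.symb_twist, ← h2.symb_twist,
    ← symb_mul (gammaPerm_twist h2.lt) (gammaPerm_twist h1.lt)]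
  refine symb_lie (gammaPerm_twist h0.lt) (by
    rw [map_mul, gammaPerm_twist h2.lt, gammaPerm_twist h1.lt, mul_one]) ?_
  rw [e, twist]
  exact (Commute.conj_iff γ).2 (hc.mul_left hc)

theorem pureSymb_lie_comm {i j l q : Fin n} (hij : i ≠ j) (hil : i ≠ l) (hiq : i ≠ q) (hjl : j ≠ l)
    (hjq : j ≠ q) (hlq : l ≠ q) : ⁅pureSymb k i j, pureSymb k l q⁆ = 0 := by
  have hn : 4 ≤ n := by
    have hf : Function.Injective ![i, j, l, q] := by
      intro a b
      fin_cases a <;> fin_cases b <;> simp [*, hij.symm, hil.symm, hjl.symm, hiq.symm, hjq.symm,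
        hlq.symm]
    simpa using Fintype.card_le_of_injective _ hf
  obtain ⟨γ, hγ⟩ := exists_gammaPerm_eq ![i, j, l, q] (Fin.castLE hn)
    (by
      intro a b
      fin_cases a <;> fin_cases b <;> simp [*, hij.symm, hil.symm, hjl.symm, hiq.symm, hjq.symm,
        hlq.symm])
    (Fin.castLE_injective hn)
  have h0 : Carries γ 0 i j := ⟨_, _, rfl, rfl, hγ 0, hγ 1⟩
  have h2 : Carries γ 2 l q := ⟨_, _, rfl, rfl, hγ 2, hγ 3⟩
  rw [pureSymb, pureSymb, ← h0.symb_twist, ← h2.symb_twist]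
  refine symb_lie (gammaPerm_twist h0.lt) (gammaPerm_twist h2.lt) ((Commute.conj_iff γ).2 ?_)
  have hc : Commute (gammaGen n 0) (gammaGen n 2) := gammaGen_far 0 2 (by omega) (by omega)
  exact (hc.mul_right hc).mul_left (hc.mul_right hc)

theorem gammaPerm_desc_mul_asc (hm : m ≤ n - 1) :
    gammaPerm n (descWord (gammaGen n) m * ascWord (gammaGen n) m) = 1 := by
  induction m with
  | zero => simp [descWord, ascWord]
  | succ m ih =>
    rw [descWord_mul_ascWord_succ, map_mul, map_mul, ih (by omega), mul_one, ← map_mul,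
      gammaPerm_gammaGen_sq (by omega)]

/-- The strand in position `m`, circling around the strands in positions `0, …, m - 1`. -/
theorem symb_desc_mul_asc (hm : m < n) (γ : Gamma n) :
    symb k (gammaPerm n) (γ * (descWord (gammaGen n) m * ascWord (gammaGen n) m) * γ⁻¹) =
      ∑ x ∈ seg n 0 m, pureSymb k (gammaPerm n γ x) (gammaPerm n γ ⟨m, hm⟩) := by
  induction m generalizing γ with
  | zero =>
    have : seg n 0 0 = ∅ := by ext; simp [mem_seg]
    simp [this, descWord, ascWord, symb_one]
  | succ m ih =>
    have hlt : m < n - 1 := by omega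
    set s := gammaGen n m with hs
    set y := descWord (gammaGen n) m * ascWord (gammaGen n) m with hy
    have e : γ * (s * y * s) * γ⁻¹ = γ * s * y * (γ * s)⁻¹ * twist γ m := by
      rw [twist, ← hs]; group
    have hc : Carries γ m (gammaPerm n γ ⟨m, by omega⟩) (gammaPerm n γ ⟨m + 1, hm⟩) :=
      ⟨_, _, rfl, rfl, rfl, rfl⟩
    rw [descWord_mul_ascWord_succ, ← hs, ← hy, e, symb_mul _ (gammaPerm_twist hlt),
      ih (by omega), hc.symb_twist, seg_succ (show m < n by omega), sum_union, sum_singleton]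
    · congr 1
      refine sum_congr rfl fun x hx => ?_
      have hx := (mem_seg.1 hx).2
      have e1 : gammaPerm n s x = x := gammaPerm_gammaGen_of_ne hlt (by omega) (by omega)
      have e2 : gammaPerm n s ⟨m, by omega⟩ = ⟨m + 1, hm⟩ :=
        Fin.ext (gammaPerm_gammaGen_left hlt rfl)
      rw [map_mul, Equiv.Perm.mul_apply, Equiv.Perm.mul_apply, e1, e2]
    · rw [disjoint_singleton_right, mem_seg]
      simp
    · rw [map_mul, map_mul, hy, gammaPerm_desc_mul_asc (by omega), mul_one, map_inv,
        mul_inv_cancel]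

/-- The last strand circling around all the other ones is trivial in `Γ_{0,n}`. -/
theorem desc_mul_asc_eq_one :
    descWord (gammaGen n) (n - 1) * ascWord (gammaGen n) (n - 1) = 1 := by
  have h : braidToGamma n (rhoElt n * rhoRev n) = 1 :=
    (QuotientGroup.eq_one_iff _).2 (Subgroup.subset_normalClosure (Or.inr rfl))
  have ha : ascWord (gammaGen n) (n - 1) = braidToGamma n (rhoElt n) := by
    rw [rhoElt_eq, ascWord, ascWord, map_list_prod, List.map_map]; rfl
  have hd : descWord (gammaGen n) (n - 1) = braidToGamma n (rhoRev n) := by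
    rw [rhoRev_eq, descWord, descWord, map_list_prod, List.map_reverse, List.map_map]; rfl
  rw [map_mul] at h
  rw [ha, hd, mul_eq_one_iff_eq_inv, eq_inv_of_mul_eq_one_left h, inv_inv]

/-- The turn of the strand `i` around all the others is trivial, and its symbol is this sum. -/
theorem sum_pureSymb (i : Fin n) : ∑ j ∈ univ.erase i, pureSymb k i j = 0 := by
  have hn : n - 1 < n := by have := i.2; omega
  obtain ⟨γ, hγ⟩ := exists_gammaPerm_eq ![i] ![⟨n - 1, hn⟩]
    (Function.injective_of_subsingleton _) (Function.injective_of_subsingleton _)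
  replace hγ : gammaPerm n γ ⟨n - 1, hn⟩ = i := hγ 0
  have h := symb_desc_mul_asc (k := k) hn γ
  rw [desc_mul_asc_eq_one, mul_one, mul_inv_cancel, symb_one, hγ] at h
  rw [h]
  symm
  refine sum_bij (fun x _ => gammaPerm n γ x) (fun x hx => ?_) (fun _ _ _ _ e =>
    (gammaPerm n γ).injective e) (fun y hy => ?_) fun x _ => pureSymb_comm _ _
  · have hx := (mem_seg.1 hx).2
    refine mem_erase.2 ⟨fun e => ?_, mem_univ _⟩
    have := congrArg Fin.val ((gammaPerm n γ).injective (e.trans hγ.symm))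
    change (x : ℕ) = n - 1 at this
    omega
  · refine ⟨(gammaPerm n γ)⁻¹ y, ?_, Equiv.apply_symm_apply _ _⟩
    rw [mem_seg]
    have hne : (gammaPerm n γ)⁻¹ y ≠ ⟨n - 1, hn⟩ := fun e =>
      (mem_erase.1 hy).1 (by rw [← hγ]; exact Equiv.Perm.inv_eq_iff_eq.1 e)
    have : (((gammaPerm n γ)⁻¹ y : Fin n) : ℕ) ≠ n - 1 := fun e => hne (Fin.ext e)
    omega

/-- The symbol of every pure element is a combination of the symbols of the loops. -/
theorem symb_mem_span {g : Gamma n} (hg : gammaPerm n g = 1) :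
    symb k (gammaPerm n) g ∈ Submodule.span k
      (Set.range fun p : Fin n × Fin n => symb k (gammaPerm n) (pureLoop p.1 p.2)) := by
  set V := Submodule.span k
    (Set.range fun p : Fin n × Fin n => symb k (gammaPerm n) (pureLoop p.1 p.2))
  let K : Subgroup (Gamma n) :=
    { carrier := {g | gammaPerm n g = 1 ∧ symb k (gammaPerm n) g ∈ V}
      one_mem' := ⟨map_one _, by rw [symb_one]; exact zero_mem _⟩
      mul_mem' := fun {a b} ha hb =>
        ⟨by rw [map_mul, ha.1, hb.1, mul_one], by rw [symb_mul ha.1 hb.1]; exact add_mem ha.2 hb.2⟩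
      inv_mem' := fun {a} ha =>
        ⟨by rw [map_inv, ha.1, inv_one], by rw [symb_inv ha.1]; exact neg_mem ha.2⟩ }
  suffices h : Subgroup.normalClosure {γ | ∃ i < n - 1, γ = gammaGen n i * gammaGen n i} ≤ K from
    (h (ker_gammaPerm_le hg)).2
  refine (Subgroup.closure_le _).2 fun x hx => ?_
  obtain ⟨_, ⟨i, hi, rfl⟩, hc⟩ := Group.mem_conjugatesOfSet_iff.1 hx
  obtain ⟨γ, rfl⟩ := isConj_iff.1 hc
  refine ⟨gammaPerm_twist hi, ?_⟩
  have h : Carries γ i (gammaPerm n γ ⟨i, by omega⟩) (gammaPerm n γ ⟨i + 1, by omega⟩) :=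
    ⟨_, _, rfl, rfl, rfl, rfl⟩
  change symb k (gammaPerm n) (twist γ i) ∈ V
  rw [h.symb_twist]
  exact Submodule.subset_span ⟨(_, _), rfl⟩

end TwistSymbols

/-! ### Morphisms out of `p_n` and its grading -/

section PLie

variable {k : Type u} [CommRing k] {n : ℕ}

variable (k) in
/-- The image of `t_ij` in `p_n`. -/
def pGen (i j : Fin n) : PLie k n := tToP k n (tGen k i j)

/-- A morphism out of `p_n` is given by elements satisfying the defining relations. -/
def PLie.lift {L : Type*} [LieRing L] [LieAlgebra k L] (τ : Fin n → Fin n → L)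
    (h0 : ∀ i, τ i i = 0) (hs : ∀ i j, τ j i = τ i j)
    (ht : ∀ i j l, i ≠ j → i ≠ l → j ≠ l → ⁅τ i j, τ i l + τ j l⁆ = 0)
    (hc : ∀ i j l m, i ≠ j → i ≠ l → i ≠ m → j ≠ l → j ≠ m → l ≠ m → ⁅τ i j, τ l m⁆ = 0)
    (hsum : ∀ i, ∑ j ∈ univ.erase i, τ i j = 0) : PLie k n →ₗ⁅k⁆ L :=
  LieQuot.lift (TLie.lift τ h0 hs ht hc) (by
    rintro _ ⟨i, rfl⟩
    rw [map_sum, ← hsum i]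
    exact sum_congr rfl fun j _ => TLie.lift_tGen _ _ _ _ _ _ _)

theorem PLie.lift_pGen {L : Type*} [LieRing L] [LieAlgebra k L] (τ : Fin n → Fin n → L)
    (h0 : ∀ i, τ i i = 0) (hs : ∀ i j, τ j i = τ i j)
    (ht : ∀ i j l, i ≠ j → i ≠ l → j ≠ l → ⁅τ i j, τ i l + τ j l⁆ = 0)
    (hc : ∀ i j l m, i ≠ j → i ≠ l → i ≠ m → j ≠ l → j ≠ m → l ≠ m → ⁅τ i j, τ l m⁆ = 0)
    (hsum : ∀ i, ∑ j ∈ univ.erase i, τ i j = 0) (i j : Fin n) :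
    PLie.lift τ h0 hs ht hc hsum (pGen k i j) = τ i j := TLie.lift_tGen τ h0 hs ht hc i j

theorem pGen_self (i : Fin n) : pGen k i i = 0 := by rw [pGen, tGen_self, map_zero]

theorem pGen_comm (i j : Fin n) : pGen k j i = pGen k i j := by rw [pGen, tGen_symm, pGen]

theorem lie_pGen_triangle {i j l : Fin n} (hij : i ≠ j) (hil : i ≠ l) (hjl : j ≠ l) :
    ⁅pGen k i j, pGen k i l + pGen k j l⁆ = 0 := by
  rw [pGen, pGen, pGen, ← map_add, ← LieHom.map_lie, tGen_triangle hij hil hjl, map_zero]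

theorem lie_pGen_comm {i j l m : Fin n} (hil : i ≠ l) (him : i ≠ m) (hjl : j ≠ l)
    (hjm : j ≠ m) : ⁅pGen k i j, pGen k l m⁆ = 0 := by
  rw [pGen, pGen, ← LieHom.map_lie, tGen_comm hil him hjl hjm, map_zero]

theorem sum_pGen (i : Fin n) : ∑ j ∈ univ.erase i, pGen k i j = 0 := by
  have h := tToP_sum_erase (k := k) i
  rwa [map_sum] at h

theorem pPerm_pGen (s : Equiv.Perm (Fin n)) (i j : Fin n) :
    pPerm k s (pGen k i j) = pGen k (s i) (s j) := by
  rw [pGen, pGen, ← tPerm_tGen]; rfl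

theorem lie_C_mul_X {A : Type*} [Ring A] (a b : A) :
    ⁅Polynomial.C a * Polynomial.X, Polynomial.C b * Polynomial.X⁆ =
      Polynomial.C ⁅a, b⁆ * Polynomial.X ^ 2 := by
  rw [Ring.lie_def, Ring.lie_def, map_sub, map_mul, map_mul, sub_mul, pow_two]
  congr 1 <;> rw [mul_assoc, ← mul_assoc Polynomial.X, Polynomial.X_mul_C, mul_assoc, mul_assoc]

variable (k n) in
/-- The grading of `U(p_n)` with all generators in degree one. -/
def pGrading : UniversalEnvelopingAlgebra k (PLie k n) →ₐ[k]
    Polynomial (UniversalEnvelopingAlgebra k (PLie k n)) :=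
  UniversalEnvelopingAlgebra.lift k (PLie.lift
    (fun i j => Polynomial.C (UniversalEnvelopingAlgebra.ι k (pGen k i j)) * Polynomial.X)
    (fun i => by rw [pGen_self, map_zero, map_zero, zero_mul])
    (fun i j => by rw [pGen_comm])
    (fun i j l hij hil hjl => by
      rw [← add_mul, ← map_add, ← map_add, lie_C_mul_X, ← LieHom.map_lie,
        lie_pGen_triangle hij hil hjl, map_zero, map_zero, zero_mul])
    (fun i j l m _ hil him hjl hjm _ => by
      rw [lie_C_mul_X, ← LieHom.map_lie, lie_pGen_comm hil him hjl hjm, map_zero, map_zero,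
        zero_mul])
    (fun i => by rw [← sum_mul, ← map_sum, ← map_sum, sum_pGen, map_zero, map_zero, zero_mul]))

theorem isGradedBy_pGen :
    IsGradedBy (fun p : Fin n × Fin n => pGen k p.1 p.2) (pGrading k n) where
  adjoin_eq_top := by
    set B := Algebra.adjoin k (Set.range fun p : Fin n × Fin n =>
      UniversalEnvelopingAlgebra.ι k (pGen k p.1 p.2)) with hB
    -- the elements of `p_n` lying in the subalgebra form a Lie subalgebra
    let K : LieSubalgebra k (PLie k n) :=
      { B.toSubmodule.comap
          (UniversalEnvelopingAlgebra.ι k : PLie k n →ₗ⁅k⁆ _).toLinearMap with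
        lie_mem' := fun {x y} hx hy => by
          change UniversalEnvelopingAlgebra.ι k ⁅x, y⁆ ∈ B
          rw [LieHom.map_lie, Ring.lie_def]
          exact sub_mem (mul_mem hx hy) (mul_mem hy hx) }
    have hK : ∀ x, UniversalEnvelopingAlgebra.ι k x ∈ B := by
      intro x
      obtain ⟨x, rfl⟩ := LieQuot.mk_surjective k _ x
      obtain ⟨x, rfl⟩ := LieQuot.mk_surjective k _ x
      have h := FreeLieAlgebra_lift_mem K (x := fun p : Fin n × Fin n => pGen k p.1 p.2)
        (fun p => Algebra.subset_adjoin ⟨p, rfl⟩) x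
      have e : FreeLieAlgebra.lift k (fun p : Fin n × Fin n => pGen k p.1 p.2) =
          (tToP k n).comp (TLie.mk k n) :=
        FreeLieAlgebra.hom_ext fun p => FreeLieAlgebra.lift_of_apply _ _
      rw [e] at h
      exact h
    have hι : ∀ a, a ∈ B := by
      intro a
      let f : UniversalEnvelopingAlgebra k (PLie k n) →ₐ[k] B :=
        UniversalEnvelopingAlgebra.lift k
          { toFun := fun x => ⟨_, hK x⟩
            map_add' := fun x y => Subtype.ext (map_add _ x y)
            map_smul' := fun c x => Subtype.ext (map_smul (UniversalEnvelopingAlgebra.ι k) c x)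
            map_lie' := fun {x y} => Subtype.ext (LieHom.map_lie _ x y) }
      have hf : B.val.comp f = AlgHom.id k _ := by
        apply UniversalEnvelopingAlgebra.hom_ext
        ext x
        exact congrArg Subtype.val (UniversalEnvelopingAlgebra.lift_ι_apply k _ x)
      have := DFunLike.congr_fun hf a
      rw [AlgHom.id_apply] at this
      rw [← this]
      exact (f a).2
    exact eq_top_iff.2 fun a _ => hι a
  apply_gen p := by
    rw [pGrading, UniversalEnvelopingAlgebra.lift_ι_apply]
    exact PLie.lift_pGen _ _ _ _ _ _ _ _

variable (k n) in
/-- The morphism from `p_n` to the associated graded algebra of `Γ_{0,n}`, relative to `S_n`. -/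
def pToGraded : PLie k n →ₗ⁅k⁆ AssocGraded k (relIdeal k (gammaPerm n)) :=
  PLie.lift (pureSymb k) pureSymb_self pureSymb_comm
    (fun _ _ _ hij hil hjl => pureSymb_triangle hij hil hjl)
    (fun _ _ _ _ hij hil him hjl hjm hlm => pureSymb_lie_comm hij hil him hjl hjm hlm)
    sum_pureSymb

theorem pToGraded_pGen (i j : Fin n) : pToGraded k n (pGen k i j) = pureSymb k i j :=
  PLie.lift_pGen _ _ _ _ _ _ _ _

end PLie

/-! ### Leading terms of the images of the twists -/

section LeadingTerms

theorem ExpGroup.expOf_sub_mem {k : Type u} [CommRing k] [Algebra ℚ k] {L : Type*} [LieRing L]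
    [LieAlgebra k L] (y : L) : (ExpGroup.toUnits (expOf (k := k) y) : UHat k L) - 1 -
      Compl.of (augIdeal k L) (UniversalEnvelopingAlgebra.ι k y) ∈ Compl.fil (augIdeal k L) 2 := by
  rw [Compl.mem_fil, map_sub, map_sub]
  change truncExp k 2 (Ideal.Quotient.mk (augIdeal k L ^ 2) (UniversalEnvelopingAlgebra.ι k y)) -
    _ - _ = 0
  rw [truncExp, sum_range_succ, sum_range_one, map_one, Compl.proj_of]
  simp

theorem ExpGroup.conj_sub_mem {k : Type u} [CommRing k] [Algebra ℚ k] {L : Type*} [LieRing L]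
    [LieAlgebra k L] (v w : ExpGroup k L) {z : UHat k L} (hz : z ∈ Compl.fil (augIdeal k L) 1)
    (h : (ExpGroup.toUnits w : UHat k L) - 1 - z ∈ Compl.fil (augIdeal k L) 2) :
    (ExpGroup.toUnits (v * w * v⁻¹) : UHat k L) - 1 - z ∈ Compl.fil (augIdeal k L) 2 := by
  set a : UHat k L := (ExpGroup.toUnits v : UHat k L)
  set b : UHat k L := (ExpGroup.toUnits w : UHat k L)
  set c : UHat k L := ((ExpGroup.toUnits v⁻¹ : (UHat k L)ˣ) : UHat k L) with hc
  have hac : a * c = 1 := by rw [hc, map_inv]; exact Units.mul_inv _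
  have e : (ExpGroup.toUnits (v * w * v⁻¹) : UHat k L) - 1 - z =
      a * (b - 1 - z) * c + ((a - 1) * z * c + z * (c - 1)) := by
    rw [map_mul, map_mul, Units.val_mul, Units.val_mul]
    change a * b * c - 1 - z = _
    have e' : a * (b - 1 - z) * c + ((a - 1) * z * c + z * (c - 1)) = a * b * c - a * c - z := by
      noncomm_ring
    rw [e', hac]
  have h1 : (a - 1) * z ∈ Compl.fil (augIdeal k L) (1 + 1) :=
    Compl.mul_mem_fil (ExpGroup.toUnits_sub_one_mem v) hz
  have h2 : z * (c - 1) ∈ Compl.fil (augIdeal k L) (1 + 1) :=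
    Compl.mul_mem_fil hz (ExpGroup.toUnits_sub_one_mem v⁻¹)
  rw [e]
  exact add_mem (Ideal.mul_mem_right _ _ (Ideal.mul_mem_left _ _ h))
    (add_mem (Ideal.mul_mem_right _ _ h1) h2)

variable {k : Type u} [CommRing k] [Algebra ℚ k] {n : ℕ} {μ : k} {Φ : ExpGroup k (FreeLie2 k)}

theorem expHalf_mul_self {L : Type*} [LieRing L] [LieAlgebra k L] (μ : k) (x : L) :
    expHalf μ x * expHalf μ x = expOf (μ • x) := by
  have h2 : algebraMap ℚ k (1 / 2) + algebraMap ℚ k (1 / 2) = 1 := by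
    rw [← map_add, ← map_one (algebraMap ℚ k)]; norm_num
  rw [← expHalf_add μ (lie_self x), expHalf, smul_add, ← add_smul, ← mul_add, h2, mul_one]

theorem sigmaImage_mul_self (t : FreeMagma Unit) (i : Fin (n - 1)) :
    ∃ v, sigmaImage μ Φ t i * sigmaImage μ Φ t i = SemidirectProduct.inl
      (v * expOf (μ • tGen k (strand i) (strandSucc i)) * v⁻¹) := by
  refine ⟨(combElt Φ n 0 t)⁻¹ * (assocElt Φ (seg n 0 i) {strand i} {strandSucc i})⁻¹, ?_⟩
  rw [← expHalf_mul_self]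
  set e := expHalf μ (tGen k (strand i) (strandSucc i)) with he
  have hs : (SemidirectProduct.inr (adjSwap i) : ExpT k n) * SemidirectProduct.inl e *
      SemidirectProduct.inr (adjSwap i) = SemidirectProduct.inl e := by
    have h := SemidirectProduct.inl_aut (φ := expAct (tPerm k) (tPerm_one k) (tPerm_mul k))
      (adjSwap i) e
    have h1 : expAct (tPerm k) (tPerm_one k) (tPerm_mul k) (adjSwap i) e = e := by
      change expMap (tPerm k (adjSwap i)) e = e
      rw [he, expMap_expHalf, tPerm_tGen, adjSwap, Equiv.swap_apply_left, Equiv.swap_apply_right,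
        tGen_symm]
    have h2 : (adjSwap i)⁻¹ = adjSwap i := Equiv.swap_inv _ _
    rw [h1, h2] at h
    exact h.symm
  rw [sigmaImage, leftImage, ← he]
  simp only [map_mul, map_inv, mul_inv_rev, inv_inv]
  generalize (SemidirectProduct.inl (combElt Φ n 0 t) : ExpT k n) = a
  generalize (SemidirectProduct.inl (assocElt Φ (seg n 0 i) {strand i} {strandSucc i}) :
    ExpT k n) = b
  generalize (SemidirectProduct.inl e : ExpT k n) = x at hs ⊢
  generalize (SemidirectProduct.inr (adjSwap i) : ExpT k n) = s at hs ⊢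
  calc a⁻¹ * (b⁻¹ * x * s * b) * a * (a⁻¹ * (b⁻¹ * x * s * b) * a)
      = a⁻¹ * b⁻¹ * x * (s * x * s) * b * a := by group
    _ = _ := by rw [hs]; group

variable (hΦ : IsAssociator μ Φ) (hn : n ≠ 0) (t : FreeMagma Unit)

theorem gammaHom_right (γ : Gamma n) : (gammaHom hΦ hn t γ).right = gammaPerm n γ := by
  obtain ⟨b, rfl⟩ := braidToGamma_surjective γ
  have h : SemidirectProduct.rightHom.comp ((expTToExpP k n).comp (treeHom hΦ n t)) =
      braidPerm n := by
    refine PresentedGroup.ext fun i => ?_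
    change (expTToExpP k n (treeHom hΦ n t (sigma i))).right = braidPerm n (sigma i)
    rw [treeHom_sigma, braidPerm_sigma]
    change (sigmaImage μ Φ t i).right = _
    simp [sigmaImage, leftImage]
  exact DFunLike.congr_fun h b

/-- The image of `σ_m ^ 2` is conjugate in `exp` to the exponential of `μ` times a generator.
Conjugation in `exp` does not change the leading term, so that `γ` acts on it only through its
permutation. -/
theorem gammaHom_twist {γ : Gamma n} {m : ℕ} {i j : Fin n} (h : Carries γ m i j) :
    (ExpGroup.toUnits (gammaHom hΦ hn t (twist γ m)).left : UHat k (PLie k n)) - 1 -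
      μ • Compl.of (augIdeal k (PLie k n)) (UniversalEnvelopingAlgebra.ι k (pGen k i j)) ∈
        Compl.fil (augIdeal k (PLie k n)) 2 := by
  have hm := h.lt
  obtain ⟨a, b, ha, hb, rfl, rfl⟩ := h
  obtain rfl : a = strand ⟨m, hm⟩ := Fin.ext ha
  obtain rfl : b = strandSucc ⟨m, hm⟩ := Fin.ext hb
  obtain ⟨v, hv⟩ := sigmaImage_mul_self (n := n) (μ := μ) (Φ := Φ) t ⟨m, hm⟩
  set x := tGen k (strand (n := n) ⟨m, hm⟩) (strandSucc ⟨m, hm⟩) with hx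
  have e1 : gammaHom hΦ hn t (gammaGen n m * gammaGen n m) = SemidirectProduct.inl
      (expMap (tToP k n) (v * expOf (μ • x) * v⁻¹)) := by
    rw [gammaGen, ← map_mul, gammaHom_braidToGamma, map_mul (treeHom hΦ n t), sigmaNat_of_lt hm,
      treeHom_sigma, hv, expTToExpP_inl]
  set w := (gammaHom hΦ hn t γ).left with hw
  set s := gammaPerm n γ with hs
  have e2 : gammaHom hΦ hn t γ = SemidirectProduct.inl w * SemidirectProduct.inr s := by
    rw [hs, ← gammaHom_right hΦ hn t, hw, SemidirectProduct.inl_left_mul_inr_right]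
  have e3 : gammaHom hΦ hn t (twist γ m) = SemidirectProduct.inl
      (w * expMap (pPerm k s) (expMap (tToP k n) (v * expOf (μ • x) * v⁻¹)) * w⁻¹) := by
    rw [twist, map_mul, map_mul, map_inv, e1, e2]
    have h := SemidirectProduct.inl_aut (φ := expAct (pPerm k) (pPerm_one k) (pPerm_mul k)) s
      (expMap (tToP k n) (v * expOf (μ • x) * v⁻¹))
    change SemidirectProduct.inl (expMap (pPerm k s) _) = _ at h
    generalize expMap (tToP k n) (v * expOf (μ • x) * v⁻¹) = y at h ⊢
    rw [map_mul, map_mul, h, map_inv, map_inv]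
    group
  have e4 : expMap (pPerm k s) (expMap (tToP k n) (expOf (μ • x))) =
      expOf (μ • pGen k (s (strand ⟨m, hm⟩)) (s (strandSucc ⟨m, hm⟩))) := by
    rw [← pPerm_pGen, pGen, expMap_expOf, expMap_expOf, map_smul, map_smul]
  have e5 : (gammaHom hΦ hn t (twist γ m)).left =
      w * expMap (pPerm k s) (expMap (tToP k n) v) *
        expOf (μ • pGen k (s (strand ⟨m, hm⟩)) (s (strandSucc ⟨m, hm⟩))) *
        (w * expMap (pPerm k s) (expMap (tToP k n) v))⁻¹ := by
    rw [e3, SemidirectProduct.left_inl, ← e4]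
    simp only [map_mul, map_inv]
    group
  rw [e5, ← Compl.of_smul, ← map_smul]
  refine ExpGroup.conj_sub_mem _ _ ?_ (ExpGroup.expOf_sub_mem _)
  rw [Compl.of_mem_fil, Submodule.pow_one]
  exact ι_mem_augIdeal _

/-- The expansion of `Γ_{0,n}`, relative to `S_n`, attached to an associator with invertible
coupling constant and a parenthesization. -/
def gammaExpansion (hμ : IsUnit μ) :
    Expansion k (PLie k n) (gammaPerm n) (Fin n × Fin n) where
  act := pPerm k
  act_one := pPerm_one k
  u γ := (ExpGroup.toUnits (gammaHom hΦ hn t γ).left : UHat k (PLie k n))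
  u_one := by rw [map_one, SemidirectProduct.one_left, map_one, Units.val_one]
  u_mul g h := by
    rw [map_mul, SemidirectProduct.mul_left, map_mul, Units.val_mul, gammaHom_right]
    rfl
  u_sub_one_mem γ := ExpGroup.toUnits_sub_one_mem _
  surjective := gammaPerm_surjective
  loop p := pureLoop p.1 p.2
  map_loop p := gammaPerm_pureLoop _ _
  gen p := pGen k p.1 p.2
  μ := μ
  isUnit_μ := hμ
  u_loop p := by
    obtain ⟨i, j⟩ := p
    change _ - 1 - μ • Compl.of _ (UniversalEnvelopingAlgebra.ι k (pGen k i j)) ∈ _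
    dsimp only
    by_cases h : ∃ γ, Carries γ (n - 2) i j
    · rw [pureLoop, dif_pos h]
      exact gammaHom_twist hΦ hn t h.choose_spec
    · have hij : i = j := by
        by_contra hij
        exact h (exists_carries hij)
      rw [pureLoop, dif_neg h, hij, pGen_self, map_one, SemidirectProduct.one_left, map_one,
        Units.val_one, map_zero, map_zero, smul_zero, sub_self, sub_self]
      exact zero_mem _
  δ := pGrading k n
  graded := isGradedBy_pGen
  mem_span g hg := exists_sub_mem_of_symb_mem_span (fun p => gammaPerm_pureLoop p.1 p.2) hg
    (symb_mem_span hg)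
  θ := pToGraded k n
  θ_gen p := by
    rw [pToGraded_pGen, pureSymb, symb_of_mem (gammaPerm_pureLoop _ _)]

end LeadingTerms

end GenusZero

end

theorem mainTheorem8 {k : Type u} [CommRing k] [Algebra ℚ k]
    (n : ℕ) (t : FreeMagma Unit) (ht : t.length = n)
    (μ : k) (Φ : ExpGroup k (FreeLie2 k)) (hΦ : IsAssociator μ Φ) :
    -- the morphism `i_{t,Φ}`
    ∃ i : BraidGroup n →* ExpT k n, (∀ j, i (sigma j) = sigmaImage μ Φ t j) ∧
      -- it descends to a unique morphism
      (∃! f : Gamma n →* ExpP k n, ∀ b, f (braidToGamma n b) = expTToExpP k n (i b)) ∧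
      -- which induces an isomorphism if `μ` is invertible
      ∀ f : Gamma n →* ExpP k n, (∀ b, f (braidToGamma n b) = expTToExpP k n (i b)) →
        IsUnit μ →
          ∃! F : RelCompletion k (gammaPerm n) ≃* ExpP k n, IsInducedBy (gammaPerm n) f F := by
  have hn : n ≠ 0 := ht ▸ t.length_pos.ne'
  have huniq : ∀ f : Gamma n →* ExpP k n,
      (∀ b, f (braidToGamma n b) = expTToExpP k n (treeHom hΦ n t b)) → f = gammaHom hΦ hn t := by
    intro f hf
    refine MonoidHom.ext fun γ => ?_
    obtain ⟨b, rfl⟩ := braidToGamma_surjective γ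
    rw [hf, gammaHom_braidToGamma]
  refine ⟨treeHom hΦ n t, treeHom_sigma hΦ t,
    ⟨gammaHom hΦ hn t, gammaHom_braidToGamma hΦ hn t, huniq⟩, fun f hf hμ => ?_⟩
  obtain rfl := huniq f hf
  exact (gammaExpansion hΦ hn t hμ).existsUnique_isInducedBy (fun γ => ExpGroup.map_diag _)
    (fun s v => rfl) (gammaHom_right hΦ hn t) fun γ => rfl
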